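/- Setting. Let $\alpha\in(0,1)$ and $0<\varepsilon_0\le\frac14$. For $0\le\varepsilon<\varepsilon_0$ let $T_\varepsilon:[0,1]\to[0,1]$ be $$T_\varepsilon(x)=\begin{cases}x+4^{\alpha}(1+4\varepsilon)x^{1+\alpha},&0\le x<\frac14,\\ -4(1+2\varepsilon)x+\frac32+3\varepsilon,&\frac14\le x<\frac38,\\ 4x-\frac32,&\frac38\le x<\frac12,\\ T_{4,\varepsilon}(x),&\frac12\le x\le1,\end{cases}$$ where $T_{4,\varepsilon}$ is continuous with finitely many branches: there are $M\ge1$ and branch points $\frac12=c_0(\varepsilon)<c_1(\varepsilon)<\dots<c_{2M+1}(\varepsilon)=1$, continuous in $\varepsilon$, such that on $[c_j(\varepsilon),c_{j+1}(\varepsilon)]$ one has $T_{4,\varepsilon}=g_j(\varepsilon,\cdot)$ with $g_j:\mathbb R^2\to\mathbb R$ of class $C^2$ and $|\partial_xg_j(\varepsilon,x)|>2$; $T_{4,\varepsilon}(c_j(\varepsilon))=1$ for odd $j$; $T_{4,\varepsilon}(c_j(\varepsilon))=\frac12$ for even $j$, with the exception of one even index $2p$, $1\le p\le M$, for which $c_{2p}(\varepsilon)=s_r$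 does not depend on $\varepsilon$ and $T_{4,\varepsilon}(s_r)=\frac12-\varepsilon$. Let $\Delta=[\frac14,1]$, $b=\frac12$, $\Delta_l=[\frac14,b]$, $\Delta_r=[b,1]$. Let $\hat T_\varepsilon:\Delta\to\Delta$ be the map induced by $T_\varepsilon$ on $\Delta$: $\hat T_\varepsilon(x)=T_\varepsilon^{n}(x)$, where $n\ge1$ is the first time with $T^n_\varepsilon(x)\in(\frac14,1]$ (using $(\frac14,1]$ instead of $\Delta$ only fixes the values at end points of branches), and $\hat T_\varepsilon(\frac38)=\frac38$ at the point $\frac38$, which never returns. Write $\hat T=\hat T_0$. An a.c.i.m. is an invariant probability measure on $\Delta$ that is absolutely continuous with respect to Lebesgue measure. A countable partition of $\Delta$ is a sequence of pairwise disjoint nonempty open intervals $I_i=(q_i^-,q_i^+)$ with closures in $\Delta$ that cover $\Delta$ up to a countable set; its set of partition points is $\mathcal C=\Delta\setminus\bigcup_iI_i$. Lemma. $\hat T_\varepsilon(\Delta)\subseteq\Delta$ for $0\le\varepsilon<\varepsilon_0$. There are probability measures $\hat\mu_l,\hat\mu_r$ with densities $\hat h_l$ on $\Delta_l$ and $\hat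 h_r$ on $\Delta_r$, countable partitions $I_{i,\varepsilon}=(q^-_{i,\varepsilon},q^+_{i,\varepsilon})$, $0\le\varepsilon<\varepsilon_0$, with partition points $\mathcal C_\varepsilon$, a number $\delta>0$ and $C^2$ functions $\bar T_{i,\varepsilon}$ such that the following holds. (1) $\hat h_l$ and $\hat h_r$ are Lipschitz continuous and bounded away from $0$ on $\Delta_l$ and $\Delta_r$ respectively. (2) For $\varepsilon=0$: (A1) $\hat T|_{I_{i,0}}$ is $C^2$ and extends to the $C^2$ function $\bar T_{i,0}$ on $[q^-_{i,0}-\delta,q^+_{i,0}+\delta]$. (A2) $\inf_{x\in\Delta\setminus\mathcal C_0}|\hat T'(x)|\ge\beta_0^{-1}>2$ for some $\beta_0>0$. (A3) The sets $\hat T(I_{i,0})$ are finitely many different intervals. (A4) $b$ is an interior point of $\Delta$, $\Delta_l\cup\Delta_r=\Delta$, $\Delta_l\cap\Delta_r=\{b\}$, $\hat T(\Delta_l)\subseteq\Delta_l$ and $\hat T(\Delta_r)\subseteq\Delta_r$. (A5) With $H_0=\hat T^{-1}\{b\}\setminus\{b\}$, $\hat T^n(\mathcal C_0)\cap H_0=\emptyset$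 for all $n\ge1$. (A6) $\sup_i\sup_{x\in I_{i,0}}|D^2\hat T(x)|/(D\hat T(x))^2<\infty$; $\hat T$ has exactly two ergodic a.c.i.m.s, namely $\hat\mu_l$ and $\hat\mu_r$, which are supported on $\Delta_l$ and $\Delta_r$; and $\hat h_l>0$ on $H_0\cap\Delta_l$, $\hat h_r>0$ on $H_0\cap\Delta_r$. (3) For $0<\varepsilon<\varepsilon_0$: (B1) $\varepsilon\mapsto q^\pm_{i,\varepsilon}$ is $C^2$ on $[0,\varepsilon_0)$; for all sufficiently small $\varepsilon$ and all $i$, $[q^-_{i,\varepsilon},q^+_{i,\varepsilon}]\subset[q^-_{i,0}-\delta,q^+_{i,0}+\delta]$; $\bar T_{i,\varepsilon}$ is a $C^2$ extension of $\hat T_\varepsilon|_{I_{i,\varepsilon}}$, and for each $i$, $\bar T_{i,\varepsilon}\to\bar T_{i,0}$ in $C^2([q^-_{i,0}-\delta,q^+_{i,0}+\delta])$ as $\varepsilon\to0^+$. (B2) For each $\varepsilon$ the sets $\hat T_\varepsilon(I_{i,\varepsilon})$ are finitely many different intervals. (B3) $\hat T_\varepsilon$ has a unique a.c.i.m. (B4)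 $\hat T_\varepsilon(b)=b$ for all $0\le\varepsilon<\varepsilon_0$. Moreover, if $T_\varepsilon$ is of class $C^2$ near $b$ for all $0\le\varepsilon<\varepsilon_0$, then: (i) if $b\notin\mathcal C_0$, then $\hat T(b)=b$ and $\hat T_\varepsilon(b)=b$ for all $\varepsilon>0$; (ii) if $b\in\mathcal C_0$, then $\hat T(b-)<b<\hat T(b+)$ and $b\in\mathcal C_\varepsilon$ for all $\varepsilon>0$. (4) With $\hat H_{l,\varepsilon}=\Delta_l\cap\hat T_\varepsilon^{-1}(\Delta_r)$ and $\hat H_{r,\varepsilon}=\Delta_r\cap\hat T_\varepsilon^{-1}(\Delta_l)$, the limit $$\lim_{\varepsilon\to0^+}\frac{\hat\mu_r(\hat H_{r,\varepsilon})}{\hat\mu_l(\hat H_{l,\varepsilon})}$$ exists and is different from $0$ and $\infty$. -/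

import Mathlib

open Set Filter Topology MeasureTheory

noncomputable section

/-! ### The intermittent map, its perturbation, and the induced map -/

/-- The class of admissible right components `T4 ε : [1/2, 1] → [0, 1]`, `0 ≤ ε < ε₀`.
There are `2 * M + 1` branches, with branch points `1/2 = c 0 ε < c 1 ε < ⋯ < c (2 * M + 1) ε = 1`;
on the `j`-th one `T4 ε` coincides with `g j ε`, where `g j` is `C²` in `(ε, x)`, and has slope of
absolute value larger than `2`.  The relative maxima (odd `j`) have height `1`, the relative minima
(even `j`) have height `1/2`, except for a single spike of height `ε` below `1/2`, located at one
interior relative minimum `c (2 * p) ε = s` that does not move with `ε`. -/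
def IsRightFamily (ε₀ : ℝ) (T4 : ℝ → ℝ → ℝ) : Prop :=
  ∃ (M p : ℕ) (s : ℝ) (c : ℕ → ℝ → ℝ) (g : ℕ → ℝ → ℝ → ℝ),
    1 ≤ p ∧ p ≤ M ∧
    (∀ j < 2 * M + 1, ContDiff ℝ 2 (fun z : ℝ × ℝ => g j z.1 z.2)) ∧
    (∀ j ≤ 2 * M + 1, ContinuousOn (c j) (Ico 0 ε₀)) ∧
    ∀ ε ∈ Ico 0 ε₀,
      c 0 ε = 1 / 2 ∧ c (2 * M + 1) ε = 1 ∧ c (2 * p) ε = s ∧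
      (∀ j < 2 * M + 1, c j ε < c (j + 1) ε) ∧
      (∀ j < 2 * M + 1, EqOn (T4 ε) (g j ε) (Icc (c j ε) (c (j + 1) ε))) ∧
      (∀ j < 2 * M + 1, ∀ x ∈ Icc (c j ε) (c (j + 1) ε), 2 < |deriv (g j ε) x|) ∧
      (∀ j ≤ 2 * M + 1, Odd j → T4 ε (c j ε) = 1) ∧
      (∀ j ≤ 2 * M + 1, Even j → j ≠ 2 * p → T4 ε (c j ε) = 1 / 2) ∧
      T4 ε s = 1 / 2 - ε

/-- The map `T_ε` of `[0, 1]` with parameter `α` and right component `T4 ε`, extended to the line by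
the identity outside `[0, 1]`. -/
def intermittentMap (α : ℝ) (T4 : ℝ → ℝ → ℝ) (ε x : ℝ) : ℝ :=
  if x < 0 then x
  else if x < 1 / 4 then x + (4 : ℝ) ^ α * (1 + 4 * ε) * x ^ (1 + α)
  else if x < 3 / 8 then -4 * (1 + 2 * ε) * x + 3 / 2 + 3 * ε
  else if x < 1 / 2 then 4 * x - 3 / 2
  else if x ≤ 1 then T4 ε x
  else x

/-- The first time `n ≥ 1` at which the orbit of `x` is in `A` (`0` if there is none). -/
def returnTime (T : ℝ → ℝ) (A : Set ℝ) (x : ℝ) : ℕ :=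
  sInf {n : ℕ | 1 ≤ n ∧ T^[n] x ∈ A}

/-- The domain `Δ = [a₀, 1]`, `a₀ = 1/4`, of the induced map. -/
def indDom : Set ℝ := Icc (1 / 4) 1

/-- `Δ_l = [a₀, b]`, where `b = 1/2`. -/
def indDomL : Set ℝ := Icc (1 / 4) (1 / 2)

/-- `Δ_r = [b, 1]`, where `b = 1/2`. -/
def indDomR : Set ℝ := Icc (1 / 2) 1

/-- The induced map of `T_ε` on `Δ = [1/4, 1]`.  Returns are counted to `(1/4, 1]`: this only fixes
the values at the end points of the branches (those adjacent to `3/8` are taken on `[a_{n-1}, a_n)`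
and `(a'_n, a'_{n-1}]`) and leaves the map unchanged in the interior of every branch.  The point
`3/8`, which never returns, is kept fixed. -/
def inducedMap (α : ℝ) (T4 : ℝ → ℝ → ℝ) (ε x : ℝ) : ℝ :=
  (intermittentMap α T4 ε)^[returnTime (intermittentMap α T4 ε) (Ioc (1 / 4) 1) x] x

/-! ### Countable partitions and invariant measures -/

/-- The open intervals `(l i, r i)` are pairwise disjoint, lie in `Δ`, and cover it up to a
countable set. -/
def IsIntervalPartition (Δ : Set ℝ) (l r : ℕ → ℝ) : Prop :=
  (∀ i, l i < r i) ∧ (∀ i, Icc (l i) (r i) ⊆ Δ) ∧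
  (∀ i j, i ≠ j → Disjoint (Ioo (l i) (r i)) (Ioo (l j) (r j))) ∧
  (Δ \ ⋃ i, Ioo (l i) (r i)).Countable

/-- The set of partition points: the end points of the intervals and their accumulation points. -/
def partitionPoints (Δ : Set ℝ) (l r : ℕ → ℝ) : Set ℝ :=
  Δ \ ⋃ i, Ioo (l i) (r i)

/-- `μ` is an absolutely continuous `F`-invariant probability measure on `Δ`. -/
def IsACIM (F : ℝ → ℝ) (Δ : Set ℝ) (μ : Measure ℝ) : Prop :=
  IsProbabilityMeasure μ ∧ μ ≪ volume.restrict Δ ∧ MeasurePreserving F μ μ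

/-- `h` is the density of a measure `μ` carried by `S`. -/
def IsDensityOn (μ : Measure ℝ) (h : ℝ → ℝ) (S : Set ℝ) : Prop :=
  (∀ x ∈ S, 0 ≤ h x) ∧ μ = (volume.restrict S).withDensity (fun x => ENNReal.ofReal (h x))

/-- The infinitesimal holes `H₀ = F⁻¹{b} \ {b}`. -/
def infHoles (F : ℝ → ℝ) (Δ : Set ℝ) (b : ℝ) : Set ℝ :=
  {x | x ∈ Δ ∧ F x = b} \ {b}

/-! ### Conditions on the expanding map `F : Δ → Δ` -/

/-- (A1): `F` is `C²` on each interval of a countable partition, and its restriction to the `i`-th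
interval has a `C²` extension `Fbar i` to the `δ`-neighbourhood.  (A `C²` function on a compact
interval is represented by a `C²` function on the line; only its values on the interval matter.) -/
def CondA1 (F : ℝ → ℝ) (Δ : Set ℝ) (l r : ℕ → ℝ) (δ : ℝ) (Fbar : ℕ → ℝ → ℝ) : Prop :=
  IsIntervalPartition Δ l r ∧ 0 < δ ∧
  ∀ i, ContDiffOn ℝ 2 F (Ioo (l i) (r i)) ∧ ContDiff ℝ 2 (Fbar i) ∧
    EqOn (Fbar i) F (Ioo (l i) (r i))

/-- (A2): uniform expansion by a factor larger than `2` off the partition points. -/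
def CondA2 (F : ℝ → ℝ) (Δ : Set ℝ) (l r : ℕ → ℝ) : Prop :=
  ∃ β₀ : ℝ, 0 < β₀ ∧ 2 < β₀⁻¹ ∧ ∀ x ∈ Δ \ partitionPoints Δ l r, β₀⁻¹ ≤ |deriv F x|

/-- (A3), and (B2): the images of the partition intervals are finitely many different intervals. -/
def CondA3 (F : ℝ → ℝ) (l r : ℕ → ℝ) : Prop :=
  (∀ i, (F '' Ioo (l i) (r i)).OrdConnected) ∧
  (range fun i => F '' Ioo (l i) (r i)).Finite

/-- (A4): `Δ` splits at an interior point `b` into two invariant intervals. -/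
def CondA4 (F : ℝ → ℝ) (Δ Δl Δr : Set ℝ) (b : ℝ) : Prop :=
  b ∈ interior Δ ∧ Δl.OrdConnected ∧ Δr.OrdConnected ∧ Δl ∪ Δr = Δ ∧ Δl ∩ Δr = {b} ∧
  MapsTo F Δl Δl ∧ MapsTo F Δr Δr

/-- (A5): no partition point is ever mapped to an infinitesimal hole. -/
def CondA5 (F : ℝ → ℝ) (Δ : Set ℝ) (b : ℝ) (l r : ℕ → ℝ) : Prop :=
  ∀ n : ℕ, 1 ≤ n → (F^[n] '' partitionPoints Δ l r) ∩ infHoles F Δ b = ∅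

/-- (A6): Adler's condition; moreover `μl` and `μr`, with densities `hl` and `hr`, are exactly the
ergodic a.c.i.m.s of `F`, they are supported on `Δl` and `Δr` respectively, and each density is
positive at the infinitesimal holes in its support. -/
def CondA6 (F : ℝ → ℝ) (Δ Δl Δr : Set ℝ) (b : ℝ) (l r : ℕ → ℝ)
    (μl μr : Measure ℝ) (hl hr : ℝ → ℝ) : Prop :=
  (∃ D : ℝ, 0 < D ∧ ∀ i, ∀ x ∈ Ioo (l i) (r i),
    |deriv (deriv F) x| / (deriv F x) ^ 2 ≤ D) ∧
  μl ≠ μr ∧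
  (∀ μ : Measure ℝ, (IsACIM F Δ μ ∧ Ergodic F μ) ↔ (μ = μl ∨ μ = μr)) ∧
  μl.support = Δl ∧ μr.support = Δr ∧
  IsDensityOn μl hl Δl ∧ IsDensityOn μr hr Δr ∧
  (∀ x ∈ infHoles F Δ b ∩ Δl, 0 < hl x) ∧ (∀ x ∈ infHoles F Δ b ∩ Δr, 0 < hr x)

/-! ### Conditions on the perturbations `F ε`, `0 < ε < ε₀`, of `F 0`

The intervals `(l 0 i, r 0 i)`, the number `δ` and the extensions `Fbar 0 i` are those of (A1). -/

/-- (B1): the perturbed partitions depend `C²`-smoothly on `ε` and, for small `ε`, stay in the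
`δ`-neighbourhoods; the branches have `C²` extensions that converge to the unperturbed ones in the
`C²` topology of the closed `δ`-neighbourhoods. -/
def CondB1 (F : ℝ → ℝ → ℝ) (Δ : Set ℝ) (ε₀ : ℝ) (l r : ℝ → ℕ → ℝ) (δ : ℝ)
    (Fbar : ℝ → ℕ → ℝ → ℝ) : Prop :=
  (∀ ε ∈ Ioo 0 ε₀, IsIntervalPartition Δ (l ε) (r ε)) ∧
  (∀ i, ContDiffOn ℝ 2 (fun ε => l ε i) (Ico 0 ε₀) ∧
    ContDiffOn ℝ 2 (fun ε => r ε i) (Ico 0 ε₀)) ∧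
  (∃ ε₁ > 0, ∀ ε ∈ Ioo 0 ε₀, ε < ε₁ → ∀ i,
    Icc (l ε i) (r ε i) ⊆ Icc (l 0 i - δ) (r 0 i + δ)) ∧
  (∀ ε ∈ Ioo 0 ε₀, ∀ i, ContDiff ℝ 2 (Fbar ε i) ∧
    EqOn (Fbar ε i) (F ε) (Ioo (l ε i) (r ε i))) ∧
  (∀ i, ∀ k ≤ 2, TendstoUniformlyOn (fun ε => iteratedDeriv k (Fbar ε i))
    (iteratedDeriv k (Fbar 0 i)) (𝓝[>] 0) (Icc (l 0 i - δ) (r 0 i + δ)))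

/-- (B2): for each `ε`, finitely many different images. -/
def CondB2 (F : ℝ → ℝ → ℝ) (ε₀ : ℝ) (l r : ℝ → ℕ → ℝ) : Prop :=
  ∀ ε ∈ Ioo 0 ε₀, CondA3 (F ε) (l ε) (r ε)

/-- (B3): for each `ε`, a unique a.c.i.m. -/
def CondB3 (F : ℝ → ℝ → ℝ) (Δ : Set ℝ) (ε₀ : ℝ) : Prop :=
  ∀ ε ∈ Ioo 0 ε₀, ∃! μ : Measure ℝ, IsACIM (F ε) Δ μ

/-- (B4): the boundary condition at `b`. -/
def CondB4 (F : ℝ → ℝ → ℝ) (Δ : Set ℝ) (b ε₀ : ℝ) (l r : ℝ → ℕ → ℝ) : Prop :=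
  (b ∉ partitionPoints Δ (l 0) (r 0) → F 0 b = b ∧ ∀ ε ∈ Ioo 0 ε₀, F ε b = b) ∧
  (b ∈ partitionPoints Δ (l 0) (r 0) →
    (∃ u v : ℝ, Tendsto (F 0) (𝓝[<] b) (𝓝 u) ∧ Tendsto (F 0) (𝓝[>] b) (𝓝 v) ∧ u < b ∧ b < v) ∧
    ∀ ε ∈ Ioo 0 ε₀, b ∈ partitionPoints Δ (l ε) (r ε))

/-- The hole `A ∩ F⁻¹ B` through which mass leaks from `A` to `B`. -/
def hole (F : ℝ → ℝ) (A B : Set ℝ) : Set ℝ := A ∩ F ⁻¹' B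

end

/-! At ε = 0 the induced map has full branches: each left branch is mapped onto (1/4, 1/2), each
right branch onto (1/2, 1), with slopes bounded below by a constant larger than 2 and with bounded
distortion. On the left the distortion bound survives arbitrarily long passages near the neutral
fixed point 0: for the n-th iterate y of the neutral branch one has y'' y ≤ 2 (y')²
(`neutralD2_bound`), and y > 1/4 at a return, so Adler's quotient is at most 8.

One mechanism governs the invariant measures. Densities with 2D-Lipschitz logarithm are preserved by
every branch (`IsPiecewiseExpanding.map_branch`). Such a density on an interval W is pushed to
densities of the same kind on complete images, plus at most two pieces coming from branches cut by
the ends of W, and these are lower by the factor lam (`IsPiecewiseExpanding.step`). Since lam > 2,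
the cut pieces die out geometrically. This gives a criterion for an invariant set to be full
(`null_compl_of_invariant`) and a uniform bound for the push-forwards of Lebesgue measure
(`exists_bound`), from which Cesàro means produce an a.c.i.m. (`exists_invariant_of_bound`). With a
single full image there are no cut pieces, and averaging the densities themselves gives a Lipschitz
density bounded away from zero (`exists_lipschitz_density`).

For ε > 0 mass crosses 1/2 both ways: left branches overshoot to 1/2 + ε, the spike undershoots to
1/2 - ε. As 1/2 is a repelling fixed point on both sides, an invariant set that is null on one side
is null everywhere (`trivial_of_invariant`), so the a.c.i.m. is unique.

The branch points solve equations with nonvanishing derivative, so they are C² in ε by the implicit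
function theorem; the C² extensions of the left branches come from modifying the power function near
0 (`smoothIter`). If the maps are C² at 1/2, the two branches adjacent to 1/2 are merged, so that
1/2 is not a partition point.

Inside one branch, the hole is the set mapped onto an interval of length ε, and its mass divided by
ε tends to density over slope at an end point of the branch (`tendsto_edge_integral`). On the right
only the two branches at the spike count. On the left there are infinitely many, and dominated
convergence applies: distortion bounds each term by a multiple of a term of a telescoping series.
Both holes are thus of exact order ε, and their ratio converges to a positive number. -/

open scoped ENNReal

/-! ### Measures with log-Lipschitz densities on intervals -/

/-- `ν` has a density with respect to Lebesgue measure on `W` which is bounded by `s` and whose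
logarithm is `K`-Lipschitz. -/
def HasLogLipDensity (K : ℝ) (s : ℝ≥0∞) (W : Set ℝ) (ν : Measure ℝ) : Prop :=
  ∃ ρ : ℝ → ℝ≥0∞, Measurable ρ ∧ (∀ x ∈ W, ρ x ≤ s) ∧
    (∀ x ∈ W, ∀ y ∈ W, ρ x ≤ ENNReal.ofReal (Real.exp (K * |x - y|)) * ρ y) ∧
    ν = (volume.restrict W).withDensity ρ

namespace HasLogLipDensity

variable {K K' : ℝ} {s s' : ℝ≥0∞} {W V : Set ℝ} {ν : Measure ℝ}

theorem mono (h : HasLogLipDensity K s W ν) (hK : K ≤ K') (hs : s ≤ s') :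
    HasLogLipDensity K' s' W ν := by
  obtain ⟨ρ, h1, h2, h3, h4⟩ := h
  refine ⟨ρ, h1, fun x hx => (h2 x hx).trans hs, fun x hx y hy => (h3 x hx y hy).trans ?_, h4⟩
  gcongr

theorem restrict (h : HasLogLipDensity K s W ν) (hV : MeasurableSet V) (hVW : V ⊆ W) :
    HasLogLipDensity K s V (ν.restrict V) := by
  obtain ⟨ρ, h1, h2, h3, h4⟩ := h
  refine ⟨ρ, h1, fun x hx => h2 x (hVW hx), fun x hx y hy => h3 x (hVW hx) y (hVW hy), ?_⟩
  rw [h4, restrict_withDensity hV, Measure.restrict_restrict_of_subset hVW]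

/-- The log-Lipschitz inequality is linear in the density, with a constant that does not depend on
the summand, so it survives countable sums. The height bound is given up here and recovered from the
mass by `bound_of_mass`. -/
theorem sum {ι : Type*} [Countable ι] {ν : ι → Measure ℝ}
    (h : ∀ i, HasLogLipDensity K ∞ W (ν i)) : HasLogLipDensity K ∞ W (Measure.sum ν) := by
  choose ρ h1 h2 h3 h4 using h
  refine ⟨fun x => ∑' i, ρ i x, by fun_prop, fun x _ => le_top, fun x hx y hy => ?_, ?_⟩
  · rw [← ENNReal.tsum_mul_left]
    exact ENNReal.tsum_le_tsum fun i => h3 i x hx y hy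
  · have := withDensity_tsum (μ := volume.restrict W) h1
    rw [show ν = fun i => (volume.restrict W).withDensity (ρ i) from funext h4, ← this]
    congr 1
    ext x
    rw [tsum_apply (Pi.summable.2 fun _ => ENNReal.summable)]

theorem zero : HasLogLipDensity K 0 W 0 :=
  ⟨0, measurable_const, fun _ _ => le_rfl, fun _ _ _ _ => by simp, by simp⟩

theorem apply_le (h : HasLogLipDensity K s W ν) (hW : MeasurableSet W) {B : Set ℝ}
    (hB : MeasurableSet B) : ν B ≤ s * volume (B ∩ W) := by
  obtain ⟨ρ, h1, h2, h3, rfl⟩ := h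
  rw [withDensity_apply _ hB, Measure.restrict_restrict hB]
  calc ∫⁻ x in B ∩ W, ρ x ≤ ∫⁻ x in B ∩ W, s :=
        setLIntegral_mono' (hB.inter hW) fun x hx => h2 x hx.2
    _ = _ := by simp

theorem ae_mem (h : HasLogLipDensity K s W ν) (hW : MeasurableSet W) : ν Wᶜ = 0 := by
  obtain ⟨ρ, h1, h2, h3, rfl⟩ := h
  rw [withDensity_apply _ hW.compl, Measure.restrict_restrict hW.compl]
  simp

theorem absolutelyContinuous (h : HasLogLipDensity K s W ν) : ν ≪ volume.restrict W := by
  obtain ⟨ρ, h1, h2, h3, rfl⟩ := h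
  exact withDensity_absolutelyContinuous _ _

/-- On a set of diameter at most one, the density is controlled by the mass. -/
theorem bound_of_mass (h : HasLogLipDensity K s W ν) (hK : 0 ≤ K) (hW : MeasurableSet W)
    (hd : ∀ x ∈ W, ∀ y ∈ W, |x - y| ≤ 1) (h0 : volume W ≠ 0) (h1 : volume W ≠ ∞) :
    HasLogLipDensity K (ENNReal.ofReal (Real.exp K) * ν univ / volume W) W ν := by
  obtain ⟨ρ, m1, m2, m3, rfl⟩ := h
  refine ⟨ρ, m1, fun x hx => ?_, m3, rfl⟩
  rw [ENNReal.le_div_iff_mul_le (Or.inl h0) (Or.inl h1), withDensity_apply _ .univ,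
    Measure.restrict_univ, ← lintegral_const_mul _ m1]
  calc ρ x * volume W = ∫⁻ y in W, ρ x := by simp
    _ ≤ _ := setLIntegral_mono' hW fun y hy => (m3 x hx y hy).trans (by
        gcongr
        nlinarith [hd x hx y hy, abs_nonneg (x - y)])

/-- Bounded distortion: relative measures of sets are comparable to relative Lebesgue measures. -/
theorem mul_le_of_mass (h : HasLogLipDensity K s W ν) (hK : 0 ≤ K) (hW : MeasurableSet W)
    (hd : ∀ x ∈ W, ∀ y ∈ W, |x - y| ≤ 1) {A : Set ℝ} (hA : MeasurableSet A) :
    ν univ * volume (W ∩ A) ≤ ENNReal.ofReal (Real.exp K) * volume W * ν A := by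
  obtain ⟨ρ, m1, m2, m3, rfl⟩ := h
  rw [withDensity_apply _ .univ, Measure.restrict_univ, withDensity_apply _ hA,
    Measure.restrict_restrict hA]
  have key : ∀ y ∈ W, (∫⁻ x in W, ρ x) ≤ ENNReal.ofReal (Real.exp K) * volume W * ρ y := by
    intro y hy
    calc (∫⁻ x in W, ρ x) ≤ ∫⁻ x in W, ENNReal.ofReal (Real.exp K) * ρ y :=
          setLIntegral_mono' hW fun x hx => (m3 x hx y hy).trans (by
            gcongr
            nlinarith [hd x hx y hy, abs_nonneg (x - y)])
      _ = _ := by simp; ring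
  rw [← lintegral_const_mul _ m1, inter_comm W A]
  calc (∫⁻ x in W, ρ x) * volume (A ∩ W) = ∫⁻ y in A ∩ W, (∫⁻ x in W, ρ x) := by simp
    _ ≤ _ := setLIntegral_mono' (hA.inter hW) fun y hy => key y hy.2

/-- Push-forward by an expanding map with bounded distortion. -/
theorem map_of_expanding (h : HasLogLipDensity K s W ν) (hK : 0 ≤ K) (hW : MeasurableSet W)
    {F : ℝ → ℝ} {D lam : ℝ} (hF : Measurable F) (hlam : 0 < lam)
    (hd : ∀ x ∈ W, DifferentiableAt ℝ F x) (hinj : InjOn F W)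
    (hexp : ∀ x ∈ W, ∀ y ∈ W, lam * |x - y| ≤ |F x - F y|)
    (hder : ∀ x ∈ W, lam ≤ |deriv F x|)
    (hdist : ∀ x ∈ W, ∀ y ∈ W, |deriv F x| ≤ Real.exp (D * |F x - F y|) * |deriv F y|) :
    HasLogLipDensity (K / lam + D) (s / ENNReal.ofReal lam) (F '' W) (ν.map F) := by
  obtain ⟨ρ, m1, m2, m3, rfl⟩ := h
  -- A continuous injection on a Borel set is a measurable embedding, so the new density ρ / |F'|
  -- can be carried to `F '' W` by `Function.extend`; its values off the image play no role.
  have hemb : MeasurableEmbedding (W.domRestrict F) :=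
    ContinuousOn.measurableEmbedding hW (fun x hx => (hd x hx).continuousAt.continuousWithinAt) hinj
  set g : W → ℝ≥0∞ := fun x => (ENNReal.ofReal |deriv F x|)⁻¹ * ρ x with hg
  have hgm : Measurable g := by
    have := measurable_deriv F
    fun_prop
  have hval : ∀ x (hx : x ∈ W), Function.extend (W.domRestrict F) g 0 (F x) =
      (ENNReal.ofReal |deriv F x|)⁻¹ * ρ x := by
    intro x hx
    exact hemb.injective.extend_apply g 0 ⟨x, hx⟩
  have hpos : ∀ x ∈ W, 0 < |deriv F x| := fun x hx => hlam.trans_le (hder x hx)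
  refine ⟨Function.extend (W.domRestrict F) g 0, hemb.measurable_extend hgm measurable_const,
    ?_, ?_, ?_⟩
  · rintro _ ⟨x, hx, rfl⟩
    rw [hval x hx, mul_comm, div_eq_mul_inv]
    have := hder x hx
    have := m2 x hx
    gcongr
  · rintro _ ⟨x, hx, rfl⟩ _ ⟨y, hy, rfl⟩
    rw [hval x hx, hval y hy]
    have e1 : (ENNReal.ofReal |deriv F x|)⁻¹ ≤
        ENNReal.ofReal (Real.exp (D * |F x - F y|)) * (ENNReal.ofReal |deriv F y|)⁻¹ := by
      rw [← ENNReal.ofReal_inv_of_pos (hpos x hx), ← ENNReal.ofReal_inv_of_pos (hpos y hy),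
        ← ENNReal.ofReal_mul (Real.exp_pos _).le]
      apply ENNReal.ofReal_le_ofReal
      have h1 := hdist y hy x hx
      have h2 := hpos x hx
      have h3 := hpos y hy
      rw [abs_sub_comm] at h1
      rw [← div_eq_mul_inv, le_div_iff₀ h3, inv_mul_le_iff₀ h2]
      linarith
    have e2 : ENNReal.ofReal (Real.exp (K * |x - y|)) ≤
        ENNReal.ofReal (Real.exp (K / lam * |F x - F y|)) := by
      apply ENNReal.ofReal_le_ofReal
      apply Real.exp_le_exp.2
      rw [div_mul_eq_mul_div, le_div_iff₀ hlam]
      nlinarith [hexp x hx y hy]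
    calc (ENNReal.ofReal |deriv F x|)⁻¹ * ρ x
        ≤ (ENNReal.ofReal (Real.exp (D * |F x - F y|)) * (ENNReal.ofReal |deriv F y|)⁻¹) *
          (ENNReal.ofReal (Real.exp (K / lam * |F x - F y|)) * ρ y) :=
          mul_le_mul' e1 ((m3 x hx y hy).trans (by gcongr))
      _ = _ := by
          rw [add_mul, Real.exp_add, ENNReal.ofReal_mul (Real.exp_pos _).le]
          ring
  · ext B hB
    rw [Measure.map_apply hF hB, withDensity_apply _ (hF hB), withDensity_apply _ hB,
      Measure.restrict_restrict hB, Measure.restrict_restrict (hF hB)]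
    have : B ∩ F '' W = F '' (F ⁻¹' B ∩ W) := by
      ext y; constructor
      · rintro ⟨h1, x, hx, rfl⟩; exact ⟨x, ⟨h1, hx⟩, rfl⟩
      · rintro ⟨x, ⟨h1, h2⟩, rfl⟩; exact ⟨h1, x, h2, rfl⟩
    rw [this, lintegral_image_eq_lintegral_abs_deriv_mul ((hF hB).inter hW)
      (fun x hx => (hd x hx.2).hasDerivAt.hasDerivWithinAt) (hinj.mono inter_subset_right)]
    refine setLIntegral_congr_fun ((hF hB).inter hW) fun x hx => ?_
    rw [hval x hx.2, ← mul_assoc, ENNReal.mul_inv_cancel (by simpa using (abs_pos.1 (hpos x hx.2)))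
      ENNReal.ofReal_ne_top, one_mul]

end HasLogLipDensity

/-! ### Piecewise expanding maps with finitely many images -/

/-- `F` is a piecewise expanding map of `Δ` with countably many branches `I i`, uniformly bounded
distortion, and finitely many different images `J k`. -/
structure IsPiecewiseExpanding {ι κ : Type} (F : ℝ → ℝ) (I : ι → Set ℝ) (J : κ → Set ℝ)
    (σ : ι → κ) (D lam : ℝ) (Δ : Set ℝ) : Prop where
  measurable : Measurable F
  lam_gt : 2 < lam
  dist_nonneg : 0 ≤ D
  ordConnected : ∀ i, (I i).OrdConnected
  isOpen : ∀ i, IsOpen (I i)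
  disjoint : Pairwise fun i j => Disjoint (I i) (I j)
  subset : ∀ i, I i ⊆ Δ
  null : volume (Δ \ ⋃ i, I i) = 0
  differentiableAt : ∀ i, ∀ x ∈ I i, DifferentiableAt ℝ F x
  injOn : ∀ i, InjOn F (I i)
  expand : ∀ i, ∀ x ∈ I i, lam ≤ |deriv F x|
  distortion : ∀ i, ∀ x ∈ I i, ∀ y ∈ I i,
    |deriv F x| ≤ Real.exp (D * |F x - F y|) * |deriv F y|
  image : ∀ i, F '' I i = J (σ i)
  image_subset : ∀ k, J k ⊆ Δ
  image_pos : ∀ k, volume (J k) ≠ 0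
  ordConnected_dom : Δ.OrdConnected
  diam_dom : ∀ x ∈ Δ, ∀ y ∈ Δ, |x - y| ≤ 1

theorem expand_of_deriv {F : ℝ → ℝ} {W : Set ℝ} {lam : ℝ} (hW : W.OrdConnected)
    (hd : ∀ x ∈ W, DifferentiableAt ℝ F x) (hder : ∀ x ∈ W, lam ≤ |deriv F x|) :
    ∀ x ∈ W, ∀ y ∈ W, lam * |x - y| ≤ |F x - F y| := by
  have key : ∀ x ∈ W, ∀ y ∈ W, x < y → lam * |x - y| ≤ |F x - F y| := by
    intro x hx y hy hxy
    have hsub := hW.out hx hy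
    obtain ⟨c, hc, h⟩ := exists_deriv_eq_slope F hxy
      (fun z hz => (hd z (hsub hz)).continuousAt.continuousWithinAt)
      (fun z hz => (hd z (hsub (Ioo_subset_Icc_self hz))).differentiableWithinAt)
    have h2 := hder c (hsub (Ioo_subset_Icc_self hc))
    rw [h, abs_div, abs_sub_comm (F y), abs_sub_comm y] at h2
    rwa [le_div_iff₀ (abs_pos.2 (sub_ne_zero.2 hxy.ne))] at h2
  intro x hx y hy
  rcases lt_trichotomy x y with h | h | h
  · exact key x hx y hy h
  · simp [h]
  · rw [abs_sub_comm x, abs_sub_comm (F x)]; exact key y hy x hx h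

namespace IsPiecewiseExpanding

variable {ι κ : Type} {F : ℝ → ℝ} {I : ι → Set ℝ} {J : κ → Set ℝ}
  {σ : ι → κ} {D lam : ℝ} {Δ : Set ℝ} {W : Set ℝ} {ν : Measure ℝ} {s : ℝ≥0∞}

theorem ordConnected_image (h : IsPiecewiseExpanding F I J σ D lam Δ) {i : ι} {V : Set ℝ}
    (hV : V.OrdConnected) (hVI : V ⊆ I i) : (F '' V).OrdConnected := by
  apply IsPreconnected.ordConnected
  exact hV.isPreconnected.image F
    fun x hx => (h.differentiableAt i x (hVI hx)).continuousAt.continuousWithinAt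

/-- The constant 2D is chosen to be invariant: a branch turns K into K / lam + D, and 2D / lam + D ≤
2D because lam > 2. -/
theorem map_branch (h : IsPiecewiseExpanding F I J σ D lam Δ) {i : ι} (hW : W.OrdConnected)
    (hWI : W ⊆ I i) (hν : HasLogLipDensity (2 * D) s W ν) :
    HasLogLipDensity (2 * D) (s / ENNReal.ofReal lam) (F '' W) (ν.map F) := by
  have hl := h.lam_gt
  have hD := h.dist_nonneg
  refine (hν.map_of_expanding (by positivity) hW.measurableSet h.measurable (by linarith)
    (fun x hx => h.differentiableAt i x (hWI hx)) ((h.injOn i).mono hWI)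
    (expand_of_deriv hW (fun x hx => h.differentiableAt i x (hWI hx))
      fun x hx => h.expand i x (hWI hx))
    (fun x hx => h.expand i x (hWI hx))
    fun x hx y hy => h.distortion i x (hWI hx) y (hWI hy)).mono ?_ le_rfl
  have : 2 * D / lam ≤ D := by rw [div_le_iff₀ (by linarith)]; nlinarith
  linarith

theorem map_eq_sum [Countable ι] (h : IsPiecewiseExpanding F I J σ D lam Δ) (hW : W.OrdConnected) (hWΔ : W ⊆ Δ)
    (hν : HasLogLipDensity (2 * D) s W ν) :
    ν.map F = Measure.sum fun i => (ν.restrict (W ∩ I i)).map F := by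
  have h1 : ν = Measure.sum fun i => ν.restrict (W ∩ I i) := by
    rw [← Measure.restrict_iUnion _ fun i => hW.measurableSet.inter (h.isOpen i).measurableSet]
    · rw [Measure.restrict_eq_self_of_ae_mem]
      rw [ae_iff]
      have hsub : {a | a ∉ ⋃ i, W ∩ I i} ⊆ Wᶜ ∪ (Δ \ ⋃ i, I i) := by
        intro x hx
        by_cases hxW : x ∈ W
        · right
          refine ⟨hWΔ hxW, fun hx' => hx ?_⟩
          rw [← inter_iUnion]
          exact ⟨hxW, hx'⟩
        · exact Or.inl hxW
      refine measure_mono_null hsub (measure_union_null (hν.ae_mem hW.measurableSet) ?_)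
      exact hν.absolutelyContinuous (Measure.absolutelyContinuous_of_le Measure.restrict_le_self
        h.null)
    · exact fun i j hij => (h.disjoint hij).mono inter_subset_right inter_subset_right
  conv_lhs => rw [h1]
  rw [Measure.map_sum h.measurable.aemeasurable]

/-- The branches that meet `W` and stick out of it on the left. -/
def leftPartial (I : ι → Set ℝ) (W : Set ℝ) : Set ι :=
  {i | (∃ y ∈ I i, ∀ w ∈ W, y < w) ∧ (W ∩ I i).Nonempty}

/-- The branches that meet `W` and stick out of it on the right. -/
def rightPartial (I : ι → Set ℝ) (W : Set ℝ) : Set ι :=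
  {i | (∃ y ∈ I i, ∀ w ∈ W, w < y) ∧ (W ∩ I i).Nonempty}

/-- Of two points lying to the left of `W` in two such branches, the larger one belongs to both
branches, which are disjoint. -/
theorem leftPartial_subsingleton (h : IsPiecewiseExpanding F I J σ D lam Δ) :
    (leftPartial I W).Subsingleton := by
  rintro i ⟨⟨y, hy, hyW⟩, w, hw, hwi⟩ j ⟨⟨y', hy', hyW'⟩, w', hw', hwj⟩
  by_contra hij
  have hi : max y y' ∈ I i := (h.ordConnected i).out hy hwi ⟨le_max_left _ _, max_le (hyW w hw).le (hyW' w hw).le⟩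
  have hj : max y y' ∈ I j := (h.ordConnected j).out hy' hwj ⟨le_max_right _ _, max_le (hyW w' hw').le (hyW' w' hw').le⟩
  exact Set.disjoint_left.1 (h.disjoint hij) hi hj

theorem rightPartial_subsingleton (h : IsPiecewiseExpanding F I J σ D lam Δ) :
    (rightPartial I W).Subsingleton := by
  rintro i ⟨⟨y, hy, hyW⟩, w, hw, hwi⟩ j ⟨⟨y', hy', hyW'⟩, w', hw', hwj⟩
  by_contra hij
  have hi : min y y' ∈ I i := (h.ordConnected i).out hwi hy ⟨le_min (hyW w hw).le (hyW' w hw).le, min_le_left _ _⟩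
  have hj : min y y' ∈ I j := (h.ordConnected j).out hwj hy' ⟨le_min (hyW w' hw').le (hyW' w' hw').le, min_le_right _ _⟩
  exact Set.disjoint_left.1 (h.disjoint hij) hi hj

/-- A point outside an interval lies entirely to its left or entirely to its right. Hence all
branches meeting `W`, except at most two, have their complete image. -/
theorem subset_of_notMem_partial (hW : W.OrdConnected) {i : ι} (hI : (W ∩ I i).Nonempty)
    (hl : i ∉ leftPartial I W) (hr : i ∉ rightPartial I W) : I i ⊆ W := by
  intro y hy
  by_contra hyW
  have h1 : ¬ ∀ w ∈ W, y < w := fun h => hl ⟨⟨y, hy, h⟩, hI⟩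
  have h2 : ¬ ∀ w ∈ W, w < y := fun h => hr ⟨⟨y, hy, h⟩, hI⟩
  push Not at h1 h2
  obtain ⟨w, hw, hwy⟩ := h1
  obtain ⟨w', hw', hwy'⟩ := h2
  exact hyW (hW.out hw hw' ⟨hwy, hwy'⟩)

/-- A sum over at most one branch. -/
theorem partial_piece (h : IsPiecewiseExpanding F I J σ D lam Δ) (hW : W.OrdConnected)
    (hν : HasLogLipDensity (2 * D) s W ν) {P : Set ι} (hP : P.Subsingleton) :
    ∃ V : Set ℝ, V.OrdConnected ∧ V ⊆ Δ ∧ HasLogLipDensity (2 * D) (s / ENNReal.ofReal lam) V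
      (Measure.sum fun i : P => (ν.restrict (W ∩ I i)).map F) := by
  rcases hP.eq_empty_or_singleton with rfl | ⟨i, rfl⟩
  · refine ⟨∅, ordConnected_empty, empty_subset _, ?_⟩
    rw [Measure.sum_of_isEmpty]
    exact HasLogLipDensity.zero.mono le_rfl zero_le
  · refine ⟨F '' (W ∩ I i), h.ordConnected_image (hW.inter (h.ordConnected i)) inter_subset_right,
      ?_, ?_⟩
    · refine (image_mono inter_subset_right).trans ?_
      rw [h.image]
      exact h.image_subset _
    · have : (Measure.sum fun i : ({i} : Set ι) => (ν.restrict (W ∩ I i)).map F) =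
          (ν.restrict (W ∩ I i)).map F := by
        ext B hB
        rw [Measure.sum_apply _ hB, tsum_fintype]
        simp
      rw [this]
      exact h.map_branch (hW.inter (h.ordConnected i)) inter_subset_right
        (hν.restrict (hW.inter (h.ordConnected i)).measurableSet inter_subset_left)

/-- One step of the dynamics: a log-Lipschitz density on an interval is mapped to a sum of
log-Lipschitz densities on the full images and of two smaller pieces. -/
theorem step [Countable ι] (h : IsPiecewiseExpanding F I J σ D lam Δ) (hW : W.OrdConnected) (hWΔ : W ⊆ Δ)
    (hν : HasLogLipDensity (2 * D) s W ν) :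
    ∃ (φ : κ → Measure ℝ) (V₁ V₂ : Set ℝ) (p₁ p₂ : Measure ℝ),
      (∀ k, HasLogLipDensity (2 * D) ∞ (J k) (φ k)) ∧
      (V₁.OrdConnected ∧ V₁ ⊆ Δ ∧ HasLogLipDensity (2 * D) (s / ENNReal.ofReal lam) V₁ p₁) ∧
      (V₂.OrdConnected ∧ V₂ ⊆ Δ ∧ HasLogLipDensity (2 * D) (s / ENNReal.ofReal lam) V₂ p₂) ∧
      ν.map F = Measure.sum φ + p₁ + p₂ := by
  classical
  set P := leftPartial I W
  -- A branch sticking out on both sides is charged to the left only, so that no mass is counted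
  -- twice.
  set Q := rightPartial I W \ leftPartial I W
  obtain ⟨V₁, a1, b1, c1⟩ := h.partial_piece hW hν (P := P) h.leftPartial_subsingleton
  obtain ⟨V₂, a2, b2, c2⟩ := h.partial_piece hW hν (P := Q)
    (h.rightPartial_subsingleton.anti sdiff_subset)
  set μ : ι → Measure ℝ := fun i => (ν.restrict (W ∩ I i)).map F with hμ
  refine ⟨fun k => Measure.sum fun i : {i // i ∉ P ∧ i ∉ Q ∧ σ i = k} => μ i, V₁, V₂, _, _, ?_,
    ⟨a1, b1, c1⟩, ⟨a2, b2, c2⟩, ?_⟩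
  · intro k
    refine HasLogLipDensity.sum fun ⟨i, hiP, hiQ, hik⟩ => ?_
    rcases (W ∩ I i).eq_empty_or_nonempty with he | hne
    · have : μ i = 0 := by simp [hμ, he]
      rw [this]
      exact HasLogLipDensity.zero.mono le_rfl zero_le
    · have hsub : I i ⊆ W := subset_of_notMem_partial hW hne hiP fun hr => hiQ ⟨hr, hiP⟩
      have := h.map_branch (h.ordConnected i) subset_rfl
        (hν.restrict (h.isOpen i).measurableSet hsub)
      rw [h.image, hik] at this
      simp only [hμ, inter_eq_right.2 hsub]
      exact this.mono le_rfl le_top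
  · rw [h.map_eq_sum hW hWΔ hν]
    ext B hB
    simp only [Measure.add_apply, Measure.sum_apply _ hB]
    -- The sum over `k` has at most one nonzero term, at `k = σ i`.
    have hsplit : ∀ i, μ i B = (∑' k, if i ∉ P ∧ i ∉ Q ∧ σ i = k then μ i B else 0) +
        (if i ∈ P then μ i B else 0) + (if i ∈ Q then μ i B else 0) := by
      intro i
      by_cases hP : i ∈ P
      · have : i ∉ Q := fun hq => hq.2 hP
        simp [hP, this]
      · by_cases hQ : i ∈ Q
        · simp [hP, hQ]
        · simp [hP, hQ]
    have hsub : ∀ (R : Set ι), (∑' i : R, μ i B) = ∑' i, if i ∈ R then μ i B else 0 := by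
      intro R
      rw [tsum_subtype R (fun i => μ i B)]
      simp only [indicator_apply]
    rw [tsum_congr hsplit, ENNReal.tsum_add, ENNReal.tsum_add, ENNReal.tsum_comm, hsub P, hsub Q]
    refine congr (congrArg _ (congr (congrArg _ (tsum_congr fun k => ?_))
      (tsum_congr fun i => ?_))) (tsum_congr fun i => ?_)
    · refine Eq.trans (tsum_congr fun i => ?_) (hsub {i | i ∉ P ∧ i ∉ Q ∧ σ i = k}).symm
      congr 1
    · congr 1
    · congr 1

end IsPiecewiseExpanding

namespace HasLogLipDensity

theorem volume_restrict {K : ℝ} (hK : 0 ≤ K) (W : Set ℝ) :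
    HasLogLipDensity K 1 W (volume.restrict W) := by
  refine ⟨fun _ => 1, measurable_const, fun _ _ => le_rfl, fun x _ y _ => ?_, ?_⟩
  · rw [mul_one, ← ENNReal.ofReal_one]
    exact ENNReal.ofReal_le_ofReal (Real.one_le_exp (by positivity))
  · exact (withDensity_one).symm

end HasLogLipDensity

namespace IsPiecewiseExpanding

variable {ι κ : Type} {F : ℝ → ℝ} {I : ι → Set ℝ} {J : κ → Set ℝ}
  {σ : ι → κ} {D lam : ℝ} {Δ : Set ℝ} {W : Set ℝ} {ν : Measure ℝ} {s : ℝ≥0∞}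

theorem two_div_lam_lt_one (h : IsPiecewiseExpanding F I J σ D lam Δ) :
    2 / ENNReal.ofReal lam < 1 := by
  have := h.lam_gt
  rw [ENNReal.div_lt_iff (Or.inl (by simp; linarith)) (Or.inl ENNReal.ofReal_ne_top), one_mul,
    ← ENNReal.ofReal_ofNat, ENNReal.ofReal_lt_ofReal_iff (by linarith)]
  exact this

theorem volume_le_one_of_subset (h : IsPiecewiseExpanding F I J σ D lam Δ) (hW : W ⊆ Δ) :
    volume W ≤ 1 := by
  refine (Real.volume_le_diam W).trans (ENNReal.ofReal_one ▸ ?_)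
  apply Metric.ediam_le_of_forall_dist_le
  intro x hx y hy
  exact h.diam_dom x (hW hx) y (hW hy)

/-! #### Ergodicity -/

/-- Invariance allows `ν` to be replaced by its push-forward. The parts on complete images satisfy
the inequality without error; the two cut pieces have height s / lam each and are handled by the
induction hypothesis, which turns the error into 2 (s / lam) (2 / lam) ^ n. -/
theorem mass_le_of_invariant [Countable ι] (h : IsPiecewiseExpanding F I J σ D lam Δ) {A : Set ℝ}
    (hA : MeasurableSet A) (hFA : F ⁻¹' A = A) {c : ℝ≥0∞} (hc1 : c ≤ 1)
    (hc : ∀ k (φ : Measure ℝ), HasLogLipDensity (2 * D) ∞ (J k) φ → c * φ univ ≤ φ A) (n : ℕ) :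
    ∀ (W : Set ℝ) (ν : Measure ℝ) (s : ℝ≥0∞), W.OrdConnected → W ⊆ Δ →
      HasLogLipDensity (2 * D) s W ν →
      c * ν univ ≤ ν A + (2 / ENNReal.ofReal lam) ^ n * s := by
  induction n with
  | zero =>
    intro W ν s hW hWΔ hν
    have h1 := hν.apply_le hW.measurableSet MeasurableSet.univ
    rw [univ_inter] at h1
    calc c * ν univ ≤ 1 * (s * volume W) := mul_le_mul' hc1 h1
      _ ≤ 1 * (s * 1) := by gcongr; exact h.volume_le_one_of_subset hWΔ
      _ ≤ _ := by simp
  | succ n ih =>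
    intro W ν s hW hWΔ hν
    obtain ⟨φ, V₁, V₂, p₁, p₂, hφ, ⟨a1, b1, c1⟩, ⟨a2, b2, c2⟩, hsum⟩ := h.step hW hWΔ hν
    have e1 : ν univ = ν.map F univ := by rw [Measure.map_apply h.measurable .univ, preimage_univ]
    have e2 : ν A = ν.map F A := by rw [Measure.map_apply h.measurable hA, hFA]
    rw [e1, e2, hsum]
    simp only [Measure.add_apply, Measure.sum_apply _ hA, Measure.sum_apply _ MeasurableSet.univ]
    have i1 := ih V₁ p₁ _ a1 b1 c1
    have i2 := ih V₂ p₂ _ a2 b2 c2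
    have i3 : c * ∑' k, φ k univ ≤ ∑' k, φ k A := by
      rw [← ENNReal.tsum_mul_left]
      exact ENNReal.tsum_le_tsum fun k => hc k _ (hφ k)
    calc c * (∑' k, φ k univ + p₁ univ + p₂ univ)
        = c * (∑' k, φ k univ) + c * p₁ univ + c * p₂ univ := by ring
      _ ≤ _ := add_le_add (add_le_add i3 i1) i2
      _ = _ := by
          rw [pow_succ]
          simp only [div_eq_mul_inv]
          ring

/-- An invariant set that meets every full image in positive measure has full measure. -/
theorem null_compl_of_invariant [Countable ι] [Finite κ]
    (h : IsPiecewiseExpanding F I J σ D lam Δ) {A : Set ℝ} (hA : MeasurableSet A)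
    (hFA : F ⁻¹' A = A) (hJ : ∀ k, volume (J k ∩ A) ≠ 0)
    (hJo : ∀ k, (J k).OrdConnected) : volume (Δ \ A) = 0 := by
  have hD := h.dist_nonneg
  have hJt : ∀ k, volume (J k) ≠ ∞ := fun k =>
    ((h.volume_le_one_of_subset (h.image_subset k)).trans_lt ENNReal.one_lt_top).ne
  set c' : κ → ℝ≥0∞ := fun k =>
    volume (J k ∩ A) / (ENNReal.ofReal (Real.exp (2 * D)) * volume (J k)) with hc'
  have hE : ENNReal.ofReal (Real.exp (2 * D)) ≠ 0 := by simp [Real.exp_pos]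
  have hden : ∀ k, ENNReal.ofReal (Real.exp (2 * D)) * volume (J k) ≠ ∞ := fun k =>
    ENNReal.mul_ne_top ENNReal.ofReal_ne_top (hJt k)
  have hden0 : ∀ k, ENNReal.ofReal (Real.exp (2 * D)) * volume (J k) ≠ 0 := fun k =>
    mul_ne_zero hE (h.image_pos k)
  have hc'0 : ∀ k, 0 < c' k := fun k => ENNReal.div_pos (hJ k) (hden k)
  -- Finiteness of the set of images is used here. Inserting 1 gives c ≤ 1 and a nonempty set to
  -- minimise over.
  obtain ⟨c, hc0, hc1, hc⟩ : ∃ c : ℝ≥0∞, 0 < c ∧ c ≤ 1 ∧ ∀ k, c ≤ c' k := by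
    have : (insert 1 (range c')).Finite := (finite_range c').insert 1
    obtain ⟨m, hm, hmin⟩ := this.exists_minimalFor id _ ⟨1, mem_insert _ _⟩
    have hle : ∀ x ∈ insert 1 (range c'), m ≤ x := fun x hx => by
      rcases le_total m x with h' | h'
      · exact h'
      · exact hmin hx h'
    refine ⟨m, ?_, hle 1 (mem_insert _ _), fun k => hle _ (mem_insert_of_mem _ ⟨k, rfl⟩)⟩
    rcases hm with rfl | ⟨k, rfl⟩
    · exact one_pos
    · exact hc'0 k
  have hmass : ∀ k (φ : Measure ℝ), HasLogLipDensity (2 * D) ∞ (J k) φ → c * φ univ ≤ φ A := by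
    intro k φ hφ
    have h1 := hφ.mul_le_of_mass (by positivity) (hJo k).measurableSet
      (fun x hx y hy => h.diam_dom x (h.image_subset k hx) y (h.image_subset k hy)) hA
    calc c * φ univ ≤ c' k * φ univ := by gcongr; exact hc k
      _ = (φ univ * volume (J k ∩ A)) / (ENNReal.ofReal (Real.exp (2 * D)) * volume (J k)) := by
          simp only [hc', div_eq_mul_inv]; ring
      _ ≤ φ A := by
          rw [ENNReal.div_le_iff (hden0 k) (hden k), mul_comm (φ A)]
          exact h1
  -- As n grows the error disappears: `A` occupies at least the proportion c of every interval in
  -- `Δ`.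
  have hint : ∀ W : Set ℝ, W.OrdConnected → W ⊆ Δ → c * volume W ≤ volume (A ∩ W) := by
    intro W hW hWΔ
    have hreg := HasLogLipDensity.volume_restrict (K := 2 * D) (by positivity) W
    have key : ∀ n : ℕ, c * volume W ≤ volume (A ∩ W) + (2 / ENNReal.ofReal lam) ^ n := by
      intro n
      have := h.mass_le_of_invariant hA hFA hc1 hmass n W _ 1 hW hWΔ hreg
      rwa [Measure.restrict_apply .univ, univ_inter, Measure.restrict_apply hA, mul_one] at this
    have ht : Tendsto (fun n : ℕ => volume (A ∩ W) + (2 / ENNReal.ofReal lam) ^ n) atTop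
        (𝓝 (volume (A ∩ W) + 0)) :=
      (ENNReal.tendsto_pow_atTop_nhds_zero_of_lt_one h.two_div_lam_lt_one).const_add _
    rw [add_zero] at ht
    exact ge_of_tendsto' ht key
  by_contra hpos
  have hΔm := h.ordConnected_dom.measurableSet
  -- Lebesgue's density theorem: almost every point of `Δ \ A` is a density point, whereas the
  -- proportion of `Δ \ A` in any ball is at most 1 - c.
  have hae := Besicovitch.ae_tendsto_measure_inter_div (volume : Measure ℝ) (Δ \ A)
  have : (volume.restrict (Δ \ A)) ≠ 0 := by
    rwa [Ne, Measure.restrict_eq_zero]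
  have := ae_neBot.2 this
  obtain ⟨x, hx⟩ := hae.exists
  have hle : ∀ᶠ r in 𝓝[>] (0 : ℝ), volume ((Δ \ A) ∩ Metric.closedBall x r) /
      volume (Metric.closedBall x r) ≤ 1 - c := by
    filter_upwards [self_mem_nhdsWithin] with r (hr : 0 < r)
    have hB0 : volume (Metric.closedBall x r) ≠ 0 := by simp [hr]
    have hBt : volume (Metric.closedBall x r) ≠ ∞ := measure_closedBall_lt_top.ne
    rw [ENNReal.div_le_iff hB0 hBt]
    set W := Δ ∩ Metric.closedBall x r with hW
    have hWo : W.OrdConnected := by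
      rw [hW, Real.closedBall_eq_Icc]
      exact h.ordConnected_dom.inter ordConnected_Icc
    have h1 := hint W hWo inter_subset_left
    have hWt : volume W ≠ ∞ := ((measure_mono inter_subset_right).trans_lt hBt.lt_top).ne
    have h2 : (Δ \ A) ∩ Metric.closedBall x r = W \ (A ∩ W) := by
      ext y; simp only [hW, mem_inter_iff, Set.mem_sdiff]; tauto
    rw [h2, measure_sdiff inter_subset_right (hA.inter hWo.measurableSet).nullMeasurableSet
      ((measure_mono inter_subset_right).trans_lt hWt.lt_top).ne]
    calc volume W - volume (A ∩ W) ≤ volume W - c * volume W := tsub_le_tsub_left h1 _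
      _ = (1 - c) * volume W := by rw [ENNReal.sub_mul (fun _ _ => hWt), one_mul]
      _ ≤ _ := by gcongr; exact inter_subset_right
  have := le_of_tendsto hx hle
  exact absurd this (not_le.2 (ENNReal.sub_lt_self ENNReal.one_ne_top one_ne_zero hc0.ne'))

/-! #### Uniform bounds for the iterates of Lebesgue measure -/

/-- `ν` is a countable superposition of log-Lipschitz densities on intervals, with total height at
most `S`. -/
def IsSuperposition (D : ℝ) (Δ : Set ℝ) (S : ℝ≥0∞) (ν : Measure ℝ) : Prop :=
  ∃ (τ : Type) (_ : Countable τ) (V : τ → Set ℝ) (s : τ → ℝ≥0∞) (p : τ → Measure ℝ),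
    (∀ i, (V i).OrdConnected ∧ V i ⊆ Δ ∧ HasLogLipDensity (2 * D) (s i) (V i) (p i)) ∧
    ∑' i, s i ≤ S ∧ ν = Measure.sum p

theorem IsSuperposition.apply_le {S : ℝ≥0∞} (hν : IsSuperposition D Δ S ν) {B : Set ℝ}
    (hB : MeasurableSet B) : ν B ≤ S * volume (B ∩ Δ) := by
  obtain ⟨τ, _, V, s, p, hp, hs, rfl⟩ := hν
  rw [Measure.sum_apply _ hB]
  calc ∑' i, p i B ≤ ∑' i, s i * volume (B ∩ Δ) := ENNReal.tsum_le_tsum fun i =>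
        ((hp i).2.2.apply_le (hp i).1.measurableSet hB).trans (by
          gcongr; exact (hp i).2.1)
    _ = (∑' i, s i) * volume (B ∩ Δ) := ENNReal.tsum_mul_right
    _ ≤ _ := by gcongr

/-- An inequality of Lasota–Yorke type for the total height. The cut pieces give the contraction 2 /
lam. All parts living on the same `J k` are added first and then bounded through their joint mass,
at most 1; bounding them one by one would lose this. -/
theorem IsSuperposition.map [Countable ι] [Finite κ] (h : IsPiecewiseExpanding F I J σ D lam Δ)
    (hJo : ∀ k, (J k).OrdConnected) {S : ℝ≥0∞} (hν : IsSuperposition D Δ S ν)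
    (hmass : ν univ ≤ 1) :
    IsSuperposition D Δ (∑' k, ENNReal.ofReal (Real.exp (2 * D)) / volume (J k) +
      2 / ENNReal.ofReal lam * S) (ν.map F) := by
  have hD := h.dist_nonneg
  obtain ⟨τ, _, V, s, p, hp, hs, rfl⟩ := hν
  have hstep := fun i => h.step (hp i).1 (hp i).2.1 (hp i).2.2
  choose φ V₁ V₂ p₁ p₂ hφ h₁ h₂ hsum using hstep
  have htot : (Measure.sum p).map F = Measure.sum (fun k => Measure.sum fun i => φ i k) +
      Measure.sum p₁ + Measure.sum p₂ := by
    rw [Measure.map_sum h.measurable.aemeasurable]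
    ext B hB
    simp only [Measure.sum_apply _ hB, Measure.add_apply]
    rw [ENNReal.tsum_comm, ← ENNReal.tsum_add, ← ENNReal.tsum_add]
    refine tsum_congr fun i => ?_
    rw [hsum i]
    simp only [Measure.sum_apply _ hB, Measure.add_apply]
  refine ⟨κ ⊕ (τ ⊕ τ), inferInstance, Sum.elim J (Sum.elim V₁ V₂),
    Sum.elim (fun k => ENNReal.ofReal (Real.exp (2 * D)) / volume (J k))
      (Sum.elim (fun i => s i / ENNReal.ofReal lam) (fun i => s i / ENNReal.ofReal lam)),
    Sum.elim (fun k => Measure.sum fun i => φ i k) (Sum.elim p₁ p₂), ?_, ?_, ?_⟩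
  · rintro (k | i | i)
    · refine ⟨hJo k, h.image_subset k, ?_⟩
      have hreg : HasLogLipDensity (2 * D) ∞ (J k) (Measure.sum fun i => φ i k) :=
        HasLogLipDensity.sum fun i => hφ i k
      refine (hreg.bound_of_mass (by positivity) (hJo k).measurableSet
        (fun x hx y hy => h.diam_dom x (h.image_subset k hx) y (h.image_subset k hy))
        (h.image_pos k) ((h.volume_le_one_of_subset (h.image_subset k)).trans_lt
          ENNReal.one_lt_top).ne).mono le_rfl ?_
      have hm : (Measure.sum fun i => φ i k) univ ≤ 1 := by
        refine le_trans ?_ hmass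
        have e1 : Measure.sum p univ = (Measure.sum p).map F univ := by
          rw [Measure.map_apply h.measurable .univ, preimage_univ]
        rw [e1, htot]
        simp only [Measure.add_apply, Measure.sum_apply _ MeasurableSet.univ]
        rw [add_assoc]
        exact (ENNReal.le_tsum (f := fun k => ∑' i, φ i k univ) k).trans le_self_add
      simp only [Sum.elim_inl]
      gcongr
      exact mul_le_of_le_one_right' hm
    · exact h₁ i
    · exact h₂ i
  · rw [ENNReal.summable.tsum_sum ENNReal.summable, ENNReal.summable.tsum_sum ENNReal.summable]
    simp only [Sum.elim_inl, Sum.elim_inr, div_eq_mul_inv, ENNReal.tsum_mul_right]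
    gcongr
    calc (∑' i, s i) * (ENNReal.ofReal lam)⁻¹ + (∑' i, s i) * (ENNReal.ofReal lam)⁻¹
        ≤ S * (ENNReal.ofReal lam)⁻¹ + S * (ENNReal.ofReal lam)⁻¹ := by gcongr
      _ = _ := by ring
  · rw [htot]
    ext B hB
    simp only [Measure.sum_apply _ hB, Measure.add_apply]
    rw [ENNReal.summable.tsum_sum ENNReal.summable, ENNReal.summable.tsum_sum ENNReal.summable]
    simp only [Sum.elim_inl, Sum.elim_inr, add_assoc, Measure.sum_apply _ hB]

/-- The push-forwards of Lebesgue measure have uniformly bounded densities. -/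
theorem exists_bound [Countable ι] [Finite κ] (h : IsPiecewiseExpanding F I J σ D lam Δ)
    (hJo : ∀ k, (J k).OrdConnected) :
    ∃ C : ℝ≥0∞, C ≠ ∞ ∧ ∀ (n : ℕ) (B : Set ℝ), MeasurableSet B →
      (volume.restrict Δ).map F^[n] B ≤ C * volume.restrict Δ B := by
  have hD := h.dist_nonneg
  set t := 2 / ENNReal.ofReal lam with ht
  have ht1 : t < 1 := h.two_div_lam_lt_one
  set C₀ : ℝ≥0∞ := ∑' k, ENNReal.ofReal (Real.exp (2 * D)) / volume (J k) with hC₀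
  have hC₀t : C₀ ≠ ∞ := by
    have := Fintype.ofFinite κ
    rw [hC₀, tsum_fintype]
    exact ENNReal.sum_ne_top.2 fun k _ => ENNReal.div_ne_top ENNReal.ofReal_ne_top (h.image_pos k)
  have hgeo : (1 - t)⁻¹ = 1 + t * (1 - t)⁻¹ := by
    rw [← ENNReal.tsum_geometric t, ← ENNReal.tsum_mul_left,
      tsum_eq_zero_add' (f := fun n => t ^ n) ENNReal.summable]
    simp [pow_succ']
  -- Any S ≥ C₀ / (1 - t) is preserved by S ↦ C₀ + t S; the additional 1 ensures S ≥ 1, the height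
  -- of Lebesgue measure at time 0.
  set S := (C₀ + 1) * (1 - t)⁻¹ with hS
  have hSt : S ≠ ∞ := ENNReal.mul_ne_top (ENNReal.add_ne_top.2 ⟨hC₀t, ENNReal.one_ne_top⟩)
    (ENNReal.inv_ne_top.2 (tsub_pos_of_lt ht1).ne')
  have hS1 : 1 ≤ S := by
    rw [hS, hgeo, mul_add]
    exact le_trans (by simp) le_self_add
  have hSS : C₀ + t * S ≤ S := by
    conv_rhs => rw [hS, hgeo]
    calc C₀ + t * S ≤ (C₀ + 1) + t * S := by gcongr; exact le_self_add
      _ = _ := by rw [hS]; ring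
  have key : ∀ n : ℕ, IsSuperposition D Δ S ((volume.restrict Δ).map F^[n]) := by
    intro n
    induction n with
    | zero =>
      refine ⟨Unit, inferInstance, fun _ => Δ, fun _ => 1, fun _ => volume.restrict Δ,
        fun _ => ⟨h.ordConnected_dom, subset_rfl,
          HasLogLipDensity.volume_restrict (by positivity) _⟩, ?_, ?_⟩
      · simpa using hS1
      · ext B hB
        simp
    | succ n ih =>
      have h1 := IsSuperposition.map h hJo ih (by
        rw [Measure.map_apply (h.measurable.iterate n) .univ, preimage_univ,
          Measure.restrict_apply_univ]
        exact h.volume_le_one_of_subset subset_rfl)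
      rw [Measure.map_map h.measurable (h.measurable.iterate n), ← Function.iterate_succ'] at h1
      obtain ⟨τ, h2, V, s, p, h3, h4, h5⟩ := h1
      exact ⟨τ, h2, V, s, p, h3, h4.trans hSS, h5⟩
  refine ⟨S, hSt, fun n B hB => ?_⟩
  rw [Measure.restrict_apply hB]
  exact (key n).apply_le hB

/-! #### A single full image -/

/-- All branches lie inside `J₀`, so there are no cut pieces, and no height bound has to be carried
along. -/
theorem map_of_full [Countable ι] {J₀ : Set ℝ}
    (h : IsPiecewiseExpanding F I (fun _ : Unit => J₀) (fun _ => ()) D lam Δ)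
    (hJ : J₀.OrdConnected) (hI : ∀ i, I i ⊆ J₀) (hν : HasLogLipDensity (2 * D) ∞ J₀ ν) :
    HasLogLipDensity (2 * D) ∞ J₀ (ν.map F) := by
  rw [h.map_eq_sum hJ (h.image_subset ()) hν]
  refine HasLogLipDensity.sum fun i => ?_
  have := h.map_branch (h.ordConnected i) subset_rfl
    (hν.restrict (h.isOpen i).measurableSet (hI i))
  rw [h.image] at this
  rw [inter_eq_right.2 (hI i)]
  exact this.mono le_rfl le_top

end IsPiecewiseExpanding

/-! ### Invariant measures as limits of Cesàro means -/

/-- The Cesàro means of the push-forwards of `m` by the iterates of `F`. -/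
noncomputable def cesaro (F : ℝ → ℝ) (m : Measure ℝ) (n : ℕ) (B : Set ℝ) : ℝ :=
  (∑ k ∈ Finset.range (n + 1), m.real (F^[k] ⁻¹' B)) / (n + 1)

section cesaro

variable {F : ℝ → ℝ} {m : Measure ℝ}

theorem cesaro_nonneg (n : ℕ) (B : Set ℝ) : 0 ≤ cesaro F m n B := by
  unfold cesaro; positivity

theorem cesaro_le {c : ℝ} {B : Set ℝ} (h : ∀ k, m.real (F^[k] ⁻¹' B) ≤ c) (n : ℕ) :
    cesaro F m n B ≤ c := by
  unfold cesaro
  rw [div_le_iff₀ (by positivity)]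
  calc _ ≤ ∑ k ∈ Finset.range (n + 1), c := Finset.sum_le_sum fun k _ => h k
    _ = _ := by simp; ring

/-- The sums telescope, leaving the last term minus the first. -/
theorem cesaro_preimage_sub [IsFiniteMeasure m] (n : ℕ) (B : Set ℝ) :
    |cesaro F m n (F ⁻¹' B) - cesaro F m n B| ≤ m.real univ / (n + 1) := by
  have h1 : (∑ k ∈ Finset.range (n + 1), m.real (F^[k] ⁻¹' (F ⁻¹' B))) -
      ∑ k ∈ Finset.range (n + 1), m.real (F^[k] ⁻¹' B) =
      m.real (F^[n + 1] ⁻¹' B) - m.real (F^[0] ⁻¹' B) := by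
    rw [← Finset.sum_sub_distrib,
      ← Finset.sum_range_sub (fun k => m.real (F^[k] ⁻¹' B)) (n + 1)]
    refine Finset.sum_congr rfl fun k _ => ?_
    rw [← preimage_comp, ← Function.iterate_succ']
  unfold cesaro
  rw [← sub_div, h1, abs_div, abs_of_pos (by positivity : (0 : ℝ) < n + 1)]
  gcongr
  rw [abs_le]
  have h2 := measureReal_mono (μ := m) (subset_univ (F^[n + 1] ⁻¹' B))
  have h3 := measureReal_mono (μ := m) (subset_univ (F^[0] ⁻¹' B))
  have h4 : 0 ≤ m.real (F^[n + 1] ⁻¹' B) := by positivity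
  have h5 : 0 ≤ m.real (F^[0] ⁻¹' B) := by positivity
  constructor <;> linarith

theorem measurePreserving_of_tendsto_cesaro [IsFiniteMeasure m] (hF : Measurable F) {μ : Measure ℝ}
    [IsFiniteMeasure μ] {U : Filter ℕ} [U.NeBot] (hU : U ≤ atTop)
    (h : ∀ B, MeasurableSet B → Tendsto (fun n => cesaro F m n B) U (𝓝 (μ.real B))) :
    MeasurePreserving F μ μ := by
  refine ⟨hF, ?_⟩
  ext B hB
  rw [Measure.map_apply hF hB]
  have h1 := h _ (hF hB)
  have h0 : Tendsto (fun n : ℕ => m.real univ / ((n : ℝ) + 1)) U (𝓝 0) :=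
    (((tendsto_const_div_atTop_nhds_zero_nat (m.real univ)).comp
      (tendsto_add_atTop_nat 1)).mono_left hU).congr fun n => by simp
  have h2 : Tendsto (fun n => cesaro F m n (F ⁻¹' B) - cesaro F m n B) U (𝓝 0) :=
    squeeze_zero_norm (fun n => cesaro_preimage_sub n B) h0
  have h3 := h1.sub (h B hB)
  have := tendsto_nhds_unique h3 h2
  exact (measureReal_eq_measureReal_iff).1 (sub_eq_zero.1 this)

theorem cesaro_univ (n : ℕ) : cesaro F m n univ = m.real univ := by
  unfold cesaro
  simp only [preimage_univ, Finset.sum_const, Finset.card_range, nsmul_eq_mul]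
  push_cast
  field_simp

theorem cesaro_union [IsFiniteMeasure m] (hF : Measurable F) {A B : Set ℝ} (hB : MeasurableSet B) (h : Disjoint A B)
    (n : ℕ) : cesaro F m n (A ∪ B) = cesaro F m n A + cesaro F m n B := by
  unfold cesaro
  rw [← add_div, ← Finset.sum_add_distrib]
  congr 1
  refine Finset.sum_congr rfl fun k _ => ?_
  rw [preimage_union, measureReal_union (h.preimage _) ((hF.iterate k) hB)]

/-- If the push-forwards of `m` are dominated by a multiple of `m`, there is an absolutely
continuous invariant measure. -/
theorem exists_invariant_of_bound [IsFiniteMeasure m] (hF : Measurable F) (hm : m ≠ 0) {C : ℝ≥0∞} (hC : C ≠ ∞)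
    (hb : ∀ (n : ℕ) (B : Set ℝ), MeasurableSet B → m.map F^[n] B ≤ C * m B) :
    ∃ μ : Measure ℝ, IsProbabilityMeasure μ ∧ μ ≪ m ∧ MeasurePreserving F μ μ := by
  -- Along a free ultrafilter the bounded averages converge for all sets at once, so no subsequences
  -- have to be chosen.
  set U : Ultrafilter ℕ := hyperfilter ℕ
  have hU : (U : Filter ℕ) ≤ atTop := Nat.hyperfilter_le_atTop
  have hbr : ∀ B, MeasurableSet B → ∀ n, cesaro F m n B ≤ C.toReal * m.real B := by
    intro B hB
    refine cesaro_le fun k => ?_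
    have := hb k B hB
    rw [Measure.map_apply (hF.iterate k) hB] at this
    rw [measureReal_def, measureReal_def, ← ENNReal.toReal_mul]
    exact ENNReal.toReal_mono (ENNReal.mul_ne_top hC (measure_ne_top _ _)) this
  have hlim : ∀ B, ∃ L : ℝ, MeasurableSet B → Tendsto (fun n => cesaro F m n B) U (𝓝 L) := by
    intro B
    by_cases hB : MeasurableSet B
    · have hc : IsCompact (Icc 0 (C.toReal * m.real B)) := isCompact_Icc
      obtain ⟨L, -, hL⟩ := hc.ultrafilter_le_nhds (U.map fun n => cesaro F m n B) (by
        rw [le_principal_iff]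
        exact mem_map.2 (univ_mem' fun n => ⟨cesaro_nonneg n B, hbr B hB n⟩))
      exact ⟨L, fun _ => hL⟩
    · exact ⟨0, fun h => absurd h hB⟩
  choose L hL using hlim
  have hL0 : ∀ B, MeasurableSet B → 0 ≤ L B := fun B hB =>
    ge_of_tendsto' (hL B hB) fun n => cesaro_nonneg n B
  have hLC : ∀ B, MeasurableSet B → L B ≤ C.toReal * m.real B := fun B hB =>
    le_of_tendsto' (hL B hB) fun n => hbr B hB n
  have hLadd : ∀ A B, MeasurableSet A → MeasurableSet B → Disjoint A B →
      L (A ∪ B) = L A + L B := by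
    intro A B hA hB hd
    refine tendsto_nhds_unique (hL _ (hA.union hB)) (((hL A hA).add (hL B hB)).congr fun n => ?_)
    exact (cesaro_union hF hB hd n).symm
  have hLempty : L ∅ = 0 := le_antisymm (by simpa using hLC ∅ .empty) (hL0 _ .empty)
  have hLsum : ∀ f : ℕ → Set ℝ, (∀ i, MeasurableSet (f i)) → Pairwise (Function.onFun Disjoint f) →
      HasSum (fun i => L (f i)) (L (⋃ i, f i)) := by
    intro f hf hd
    rw [hasSum_iff_tendsto_nat_of_nonneg fun i => hL0 _ (hf i)]
    have hfin : ∀ n, L (⋃ i, f i) =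
        ∑ i ∈ Finset.range n, L (f i) + L (⋃ i, f (i + n)) := by
      intro n
      induction n with
      | zero => simp
      | succ n ih =>
        rw [ih, Finset.sum_range_succ, add_assoc]
        congr 1
        rw [← hLadd _ _ (hf n) (MeasurableSet.iUnion fun i => hf _)]
        · congr 1
          ext x
          simp only [mem_iUnion, mem_union]
          constructor
          · rintro ⟨i, hi⟩
            rcases i with _ | i
            · exact Or.inl (by simpa using hi)
            · exact Or.inr ⟨i, by rwa [show i + (n + 1) = i + 1 + n by ring]⟩
          · rintro (hx | ⟨i, hi⟩)
            · exact ⟨0, by simpa using hx⟩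
            · exact ⟨i + 1, by rwa [show i + 1 + n = i + (n + 1) by ring]⟩
        · rw [disjoint_iUnion_right]
          intro i
          exact hd (by omega)
    -- Countable additivity does not survive the limit by itself; it follows from the domination `L
    -- ≤ C m`, which makes the tails of a disjoint union small.
    have htail : Tendsto (fun n => L (⋃ i, f (i + n))) atTop (𝓝 0) := by
      have h1 : Tendsto (fun n => C.toReal * m.real (⋃ i, f (i + n))) atTop (𝓝 (C.toReal * 0)) := by
        apply Tendsto.const_mul
        have h2 : Summable fun i => m.real (f i) := by
          have := ENNReal.summable_toReal (f := fun i => m (f i)) (by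
            rw [← measure_iUnion hd hf]; exact measure_ne_top _ _)
          exact this
        have h3 := tendsto_sum_nat_add fun i => m.real (f i)
        refine h3.congr fun n => ?_
        rw [measureReal_def, measure_iUnion (f := fun i => f (i + n)) (fun i j hij => hd (by omega)) fun i => hf _,
          ENNReal.tsum_toReal_eq fun i => measure_ne_top _ _]
        rfl
      rw [mul_zero] at h1
      exact squeeze_zero (fun n => hL0 _ (.iUnion fun i => hf _))
        (fun n => hLC _ (.iUnion fun i => hf _)) h1
    have : Tendsto (fun n => L (⋃ i, f i) - L (⋃ i, f (i + n))) atTop (𝓝 (L (⋃ i, f i) - 0)) :=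
      tendsto_const_nhds.sub htail
    rw [sub_zero] at this
    refine this.congr fun n => ?_
    rw [hfin n]; ring
  set μ : Measure ℝ := Measure.ofMeasurable (fun B _ => ENNReal.ofReal (L B)) (by simp [hLempty])
    (by
      intro f hf hd
      rw [← (hLsum f hf hd).tsum_eq, ENNReal.ofReal_tsum_of_nonneg (fun i => hL0 _ (hf i))
        (hLsum f hf hd).summable]) with hμ
  have hμB : ∀ B, MeasurableSet B → μ B = ENNReal.ofReal (L B) := fun B hB =>
    Measure.ofMeasurable_apply B hB
  have hμr : ∀ B, MeasurableSet B → μ.real B = L B := fun B hB => by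
    rw [measureReal_def, hμB B hB, ENNReal.toReal_ofReal (hL0 B hB)]
  have hfin : IsFiniteMeasure μ := ⟨by rw [hμB _ .univ]; exact ENNReal.ofReal_lt_top⟩
  have huniv : μ univ = m univ := by
    rw [hμB _ .univ, tendsto_nhds_unique (hL _ .univ)
      (tendsto_const_nhds.congr fun n => (cesaro_univ n).symm)]
    simp
  have hac : μ ≪ m := by
    refine Measure.AbsolutelyContinuous.mk fun B hB h0 => ?_
    rw [hμB B hB, ENNReal.ofReal_eq_zero]
    refine (hLC B hB).trans ?_
    simp [measureReal_def, h0]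
  have hinv : MeasurePreserving F μ μ :=
    measurePreserving_of_tendsto_cesaro (m := m) hF hU fun B hB => by
      rw [hμr B hB]; exact hL B hB
  have hm0 : μ univ ≠ 0 := by rw [huniv]; simpa using hm
  refine ⟨(μ univ)⁻¹ • μ, ⟨?_⟩, hac.smul_left _, hinv.smul_measure _⟩
  rw [Measure.smul_apply, smul_eq_mul, ENNReal.inv_mul_cancel hm0 (measure_ne_top _ _)]

end cesaro

/-! ### Lipschitz densities -/

/-- The hypothesis on the mass says that the density has mean 1, so bounded distortion confines it
between exp (-K) and exp K. On a bounded range a log-Lipschitz function is Lipschitz. -/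
theorem HasLogLipDensity.exists_real_density {K : ℝ} {W : Set ℝ} {ν : Measure ℝ} (hK : 0 ≤ K)
    (hν : HasLogLipDensity K ∞ W ν) (hW : MeasurableSet W)
    (hd : ∀ x ∈ W, ∀ y ∈ W, |x - y| ≤ 1) (h0 : volume W ≠ 0) (h1 : volume W ≠ ∞)
    (hmass : ν univ = volume W) :
    ∃ h : ℝ → ℝ, Measurable h ∧ (∀ x ∈ W, Real.exp (-K) ≤ h x ∧ h x ≤ Real.exp K) ∧
      (∀ x ∈ W, ∀ y ∈ W, |h x - h y| ≤ K * Real.exp (2 * K) * |x - y|) ∧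
      ∀ B, MeasurableSet B → ν.real B = ∫ x in B ∩ W, h x := by
  have hν' := hν.bound_of_mass hK hW hd h0 h1
  rw [hmass, ENNReal.mul_div_cancel_right h0 h1] at hν'
  obtain ⟨ρ, m1, m2, m3, rfl⟩ := hν'
  have hfin : ∀ x ∈ W, ρ x ≠ ∞ := fun x hx => ne_top_of_le_ne_top ENNReal.ofReal_ne_top (m2 x hx)
  have hup : ∀ x ∈ W, (ρ x).toReal ≤ Real.exp K := fun x hx =>
    ENNReal.toReal_le_of_le_ofReal (Real.exp_pos _).le (m2 x hx)
  have hratio : ∀ x ∈ W, ∀ y ∈ W, (ρ x).toReal ≤ Real.exp (K * |x - y|) * (ρ y).toReal := by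
    intro x hx y hy
    have := ENNReal.toReal_mono (ENNReal.mul_ne_top ENNReal.ofReal_ne_top (hfin y hy)) (m3 x hx y hy)
    rwa [ENNReal.toReal_mul, ENNReal.toReal_ofReal (Real.exp_pos _).le] at this
  have hlow : ∀ y ∈ W, Real.exp (-K) ≤ (ρ y).toReal := by
    intro y hy
    have e1 : volume W ≤ (ENNReal.ofReal (Real.exp K) * ρ y) * volume W := by
      rw [withDensity_apply _ .univ, Measure.restrict_univ] at hmass
      calc volume W = ∫⁻ x in W, ρ x := hmass.symm
        _ ≤ ∫⁻ x in W, ENNReal.ofReal (Real.exp K) * ρ y :=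
            setLIntegral_mono' hW fun x hx => (m3 x hx y hy).trans (by
              gcongr
              nlinarith [hd x hx y hy, abs_nonneg (x - y)])
        _ = _ := by simp
    have e2 : 1 ≤ ENNReal.ofReal (Real.exp K) * ρ y := by
      by_contra hlt
      rw [not_le] at hlt
      have := ENNReal.mul_lt_mul_left h0 h1 hlt
      rw [one_mul] at this
      exact absurd e1 (not_le.2 this)
    have e3 := ENNReal.toReal_mono (ENNReal.mul_ne_top ENNReal.ofReal_ne_top (hfin y hy)) e2
    rw [ENNReal.toReal_mul, ENNReal.toReal_ofReal (Real.exp_pos _).le, ENNReal.toReal_one] at e3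
    rw [Real.exp_neg, inv_le_iff_one_le_mul₀ (Real.exp_pos _)]
    linarith
  refine ⟨fun x => (ρ x).toReal, m1.ennreal_toReal, fun x hx => ⟨hlow x hx, hup x hx⟩, ?_, ?_⟩
  · have key : ∀ x ∈ W, ∀ y ∈ W,
        (ρ x).toReal - (ρ y).toReal ≤ K * Real.exp (2 * K) * |x - y| := by
      intro x hx y hy
      have e1 := hratio x hx y hy
      have e2 := hup y hy
      have e4 := abs_nonneg (x - y)
      -- With t = K |x - y| ≤ K: 1 - t ≤ exp (-t) gives exp t - 1 ≤ t exp t ≤ t exp K.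
      have e5 : Real.exp (K * |x - y|) - 1 ≤ K * |x - y| * Real.exp K := by
        have a1 := Real.add_one_le_exp (-(K * |x - y|))
        have a2 : Real.exp (K * |x - y|) ≤ Real.exp K :=
          Real.exp_le_exp.2 (by nlinarith [hd x hx y hy])
        have a3 : Real.exp (K * |x - y|) * Real.exp (-(K * |x - y|)) = 1 := by
          rw [← Real.exp_add]; simp
        have a4 : 0 ≤ K * |x - y| := by positivity
        nlinarith [Real.exp_pos (K * |x - y|)]
      have e6 : 0 ≤ (ρ y).toReal := ENNReal.toReal_nonneg
      have e7 : Real.exp (2 * K) = Real.exp K * Real.exp K := by rw [← Real.exp_add]; ring_nf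
      calc (ρ x).toReal - (ρ y).toReal ≤ (Real.exp (K * |x - y|) - 1) * (ρ y).toReal := by linarith
        _ ≤ (K * |x - y| * Real.exp K) * (ρ y).toReal := by gcongr
        _ ≤ (K * |x - y| * Real.exp K) * Real.exp K := by gcongr
        _ = _ := by rw [e7]; ring
    intro x hx y hy
    rw [abs_le]
    have := key x hx y hy
    have := key y hy x hx
    rw [abs_sub_comm y x] at this
    constructor <;> linarith
  · intro B hB
    rw [measureReal_def, withDensity_apply _ hB, Measure.restrict_restrict hB,
      integral_toReal m1.aemeasurable]
    exact (ae_restrict_mem (hB.inter hW)).mono fun x hx => (hfin x hx.2).lt_top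

/-- The common Lipschitz constant reduces the uniform estimate to finitely many points of a fine
net, along any filter. -/
theorem tendsto_uniform_of_pointwise {W : Set ℝ} {a b : ℝ} (hW : W ⊆ Icc a b) {H : ℕ → ℝ → ℝ}
    {g : ℝ → ℝ} {L : ℝ} (hL : 0 ≤ L) {U : Filter ℕ}
    (hH : ∀ n, ∀ x ∈ W, ∀ y ∈ W, |H n x - H n y| ≤ L * |x - y|)
    (hg : ∀ x ∈ W, ∀ y ∈ W, |g x - g y| ≤ L * |x - y|)
    (hlim : ∀ x ∈ W, Tendsto (fun n => H n x) U (𝓝 (g x))) {η : ℝ} (hη : 0 < η) :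
    ∀ᶠ n in U, ∀ x ∈ W, |H n x - g x| ≤ η := by
  obtain ⟨t, htW, htf, hcov⟩ := Metric.finite_approx_of_totallyBounded ((totallyBounded_Icc a b).subset hW)
    (η / (4 * (L + 1))) (by positivity)
  have h1 : ∀ᶠ n in U, ∀ y ∈ t, |H n y - g y| < η / 2 := by
    rw [eventually_all_finite htf]
    intro y hy
    have := (Metric.tendsto_nhds.1 (hlim y (htW hy))) (η / 2) (by positivity)
    simpa [Real.dist_eq] using this
  filter_upwards [h1] with n hn x hx
  obtain ⟨y, hy, hxy⟩ := mem_iUnion₂.1 (hcov hx)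
  rw [Metric.mem_ball, Real.dist_eq] at hxy
  have e1 := hH n x hx y (htW hy)
  have e2 := hg x hx y (htW hy)
  have e3 := hn y hy
  have e4 : L * |x - y| ≤ η / 4 := by
    rw [lt_div_iff₀ (by positivity)] at hxy
    nlinarith [abs_nonneg (x - y)]
  have : H n x - g x = (H n x - H n y) + (H n y - g y) - (g x - g y) := by ring
  rw [this]
  calc _ ≤ |(H n x - H n y) + (H n y - g y)| + |g x - g y| := abs_sub _ _
    _ ≤ |H n x - H n y| + |H n y - g y| + |g x - g y| := by gcongr; exact abs_add_le _ _
    _ ≤ _ := by linarith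

namespace IsPiecewiseExpanding

/-- A full-branched map has an invariant probability with a Lipschitz density that is bounded away
from zero. -/
theorem exists_lipschitz_density {ι : Type} [Countable ι] {F : ℝ → ℝ} {I : ι → Set ℝ}
    {D lam : ℝ} {W : Set ℝ}
    (h : IsPiecewiseExpanding F I (fun _ : Unit => W) (fun _ => ()) D lam W) :
    ∃ (μ : Measure ℝ) (g : ℝ → ℝ) (L : NNReal) (a : ℝ), IsProbabilityMeasure μ ∧
      MeasurePreserving F μ μ ∧ LipschitzWith L g ∧ 0 < a ∧ (∀ x, a ≤ g x) ∧
      μ = (volume.restrict W).withDensity fun x => ENNReal.ofReal (g x) := by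
  have hD := h.dist_nonneg
  have hWo := h.ordConnected_dom
  have hWm := hWo.measurableSet
  have hW0 : volume W ≠ 0 := h.image_pos ()
  have hW1 : volume W ≤ 1 := h.volume_le_one_of_subset subset_rfl
  have hWt : volume W ≠ ∞ := (hW1.trans_lt ENNReal.one_lt_top).ne
  obtain ⟨a, b, hWb⟩ : ∃ a b, W ⊆ Icc a b := by
    obtain ⟨x₀, hx₀⟩ := nonempty_of_measure_ne_zero hW0
    refine ⟨x₀ - 1, x₀ + 1, fun x hx => ?_⟩
    have := abs_le.1 (h.diam_dom x hx x₀ hx₀)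
    constructor <;> linarith
  set K := 2 * D with hK
  have hK0 : 0 ≤ K := by positivity
  set m : Measure ℝ := volume.restrict W with hm
  have hmf : IsFiniteMeasure m := ⟨by rw [hm, Measure.restrict_apply_univ]; exact hWt.lt_top⟩
  have hreg : ∀ k, HasLogLipDensity K ∞ W (m.map F^[k]) := by
    intro k
    induction k with
    | zero =>
      rw [Function.iterate_zero, Measure.map_id]
      exact (HasLogLipDensity.volume_restrict hK0 W).mono le_rfl le_top
    | succ k ih =>
      rw [Function.iterate_succ', ← Measure.map_map h.measurable (h.measurable.iterate k)]
      exact h.map_of_full hWo h.subset ih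
  have hdens := fun k => (hreg k).exists_real_density hK0 hWm h.diam_dom hW0 hWt (by
    rw [Measure.map_apply (h.measurable.iterate k) .univ, preimage_univ, hm,
      Measure.restrict_apply_univ])
  choose d dm db dl dint using hdens
  set L : ℝ := K * Real.exp (2 * K) with hL
  have hL0 : 0 ≤ L := by positivity
  set H : ℕ → ℝ → ℝ := fun n x => (∑ k ∈ Finset.range (n + 1), d k x) / (n + 1) with hH
  have hHb : ∀ n, ∀ x ∈ W, H n x ∈ Icc (Real.exp (-K)) (Real.exp K) := by
    intro n x hx
    have e1 := Finset.sum_le_sum fun k (_ : k ∈ Finset.range (n + 1)) => (db k x hx).1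
    have e2 := Finset.sum_le_sum fun k (_ : k ∈ Finset.range (n + 1)) => (db k x hx).2
    simp only [Finset.sum_const, Finset.card_range, nsmul_eq_mul] at e1 e2
    push_cast at e1 e2
    constructor
    · rw [le_div_iff₀ (by positivity)]; linarith
    · rw [div_le_iff₀ (by positivity)]; linarith
  have hHl : ∀ n, ∀ x ∈ W, ∀ y ∈ W, |H n x - H n y| ≤ L * |x - y| := by
    intro n x hx y hy
    simp only [hH]
    rw [← sub_div, ← Finset.sum_sub_distrib, abs_div, abs_of_pos (by positivity : (0 : ℝ) < n + 1),
      div_le_iff₀ (by positivity)]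
    calc _ ≤ ∑ k ∈ Finset.range (n + 1), |d k x - d k y| := Finset.abs_sum_le_sum_abs _ _
      _ ≤ ∑ k ∈ Finset.range (n + 1), L * |x - y| :=
          Finset.sum_le_sum fun k _ => dl k x hx y hy
      _ = _ := by simp; ring
  set U : Ultrafilter ℕ := hyperfilter ℕ
  have hU : (U : Filter ℕ) ≤ atTop := Nat.hyperfilter_le_atTop
  have hlim : ∀ x, ∃ l : ℝ, x ∈ W → l ∈ Icc (Real.exp (-K)) (Real.exp K) ∧
      Tendsto (fun n => H n x) U (𝓝 l) := by
    intro x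
    by_cases hx : x ∈ W
    · obtain ⟨l, hl, hL⟩ := (isCompact_Icc (a := Real.exp (-K)) (b := Real.exp K)).ultrafilter_le_nhds
        (U.map fun n => H n x) (by
          rw [le_principal_iff]
          exact mem_map.2 (univ_mem' fun n => hHb n x hx))
      exact ⟨l, fun _ => ⟨hl, hL⟩⟩
    · exact ⟨0, fun h => absurd h hx⟩
  choose g₀ hg₀ using hlim
  have hg₀l : ∀ x ∈ W, ∀ y ∈ W, |g₀ x - g₀ y| ≤ L * |x - y| := fun x hx y hy =>
    le_of_tendsto' ((hg₀ x hx).2.sub (hg₀ y hy).2).abs fun n => hHl n x hx y hy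
  have hlip : LipschitzOnWith L.toNNReal g₀ W := by
    refine LipschitzOnWith.of_dist_le_mul fun x hx y hy => ?_
    rw [Real.dist_eq, Real.dist_eq, Real.coe_toNNReal _ hL0]
    exact hg₀l x hx y hy
  -- Extending to the line and then truncating below at exp (-K) does not change the values on `W`,
  -- and makes continuity and the lower bound global.
  obtain ⟨g₁, hg₁, hgeq⟩ := hlip.extend_real
  set g : ℝ → ℝ := fun x => max (g₁ x) (Real.exp (-K)) with hg
  have hgW : ∀ x ∈ W, g x = g₀ x := fun x hx => by
    simp only [hg]
    rw [← hgeq hx, max_eq_left (hg₀ x hx).1.1]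
  have hgl : LipschitzWith L.toNNReal g := hg₁.max_const _
  have hgpos : ∀ x, Real.exp (-K) ≤ g x := fun x => le_max_right _ _
  set μ : Measure ℝ := m.withDensity fun x => ENNReal.ofReal (g x) with hμ
  have hgint : ∀ B, IntegrableOn g (B ∩ W) := by
    intro B
    exact (hgl.continuous.integrableOn_Icc (a := a) (b := b)).mono_set (inter_subset_right.trans hWb)
  have hμr : ∀ B, MeasurableSet B → μ.real B = ∫ x in B ∩ W, g x := by
    intro B hB
    rw [measureReal_def, hμ, withDensity_apply _ hB, hm, Measure.restrict_restrict hB,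
      integral_eq_lintegral_of_nonneg_ae (ae_of_all _ fun x => (Real.exp_pos _).le.trans (hgpos x))
      (hgl.continuous.aestronglyMeasurable)]
  have hces : ∀ B, MeasurableSet B → ∀ n, cesaro F m n B = ∫ x in B ∩ W, H n x := by
    intro B hB n
    simp only [hH, cesaro]
    rw [integral_div, integral_finsetSum]
    · congr 1
      refine Finset.sum_congr rfl fun k _ => ?_
      rw [← dint k B hB, map_measureReal_apply (h.measurable.iterate k) hB]
    · intro k _
      refine Measure.integrableOn_of_bounded (M := Real.exp K)
        ((measure_mono inter_subset_right).trans_lt hWt.lt_top).ne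
        (dm k).aestronglyMeasurable ?_
      refine (ae_restrict_mem (hB.inter hWm)).mono fun x hx => ?_
      rw [Real.norm_eq_abs, abs_of_nonneg ((Real.exp_pos _).le.trans (db k x hx.2).1)]
      exact (db k x hx.2).2
  have hHint : ∀ n B, MeasurableSet B → IntegrableOn (H n) (B ∩ W) := by
    intro n B hB
    refine Measure.integrableOn_of_bounded (M := Real.exp K)
      ((measure_mono inter_subset_right).trans_lt hWt.lt_top).ne
      (by
        have : Measurable (H n) := by simp only [hH]; fun_prop
        exact this.aestronglyMeasurable) ?_
    refine (ae_restrict_mem (hB.inter hWm)).mono fun x hx => ?_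
    rw [Real.norm_eq_abs, abs_of_nonneg ((Real.exp_pos _).le.trans (hHb n x hx.2).1)]
    exact (hHb n x hx.2).2
  have htend : ∀ B, MeasurableSet B → Tendsto (fun n => cesaro F m n B) U (𝓝 (μ.real B)) := by
    intro B hB
    rw [Metric.tendsto_nhds]
    intro η hη
    filter_upwards [tendsto_uniform_of_pointwise hWb hL0 hHl hg₀l (fun x hx => (hg₀ x hx).2)
      (half_pos hη)] with n hn
    rw [Real.dist_eq, hces B hB, hμr B hB, ← integral_sub (hHint n B hB) (hgint B)]
    have hlt : volume (B ∩ W) < ∞ := (measure_mono inter_subset_right).trans_lt hWt.lt_top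
    have e1 : ‖∫ x in B ∩ W, (H n x - g x)‖ ≤ η / 2 * volume.real (B ∩ W) :=
      norm_setIntegral_le_of_norm_le_const hlt fun x hx => by
        rw [Real.norm_eq_abs, hgW x hx.2]; exact hn x hx.2
    have e2 : volume.real (B ∩ W) ≤ 1 := by
      rw [measureReal_def]
      exact ENNReal.toReal_le_of_le_ofReal zero_le_one
        (by simpa using (measure_mono inter_subset_right).trans hW1)
    rw [Real.norm_eq_abs] at e1
    nlinarith
  have hμf : IsFiniteMeasure μ := by
    refine ⟨?_⟩
    rw [hμ, withDensity_apply _ .univ, Measure.restrict_univ]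
    have := (hgint univ).lintegral_lt_top
    rwa [univ_inter] at this
  have hinv := measurePreserving_of_tendsto_cesaro h.measurable hU htend
  have huniv : μ.real univ = volume.real W := by
    have e1 := tendsto_nhds_unique (htend _ .univ)
      (tendsto_const_nhds.congr fun n => (cesaro_univ n).symm)
    rw [e1, hm, measureReal_restrict_apply .univ, univ_inter]
  have hV : 0 < volume.real W := ENNReal.toReal_pos hW0 hWt
  have hgsc : LipschitzWith ((volume.real W)⁻¹.toNNReal * L.toNNReal)
      fun x => (volume.real W)⁻¹ * g x := by
    refine LipschitzWith.of_dist_le_mul fun x y => ?_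
    rw [Real.dist_eq, ← mul_sub, abs_mul, NNReal.coe_mul, Real.coe_toNNReal _ (by positivity),
      abs_of_pos (by positivity), mul_assoc]
    gcongr
    exact hgl.dist_le_mul x y
  have hμeq : (μ univ)⁻¹ • μ = (volume.restrict W).withDensity
      fun x => ENNReal.ofReal ((volume.real W)⁻¹ * g x) := by
    have e1 : μ univ = volume W := by
      rw [← ENNReal.toReal_eq_toReal_iff' (measure_ne_top _ _) hWt]; exact huniv
    rw [e1, hμ, ← withDensity_smul _ (by have := hgl.continuous.measurable; fun_prop)]
    congr 1
    ext x
    rw [Pi.smul_apply, smul_eq_mul, ENNReal.ofReal_mul (by positivity),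
      ENNReal.ofReal_inv_of_pos hV, measureReal_def, ENNReal.ofReal_toReal hWt]
  refine ⟨(μ univ)⁻¹ • μ, _, _, (volume.real W)⁻¹ * Real.exp (-K), ⟨?_⟩, hinv.smul_measure _,
    hgsc, by positivity, fun x => by have := hgpos x; gcongr, hμeq⟩
  have hm0 : μ univ ≠ 0 := by
    intro h0
    rw [measureReal_def, h0] at huniv
    simp at huniv
    exact hV.ne huniv
  rw [Measure.smul_apply, smul_eq_mul, ENNReal.inv_mul_cancel hm0 (measure_ne_top _ _)]

end IsPiecewiseExpanding

/-! ### Uniqueness of absolutely continuous invariant measures -/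

theorem ergodic_of_trivial {F : ℝ → ℝ} {Δ : Set ℝ}
    (h : ∀ A, MeasurableSet A → F ⁻¹' A = A → volume (Δ ∩ A) = 0 ∨ volume (Δ \ A) = 0)
    {μ : Measure ℝ} (hμ : μ ≪ volume.restrict Δ) (hF : MeasurePreserving F μ μ) :
    Ergodic F μ := by
  refine ⟨hF, ⟨fun A hA hFA => ?_⟩⟩
  rw [Filter.eventuallyConst_set]
  rcases h A hA hFA with h0 | h0
  · right
    refine measure_eq_zero_iff_ae_notMem.1 (hμ ?_)
    rwa [Measure.restrict_apply hA, inter_comm]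
  · left
    change ∀ᵐ x ∂μ, x ∈ A
    rw [ae_iff]
    refine hμ ?_
    have e : {a | a ∉ A} = Aᶜ := rfl
    rw [e, Measure.restrict_apply hA.compl, inter_comm]
    exact h0

/-- The sum μ + ν is ergodic and dominates both measures, so each is a constant multiple of it;
equal total masses make the constants equal. -/
theorem IsACIM.eq_of_trivial {F : ℝ → ℝ} {Δ : Set ℝ}
    (h : ∀ A, MeasurableSet A → F ⁻¹' A = A → volume (Δ ∩ A) = 0 ∨ volume (Δ \ A) = 0)
    {μ ν : Measure ℝ} (hμ : IsACIM F Δ μ) (hν : IsACIM F Δ ν) : μ = ν := by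
  obtain ⟨pμ, aμ, iμ⟩ := hμ
  obtain ⟨pν, aν, iν⟩ := hν
  have hsum : MeasurePreserving F (μ + ν) (μ + ν) :=
    ⟨iμ.measurable, by rw [Measure.map_add _ _ iμ.measurable, iμ.map_eq, iν.map_eq]⟩
  have hac : μ + ν ≪ volume.restrict Δ := by
    refine Measure.AbsolutelyContinuous.mk fun B _ h0 => ?_
    rw [Measure.add_apply, aμ h0, aν h0, add_zero]
  have herg := ergodic_of_trivial h hac hsum
  obtain ⟨c, hc⟩ := herg.eq_smul_of_absolutelyContinuous iμ
    (Measure.absolutelyContinuous_of_le (Measure.le_add_right le_rfl))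
  obtain ⟨d, hd⟩ := herg.eq_smul_of_absolutelyContinuous iν
    (Measure.absolutelyContinuous_of_le (Measure.le_add_left le_rfl))
  have hc1 := congrArg (fun m : Measure ℝ => m univ) hc
  have hd1 := congrArg (fun m : Measure ℝ => m univ) hd
  simp only [measure_univ, Measure.smul_apply, Measure.add_apply, smul_eq_mul] at hc1 hd1
  have : c = d := by
    have h2 : (1 + 1 : ℝ≥0∞) ≠ 0 := by simp
    have h3 : (1 + 1 : ℝ≥0∞) ≠ ∞ := by simp
    rw [← ENNReal.mul_left_inj h2 h3, ← hc1, ← hd1]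
  exact hc.trans (this ▸ hd.symm)

/-! ### Images of intervals under monotone maps -/

theorem image_Ioo_of_strictMonoOn {f : ℝ → ℝ} {a b : ℝ} (hab : a ≤ b) (hf : StrictMonoOn f (Icc a b))
    (hc : ContinuousOn f (Icc a b)) : f '' Ioo a b = Ioo (f a) (f b) := by
  apply Subset.antisymm
  · rintro _ ⟨x, hx, rfl⟩
    exact ⟨hf (left_mem_Icc.2 hab) (Ioo_subset_Icc_self hx) hx.1,
      hf (Ioo_subset_Icc_self hx) (right_mem_Icc.2 hab) hx.2⟩
  · exact intermediate_value_Ioo hab hc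

theorem image_Ioo_of_strictAntiOn {f : ℝ → ℝ} {a b : ℝ} (hab : a ≤ b) (hf : StrictAntiOn f (Icc a b))
    (hc : ContinuousOn f (Icc a b)) : f '' Ioo a b = Ioo (f b) (f a) := by
  apply Subset.antisymm
  · rintro _ ⟨x, hx, rfl⟩
    exact ⟨hf (Ioo_subset_Icc_self hx) (right_mem_Icc.2 hab) hx.2,
      hf (left_mem_Icc.2 hab) (Ioo_subset_Icc_self hx) hx.1⟩
  · exact intermediate_value_Ioo' hab hc

/-- Adler's condition implies bounded distortion. -/
theorem distortion_of_adler {F : ℝ → ℝ} {I : Set ℝ} {D : ℝ} (hI : I.OrdConnected)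
    (hd1 : ∀ x ∈ I, DifferentiableAt ℝ F x) (hd2 : ∀ x ∈ I, DifferentiableAt ℝ (deriv F) x)
    (h0 : ∀ x ∈ I, deriv F x ≠ 0) (hD : ∀ x ∈ I, |deriv (deriv F) x| / (deriv F x) ^ 2 ≤ D) :
    ∀ x ∈ I, ∀ y ∈ I, |deriv F x| ≤ Real.exp (D * |F x - F y|) * |deriv F y| := by
  have key : ∀ x ∈ I, ∀ y ∈ I, x < y →
      abs (Real.log |deriv F y| - Real.log |deriv F x|) ≤ D * |F y - F x| := by
    intro x hx y hy hxy
    have hsub := hI.out hx hy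
    have hlog : ∀ z ∈ Icc x y, HasDerivAt (fun t => Real.log |deriv F t|)
        (deriv (deriv F) z / deriv F z) z := by
      intro z hz
      have := (hd2 z (hsub hz)).hasDerivAt.log (h0 z (hsub hz))
      simpa only [Real.log_abs] using this
    -- Cauchy's mean value theorem for log |F'| against F: the ratio of their derivatives is F'' /
    -- (F')², the quantity in Adler's condition.
    obtain ⟨c, hc, h⟩ := exists_ratio_hasDerivAt_eq_ratio_slope (fun t => Real.log |deriv F t|)
      (fun t => deriv (deriv F) t / deriv F t) hxy
      (fun z hz => (hlog z hz).continuousAt.continuousWithinAt)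
      (fun z hz => hlog z (Ioo_subset_Icc_self hz)) F (deriv F)
      (fun z hz => (hd1 z (hsub hz)).continuousAt.continuousWithinAt)
      (fun z hz => (hd1 z (hsub (Ioo_subset_Icc_self hz))).hasDerivAt)
    have hcI := hsub (Ioo_subset_Icc_self hc)
    have hne := h0 c hcI
    have e1 : Real.log |deriv F y| - Real.log |deriv F x| =
        (F y - F x) * (deriv (deriv F) c / (deriv F c) ^ 2) := by
      have h' := h
      field_simp at h' ⊢
      linarith
    rw [e1, abs_mul, mul_comm, abs_div, abs_of_nonneg (sq_nonneg (deriv F c))]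
    gcongr
    exact hD c hcI
  have key2 : ∀ x ∈ I, ∀ y ∈ I,
      Real.log |deriv F x| - Real.log |deriv F y| ≤ D * |F x - F y| := by
    intro x hx y hy
    rcases lt_trichotomy x y with h | rfl | h
    · have := neg_le_of_abs_le (key x hx y hy h)
      rw [abs_sub_comm (F x)]; linarith
    · simp
    · exact (le_abs_self _).trans (key y hy x hx h)
  intro x hx y hy
  have hx0 := abs_pos.2 (h0 x hx)
  have hy0 := abs_pos.2 (h0 y hy)
  have := Real.exp_le_exp.2 (key2 x hx y hy)
  rwa [Real.exp_sub, Real.exp_log hx0, Real.exp_log hy0, div_le_iff₀ hy0] at this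

/-! ### The neutral branch -/

/-- The neutral branch `x + c x ^ (1 + α)`. -/
noncomputable def neutral (α c x : ℝ) : ℝ := x + c * x ^ (1 + α)

section neutral

variable {α c : ℝ}

theorem continuous_neutral (hα : 0 < α) : Continuous (neutral α c) := by
  unfold neutral
  have := Real.continuous_rpow_const (q := 1 + α) (by linarith)
  fun_prop

theorem neutral_zero (hα : 0 < α) : neutral α c 0 = 0 := by
  unfold neutral
  rw [Real.zero_rpow (by linarith)]; ring

theorem neutral_strictMonoOn (hα : 0 < α) (hc : 0 ≤ c) : StrictMonoOn (neutral α c) (Ici 0) := by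
  intro x hx y hy hxy
  unfold neutral
  have := Real.rpow_le_rpow hx hxy.le (by linarith : 0 ≤ 1 + α)
  nlinarith

theorem neutral_gt (hc : 0 < c) {x : ℝ} (hx : 0 < x) : x < neutral α c x := by
  unfold neutral
  have := Real.rpow_pos_of_pos hx (1 + α)
  nlinarith

theorem neutral_pos (hc : 0 ≤ c) {x : ℝ} (hx : 0 < x) : 0 < neutral α c x := by
  unfold neutral
  have := Real.rpow_pos_of_pos hx (1 + α)
  positivity

theorem neutral_mono_coeff {c' : ℝ} (hc : c ≤ c') {x : ℝ} (hx : 0 ≤ x) :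
    neutral α c x ≤ neutral α c' x := by
  unfold neutral
  have := Real.rpow_nonneg hx (1 + α)
  gcongr

theorem hasDerivAt_neutral {x : ℝ} (hx : 0 < x) :
    HasDerivAt (neutral α c) (1 + c * ((1 + α) * x ^ α)) x := by
  unfold neutral
  have h := (Real.hasDerivAt_rpow_const (p := 1 + α) (Or.inl hx.ne')).const_mul c
  have := (hasDerivAt_id' x).fun_add h
  simpa using this

theorem hasDerivAt_neutral_deriv {x : ℝ} (hx : 0 < x) :
    HasDerivAt (fun x => 1 + c * ((1 + α) * x ^ α)) (c * ((1 + α) * (α * x ^ (α - 1)))) x := by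
  have h := ((Real.hasDerivAt_rpow_const (p := α) (Or.inl hx.ne')).const_mul (1 + α)).const_mul c
  simpa using h.const_add 1

/-- The derivative of the iterates of the neutral branch. -/
noncomputable def neutralD1 (α c : ℝ) : ℕ → ℝ → ℝ
  | 0, _ => 1
  | n + 1, x => (1 + c * ((1 + α) * ((neutral α c)^[n] x) ^ α)) * neutralD1 α c n x

/-- The second derivative of the iterates of the neutral branch. -/
noncomputable def neutralD2 (α c : ℝ) : ℕ → ℝ → ℝ
  | 0, _ => 0
  | n + 1, x => c * ((1 + α) * (α * ((neutral α c)^[n] x) ^ (α - 1))) * neutralD1 α c n x *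
      neutralD1 α c n x +
      (1 + c * ((1 + α) * ((neutral α c)^[n] x) ^ α)) * neutralD2 α c n x

theorem iterate_neutral_pos (hc : 0 ≤ c) {x : ℝ} (hx : 0 < x) (n : ℕ) :
    0 < (neutral α c)^[n] x := by
  induction n with
  | zero => exact hx
  | succ n ih => rw [Function.iterate_succ_apply']; exact neutral_pos hc ih

theorem hasDerivAt_iterate_neutral (hc : 0 ≤ c) (n : ℕ) {x : ℝ} (hx : 0 < x) :
    HasDerivAt ((neutral α c)^[n]) (neutralD1 α c n x) x := by
  induction n with
  | zero => exact hasDerivAt_id x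
  | succ n ih =>
    rw [Function.iterate_succ']
    exact (hasDerivAt_neutral (iterate_neutral_pos hc hx n)).comp x ih

theorem hasDerivAt_neutralD1 (hc : 0 ≤ c) (n : ℕ) {x : ℝ} (hx : 0 < x) :
    HasDerivAt (neutralD1 α c n) (neutralD2 α c n x) x := by
  induction n with
  | zero => exact hasDerivAt_const x 1
  | succ n ih =>
    have h1 := (hasDerivAt_neutral_deriv (α := α) (c := c) (iterate_neutral_pos (α := α) hc hx n)).comp x
      (hasDerivAt_iterate_neutral hc n hx)
    exact h1.mul ih

theorem one_le_neutralD1 (hα : 0 < α) (hc : 0 ≤ c) (n : ℕ) {x : ℝ} (hx : 0 < x) :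
    1 ≤ neutralD1 α c n x := by
  induction n with
  | zero => exact le_rfl
  | succ n ih =>
    have h1 : 0 ≤ c * ((1 + α) * ((neutral α c)^[n] x) ^ α) := by
      have := Real.rpow_pos_of_pos (iterate_neutral_pos (α := α) hc hx n) α
      positivity
    change 1 ≤ (1 + c * ((1 + α) * ((neutral α c)^[n] x) ^ α)) * neutralD1 α c n x
    nlinarith

/-- The nonlinearity of the iterates is controlled by the position of the image. -/
theorem neutralD2_bound (hα : 0 < α) (hα1 : α < 1) (hc : 0 ≤ c) (n : ℕ) {x : ℝ} (hx : 0 < x) :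
    0 ≤ neutralD2 α c n x ∧
      neutralD2 α c n x * (neutral α c)^[n] x ≤ 2 * (neutralD1 α c n x) ^ 2 := by
  induction n with
  | zero => simp [neutralD2, neutralD1]
  | succ n ih =>
    obtain ⟨ih0, ih1⟩ := ih
    rw [Function.iterate_succ_apply']
    simp only [neutralD2, neutralD1]
    have hy := iterate_neutral_pos (α := α) hc hx n
    have hd1 : 0 ≤ neutralD1 α c n x := zero_le_one.trans (one_le_neutralD1 hα hc n hx)
    set y := (neutral α c)^[n] x
    set d1 := neutralD1 α c n x
    set d2 := neutralD2 α c n x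
    have hyα := Real.rpow_pos_of_pos hy α
    have e1 : y ^ (α - 1) = y ^ α / y := by rw [Real.rpow_sub hy, Real.rpow_one]
    have e2 : y ^ (1 + α) = y * y ^ α := by rw [Real.rpow_add hy, Real.rpow_one]
    -- In terms of t the branch sends y to y (1 + t), with derivative 1 + (1 + α) t and second
    -- derivative (1 + α) α t / y.
    obtain ⟨t, ht⟩ : ∃ t, t = c * y ^ α := ⟨_, rfl⟩
    have ht0 : 0 ≤ t := by rw [ht]; positivity
    have e3 : neutral α c y = y * (1 + t) := by rw [neutral, e2, ht]; ring
    have e4 : c * ((1 + α) * y ^ α) = (1 + α) * t := by rw [ht]; ring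
    have e5 : c * ((1 + α) * (α * y ^ (α - 1))) = (1 + α) * α * t / y := by rw [ht, e1]; ring
    rw [e3, e4, e5]
    constructor
    · positivity
    · have e6 : ((1 + α) * α * t / y * d1 * d1 + (1 + (1 + α) * t) * d2) * (y * (1 + t)) =
          (1 + α) * α * t * (1 + t) * d1 ^ 2 + (1 + (1 + α) * t) * (1 + t) * (d2 * y) := by
        field_simp
      rw [e6]
      have e7 : (1 + (1 + α) * t) * (1 + t) * (d2 * y) ≤
          (1 + (1 + α) * t) * (1 + t) * (2 * d1 ^ 2) := by gcongr
      -- The right side minus the left side is α t ((1 - α) + (1 + α) t), nonnegative because α < 1.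
      -- This is what allows the constant 2 to be kept through the induction.
      have e8 : (1 + α) * α * t * (1 + t) + (1 + (1 + α) * t) * (1 + t) * 2 ≤
          2 * (1 + (1 + α) * t) ^ 2 := by
        have : 0 ≤ α * t * ((1 - α) + (1 + α) * t) := by
          have : 0 ≤ 1 - α := by linarith
          positivity
        nlinarith
      nlinarith [sq_nonneg d1]

theorem iterate_neutral_strictMonoOn (hα : 0 < α) (hc : 0 ≤ c) (n : ℕ) :
    StrictMonoOn ((neutral α c)^[n]) (Ici 0) := by
  have hmaps : MapsTo (neutral α c) (Ici 0) (Ici 0) := by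
    intro x hx
    rcases eq_or_lt_of_le (mem_Ici.1 hx) with h | h
    · rw [← h, neutral_zero hα]; exact self_mem_Ici
    · exact (neutral_pos hc h).le
  induction n with
  | zero => exact strictMono_id.strictMonoOn _
  | succ n ih => rw [Function.iterate_succ]; exact ih.comp (neutral_strictMonoOn hα hc) hmaps

theorem exists_neutral_eq (hα : 0 < α) (hc : 0 < c) {y : ℝ} (hy : 0 < y) :
    ∃ x, 0 < x ∧ neutral α c x = y := by
  have h := intermediate_value_Icc hy.le (continuous_neutral (c := c) hα).continuousOn
  obtain ⟨x, hx, hxy⟩ := h ⟨by rw [neutral_zero hα]; exact hy.le, (neutral_gt hc hy).le⟩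
  refine ⟨x, lt_of_le_of_ne hx.1 ?_, hxy⟩
  rintro rfl
  rw [neutral_zero hα] at hxy
  exact hy.ne hxy

open Classical in
/-- The inverse of the neutral branch. -/
noncomputable def neutralInv (α c y : ℝ) : ℝ :=
  if h : ∃ x, 0 < x ∧ neutral α c x = y then h.choose else 0

theorem neutralInv_spec (hα : 0 < α) (hc : 0 < c) {y : ℝ} (hy : 0 < y) :
    0 < neutralInv α c y ∧ neutral α c (neutralInv α c y) = y := by
  have h := exists_neutral_eq hα hc hy
  rw [neutralInv, dif_pos h]
  exact h.choose_spec

/-- The backward orbit `z 0 = neutral (1/4)`, `z 1 = 1/4`, `z 2`, … under the neutral branch. -/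
noncomputable def backOrbit (α c : ℝ) (n : ℕ) : ℝ := (neutralInv α c)^[n] (neutral α c (1 / 4))

theorem backOrbit_pos (hα : 0 < α) (hc : 0 < c) (n : ℕ) : 0 < backOrbit α c n := by
  induction n with
  | zero => exact neutral_pos hc.le (by norm_num)
  | succ n ih =>
    rw [backOrbit, Function.iterate_succ_apply']
    exact (neutralInv_spec hα hc ih).1

theorem neutral_backOrbit_succ (hα : 0 < α) (hc : 0 < c) (n : ℕ) :
    neutral α c (backOrbit α c (n + 1)) = backOrbit α c n := by
  rw [backOrbit, Function.iterate_succ_apply']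
  exact (neutralInv_spec hα hc (backOrbit_pos hα hc n)).2

theorem backOrbit_one (hα : 0 < α) (hc : 0 < c) : backOrbit α c 1 = 1 / 4 :=
  (neutral_strictMonoOn hα hc.le).injOn (backOrbit_pos hα hc 1).le
    (mem_Ici.2 (by norm_num)) (neutral_backOrbit_succ hα hc 0)

theorem backOrbit_strictAnti (hα : 0 < α) (hc : 0 < c) : StrictAnti (backOrbit α c) := by
  refine strictAnti_nat_of_succ_lt fun n => ?_
  rw [← neutral_backOrbit_succ hα hc n]
  exact neutral_gt hc (backOrbit_pos hα hc _)

theorem iterate_neutral_backOrbit (hα : 0 < α) (hc : 0 < c) (n k : ℕ) :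
    (neutral α c)^[n] (backOrbit α c (n + k)) = backOrbit α c k := by
  induction n with
  | zero => simp
  | succ n ih =>
    rw [Function.iterate_succ_apply, show n + 1 + k = n + k + 1 by ring,
      neutral_backOrbit_succ hα hc, ih]

/-- A larger coefficient moves points further to the right, so preimages lie further to the left.
The induction starts at index 1, the common point 1/4; at index 0 the order is reversed. -/
theorem backOrbit_anti_coeff (hα : 0 < α) (hc : 0 < c) {c' : ℝ} (hcc : c ≤ c') (n : ℕ) :
    backOrbit α c' (n + 1) ≤ backOrbit α c (n + 1) := by
  have hc' := hc.trans_le hcc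
  induction n with
  | zero => rw [zero_add, backOrbit_one hα hc, backOrbit_one hα hc']
  | succ n ih =>
    rw [← (neutral_strictMonoOn hα hc'.le).le_iff_le (backOrbit_pos hα hc' _).le
      (backOrbit_pos hα hc _).le, neutral_backOrbit_succ hα hc']
    calc _ ≤ backOrbit α c (n + 1) := ih
      _ = neutral α c (backOrbit α c (n + 1 + 1)) := (neutral_backOrbit_succ hα hc _).symm
      _ ≤ _ := neutral_mono_coeff hcc (backOrbit_pos hα hc _).le

/-- The decreasing limit is a fixed point of the neutral branch, and 0 is the only fixed point in
[0, ∞). -/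
theorem tendsto_backOrbit (hα : 0 < α) (hc : 0 < c) :
    Tendsto (backOrbit α c) atTop (𝓝 0) := by
  have h1 := tendsto_atTop_ciInf (backOrbit_strictAnti hα hc).antitone
    ⟨0, by rintro _ ⟨n, rfl⟩; exact (backOrbit_pos hα hc n).le⟩
  set L := ⨅ i, backOrbit α c i
  have hL : 0 ≤ L := ge_of_tendsto' h1 fun n => (backOrbit_pos hα hc n).le
  have h2 : Tendsto (fun n => neutral α c (backOrbit α c (n + 1))) atTop (𝓝 (neutral α c L)) :=
    ((continuous_neutral hα).tendsto L).comp (h1.comp (tendsto_add_atTop_nat 1))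
  have h3 : neutral α c L = L :=
    tendsto_nhds_unique h2 (h1.congr fun n => (neutral_backOrbit_succ hα hc n).symm)
  have : L = 0 := by
    by_contra hne
    exact (neutral_gt hc (lt_of_le_of_ne hL (Ne.symm hne))).ne' h3
  rwa [this] at h1

theorem exists_mem_backOrbit (hα : 0 < α) (hc : 0 < c) {y : ℝ} (hy : 0 < y)
    (hy1 : y ≤ backOrbit α c 0) :
    ∃ n, y ∈ Ioc (backOrbit α c (n + 1)) (backOrbit α c n) := by
  classical
  have hex : ∃ n, backOrbit α c n < y := by
    have := (tendsto_backOrbit hα hc).eventually (gt_mem_nhds hy)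
    exact this.exists
  have hs := Nat.find_spec hex
  have h0 : Nat.find hex ≠ 0 := fun h0 => by rw [h0] at hs; linarith
  obtain ⟨n, hn⟩ := Nat.exists_eq_succ_of_ne_zero h0
  refine ⟨n, by rw [hn] at hs; exact hs, ?_⟩
  exact not_lt.1 (Nat.find_min hex (m := n) (by omega))

theorem backOrbit_gap (hα : 0 < α) (hc : 0 < c) (n : ℕ) :
    backOrbit α c n - backOrbit α c (n + 1) = c * backOrbit α c (n + 1) ^ (1 + α) := by
  conv_lhs => rw [← neutral_backOrbit_succ hα hc n]
  rw [neutral]; ring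

end neutral

/-! ### The induced map on the left component -/

/-- The coefficient of the neutral branch. -/
noncomputable def neutralCoeff (α ε : ℝ) : ℝ := (4 : ℝ) ^ α * (1 + 4 * ε)

/-- The decreasing affine branch. -/
noncomputable def decBranch (ε x : ℝ) : ℝ := -4 * (1 + 2 * ε) * x + 3 / 2 + 3 * ε

/-- The increasing affine branch. -/
noncomputable def incBranch (x : ℝ) : ℝ := 4 * x - 3 / 2

/-- The backward orbit of `1/2 + ε` under the neutral branch. -/
noncomputable def zpt (α ε : ℝ) (n : ℕ) : ℝ := backOrbit α (neutralCoeff α ε) n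

/-- The branch points to the left of `3/8`. -/
noncomputable def apt (α ε : ℝ) (n : ℕ) : ℝ := (3 / 2 + 3 * ε - zpt α ε n) / (4 * (1 + 2 * ε))

/-- The branch points to the right of `3/8`. -/
noncomputable def bpt (α ε : ℝ) (n : ℕ) : ℝ := (zpt α ε n + 3 / 2) / 4

section left

variable {α ε : ℝ} {T4 : ℝ → ℝ → ℝ}

theorem neutralCoeff_pos (hε : 0 ≤ ε) : 0 < neutralCoeff α ε := by
  unfold neutralCoeff; positivity

theorem neutralCoeff_mono {ε' : ℝ} (h : ε ≤ ε') : neutralCoeff α ε ≤ neutralCoeff α ε' := by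
  unfold neutralCoeff; gcongr

theorem neutral_quarter : neutral α (neutralCoeff α ε) (1 / 4) = 1 / 2 + ε := by
  have h : (4 : ℝ) ^ α * (1 / 4 : ℝ) ^ α = 1 := by
    rw [← Real.mul_rpow (by norm_num) (by norm_num)]; norm_num
  rw [neutral, neutralCoeff, Real.rpow_add (by norm_num), Real.rpow_one]
  linear_combination (1 + 4 * ε) / 4 * h

theorem zpt_zero : zpt α ε 0 = 1 / 2 + ε := neutral_quarter

theorem zpt_one (hα : 0 < α) (hε : 0 ≤ ε) : zpt α ε 1 = 1 / 4 :=
  backOrbit_one hα (neutralCoeff_pos hε)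

theorem zpt_pos (hα : 0 < α) (hε : 0 ≤ ε) (n : ℕ) : 0 < zpt α ε n :=
  backOrbit_pos hα (neutralCoeff_pos hε) n

theorem zpt_anti (hα : 0 < α) (hε : 0 ≤ ε) : StrictAnti (zpt α ε) :=
  backOrbit_strictAnti hα (neutralCoeff_pos hε)

theorem zpt_succ_le (hα : 0 < α) (hε : 0 ≤ ε) (n : ℕ) : zpt α ε (n + 1) ≤ 1 / 4 := by
  rw [← zpt_one hα hε]
  exact (zpt_anti hα hε).antitone (by omega)

theorem decBranch_apt (hε : 0 ≤ ε) (n : ℕ) : decBranch ε (apt α ε n) = zpt α ε n := by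
  unfold decBranch apt
  field_simp
  ring

theorem incBranch_bpt (n : ℕ) : incBranch (bpt α ε n) = zpt α ε n := by
  unfold incBranch bpt
  ring

/-- The end point 1/4 is included because the neutral and the decreasing branch both take the value
1/2 + ε there. -/
theorem intermittentMap_neutral {x : ℝ} (hx : 0 ≤ x) (hx1 : x ≤ 1 / 4) :
    intermittentMap α T4 ε x = neutral α (neutralCoeff α ε) x := by
  rcases hx1.lt_or_eq with h | rfl
  · rw [intermittentMap, if_neg (not_lt.2 hx), if_pos h]; rfl
  · rw [neutral_quarter, intermittentMap, if_neg (by norm_num), if_neg (by norm_num),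
      if_pos (by norm_num)]
    ring

theorem intermittentMap_dec {x : ℝ} (hx : 1 / 4 ≤ x) (hx1 : x < 3 / 8) :
    intermittentMap α T4 ε x = decBranch ε x := by
  rw [intermittentMap, if_neg (by linarith), if_neg (by linarith), if_pos hx1]; rfl

theorem intermittentMap_inc {x : ℝ} (hx : 3 / 8 ≤ x) (hx1 : x < 1 / 2) :
    intermittentMap α T4 ε x = incBranch x := by
  rw [intermittentMap, if_neg (by linarith), if_neg (by linarith), if_neg (by linarith), if_pos hx1]
  rfl

theorem intermittentMap_right {x : ℝ} (hx : 1 / 2 ≤ x) (hx1 : x ≤ 1) :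
    intermittentMap α T4 ε x = T4 ε x := by
  rw [intermittentMap, if_neg (by linarith), if_neg (by linarith), if_neg (by linarith),
    if_neg (by linarith), if_pos hx1]

theorem returnTime_eq {T : ℝ → ℝ} {A : Set ℝ} {x : ℝ} {n : ℕ} (hn : T^[n + 1] x ∈ A)
    (h : ∀ k < n, T^[k + 1] x ∉ A) : returnTime T A x = n + 1 := by
  unfold returnTime
  refine le_antisymm (Nat.sInf_le ⟨by omega, hn⟩) ?_
  refine le_csInf ⟨n + 1, by omega, hn⟩ ?_
  rintro m ⟨hm1, hm⟩
  by_contra hlt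
  obtain ⟨k, rfl⟩ : ∃ k, m = k + 1 := ⟨m - 1, by omega⟩
  exact h k (by omega) hm

theorem iterate_neutral_mem (hα : 0 < α) (hε : 0 ≤ ε) (k j : ℕ) {y : ℝ}
    (hy : y ∈ Ioc (zpt α ε (k + j + 1)) (zpt α ε (k + j))) :
    (neutral α (neutralCoeff α ε))^[k] y ∈ Ioc (zpt α ε (j + 1)) (zpt α ε j) := by
  have hc := neutralCoeff_pos (α := α) hε
  have hm := iterate_neutral_strictMonoOn (α := α) hα hc.le k
  have hy0 : 0 ≤ y := (zpt_pos hα hε _).le.trans hy.1.le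
  constructor
  · rw [zpt, ← iterate_neutral_backOrbit hα hc k (j + 1)]
    exact hm (zpt_pos hα hε _).le hy0 hy.1
  · rw [zpt, ← iterate_neutral_backOrbit hα hc k j]
    exact hm.monotoneOn hy0 (zpt_pos hα hε _).le hy.2

/-- Each neutral step moves (z (k + 1), z k] onto (z k, z (k - 1)]. From the n-th interval it takes
exactly n steps to reach (z 1, z 0] = (1/4, 1/2 + ε], and all earlier positions are at most 1/4. -/
theorem inducedMap_of_neutral (hα : 0 < α) (hε : 0 ≤ ε) (hε1 : ε ≤ 1 / 4) {x y : ℝ} {n : ℕ}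
    (hxy : intermittentMap α T4 ε x = y) (hy : y ∈ Ioc (zpt α ε (n + 1)) (zpt α ε n)) :
    inducedMap α T4 ε x = (neutral α (neutralCoeff α ε))^[n] y := by
  have hit : ∀ k ≤ n, (intermittentMap α T4 ε)^[k + 1] x =
      (neutral α (neutralCoeff α ε))^[k] y := by
    intro k hk
    induction k with
    | zero => simpa using hxy
    | succ k ih =>
      rw [Function.iterate_succ_apply', ih (by omega), Function.iterate_succ_apply']
      obtain ⟨j, rfl⟩ : ∃ j, n = k + (j + 1) := ⟨n - k - 1, by omega⟩
      have hm := iterate_neutral_mem hα hε k (j + 1) hy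
      exact intermittentMap_neutral ((zpt_pos hα hε _).le.trans hm.1.le)
        (hm.2.trans (zpt_succ_le hα hε j))
  have hrt : returnTime (intermittentMap α T4 ε) (Ioc (1 / 4) 1) x = n + 1 := by
    refine returnTime_eq ?_ fun k hk => ?_
    · rw [hit n le_rfl]
      have hm := iterate_neutral_mem hα hε n 0 hy
      rw [zero_add, zpt_one hα hε, zpt_zero] at hm
      exact ⟨hm.1, by linarith [hm.2]⟩
    · rw [hit k hk.le]
      obtain ⟨j, rfl⟩ : ∃ j, n = k + (j + 1) := ⟨n - k - 1, by omega⟩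
      have hm := iterate_neutral_mem hα hε k (j + 1) hy
      intro h
      linarith [h.1, hm.2.trans (zpt_succ_le hα hε j)]
  rw [inducedMap, hrt, hit n le_rfl]

theorem inducedMap_three_eighths (hα : 0 < α) : inducedMap α T4 ε (3 / 8) = 3 / 8 := by
  have h0 : intermittentMap α T4 ε 0 = 0 := by
    rw [intermittentMap, if_neg (by norm_num), if_pos (by norm_num),
      Real.zero_rpow (by linarith)]
    ring
  have h1 : ∀ k, (intermittentMap α T4 ε)^[k + 1] (3 / 8) = 0 := by
    intro k
    induction k with
    | zero =>
      rw [zero_add, Function.iterate_one, intermittentMap_inc le_rfl (by norm_num), incBranch]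
      norm_num
    | succ k ih => rw [Function.iterate_succ_apply', ih, h0]
  -- The orbit stays at 0, so the set of return times is empty and `sInf ∅ = 0`; the zeroth iterate
  -- then fixes 3/8.
  have hrt : returnTime (intermittentMap α T4 ε) (Ioc (1 / 4) 1) (3 / 8) = 0 := by
    unfold returnTime
    rw [Nat.sInf_eq_zero]
    right
    ext m
    simp only [mem_ofPred_eq, mem_empty_iff_false, iff_false, not_and]
    intro hm
    obtain ⟨k, rfl⟩ : ∃ k, m = k + 1 := ⟨m - 1, by omega⟩
    rw [h1]
    rintro ⟨h, -⟩
    norm_num at h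
  rw [inducedMap, hrt, Function.iterate_zero, id]

theorem inducedMap_apt (hα : 0 < α) (hε : 0 ≤ ε) (hε1 : ε ≤ 1 / 4) (n : ℕ) :
    inducedMap α T4 ε (apt α ε n) = 1 / 2 + ε := by
  have hz := zpt_pos hα hε n
  have hz0 : zpt α ε n ≤ 1 / 2 + ε := zpt_zero (α := α) ▸ (zpt_anti hα hε).antitone (Nat.zero_le n)
  have h1 : 1 / 4 ≤ apt α ε n := by
    rw [apt, le_div_iff₀ (by positivity)]; linarith
  have h2 : apt α ε n < 3 / 8 := by
    rw [apt, div_lt_iff₀ (by positivity)]; linarith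
  rw [inducedMap_of_neutral hα hε hε1 (n := n) (intermittentMap_dec h1 h2)
    (by rw [decBranch_apt hε]; exact ⟨zpt_anti hα hε (Nat.lt_succ_self n), le_rfl⟩),
    decBranch_apt hε]
  exact (iterate_neutral_backOrbit hα (neutralCoeff_pos hε) n 0).trans zpt_zero

theorem inducedMap_bpt (hα : 0 < α) (hε : 0 ≤ ε) (hε1 : ε ≤ 1 / 4) (n : ℕ) :
    inducedMap α T4 ε (bpt α ε (n + 1)) = 1 / 2 + ε := by
  have hz := zpt_pos hα hε (n + 1)
  have hz0 := zpt_succ_le hα hε n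
  rw [inducedMap_of_neutral hα hε hε1 (n := n + 1)
    (intermittentMap_inc (by rw [bpt]; linarith) (by rw [bpt]; linarith))
    (by rw [incBranch_bpt]; exact ⟨zpt_anti hα hε (Nat.lt_succ_self _), le_rfl⟩),
    incBranch_bpt]
  exact (iterate_neutral_backOrbit hα (neutralCoeff_pos hε) (n + 1) 0).trans zpt_zero

/-- The left and right end points of the `n`-th branch to the right of `3/8`. -/
noncomputable def bptTop (α ε : ℝ) : ℕ → ℝ
  | 0 => 1 / 2
  | n + 1 => bpt α ε (n + 1)

theorem apt_lt_iff (hε : 0 ≤ ε) {n : ℕ} {x : ℝ} : apt α ε n < x ↔ decBranch ε x < zpt α ε n := by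
  rw [apt, div_lt_iff₀ (by positivity), decBranch]
  constructor <;> intro h <;> linarith

theorem lt_apt_iff (hε : 0 ≤ ε) {n : ℕ} {x : ℝ} : x < apt α ε n ↔ zpt α ε n < decBranch ε x := by
  rw [apt, lt_div_iff₀ (by positivity), decBranch]
  constructor <;> intro h <;> linarith

theorem bpt_lt_iff {n : ℕ} {x : ℝ} : bpt α ε n < x ↔ zpt α ε n < incBranch x := by
  rw [bpt, div_lt_iff₀ (by positivity), incBranch]
  constructor <;> intro h <;> linarith

theorem lt_bpt_iff {n : ℕ} {x : ℝ} : x < bpt α ε n ↔ incBranch x < zpt α ε n := by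
  rw [bpt, lt_div_iff₀ (by positivity), incBranch]
  constructor <;> intro h <;> linarith

theorem apt_zero (hε : 0 ≤ ε) : apt α ε 0 = 1 / 4 := by
  rw [apt, zpt_zero, div_eq_iff (by positivity)]; ring

theorem apt_strictMono (hα : 0 < α) (hε : 0 ≤ ε) : StrictMono (apt α ε) := by
  intro m n hmn
  rw [apt_lt_iff hε, decBranch_apt hε]
  exact zpt_anti hα hε hmn

theorem apt_lt_three_eighths (hα : 0 < α) (hε : 0 ≤ ε) (n : ℕ) : apt α ε n < 3 / 8 := by
  rw [apt_lt_iff hε, decBranch]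
  have := zpt_pos hα hε n
  linarith

theorem three_eighths_lt_bpt (hα : 0 < α) (hε : 0 ≤ ε) (n : ℕ) : 3 / 8 < bpt α ε n := by
  rw [lt_bpt_iff, incBranch]
  have := zpt_pos hα hε n
  linarith

theorem bpt_anti (hα : 0 < α) (hε : 0 ≤ ε) : StrictAnti (bpt α ε) := by
  intro m n hmn
  rw [bpt_lt_iff, incBranch_bpt]
  exact zpt_anti hα hε hmn

theorem bpt_one (hα : 0 < α) (hε : 0 ≤ ε) : bpt α ε 1 = 7 / 16 := by
  rw [bpt, zpt_one hα hε]; norm_num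

theorem bpt_succ_lt_bptTop (hα : 0 < α) (hε : 0 ≤ ε) (n : ℕ) : bpt α ε (n + 1) < bptTop α ε n := by
  cases n with
  | zero => rw [zero_add, bpt_one hα hε, bptTop]; norm_num
  | succ n => exact bpt_anti hα hε (Nat.lt_succ_self _)

theorem bptTop_anti (hα : 0 < α) (hε : 0 ≤ ε) : StrictAnti (bptTop α ε) := by
  refine strictAnti_nat_of_succ_lt fun n => ?_
  exact bpt_succ_lt_bptTop hα hε n

theorem bptTop_le (hα : 0 < α) (hε : 0 ≤ ε) (n : ℕ) : bptTop α ε n ≤ 1 / 2 :=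
  (bptTop_anti hα hε).antitone (Nat.zero_le n)

/-- On the `n`-th branch to the left of `3/8`. -/
theorem inducedMap_dec (hα : 0 < α) (hε : 0 ≤ ε) (hε1 : ε ≤ 1 / 4) {n : ℕ} {x : ℝ}
    (hx : x ∈ Ioo (apt α ε n) (apt α ε (n + 1))) :
    inducedMap α T4 ε x = (neutral α (neutralCoeff α ε))^[n] (decBranch ε x) := by
  refine inducedMap_of_neutral hα hε hε1 (intermittentMap_dec ?_ ?_) ?_
  · have := (apt_strictMono hα hε).monotone (Nat.zero_le n)
    rw [apt_zero hε] at this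
    linarith [hx.1]
  · exact hx.2.trans (apt_lt_three_eighths hα hε _)
  · exact ⟨(lt_apt_iff hε).1 hx.2, ((apt_lt_iff hε).1 hx.1).le⟩

/-- On the `n`-th branch to the right of `3/8`. -/
theorem inducedMap_inc (hα : 0 < α) (hε : 0 ≤ ε) (hε1 : ε ≤ 1 / 4) {n : ℕ} {x : ℝ}
    (hx : x ∈ Ioo (bpt α ε (n + 1)) (bptTop α ε n)) :
    inducedMap α T4 ε x = (neutral α (neutralCoeff α ε))^[n] (incBranch x) := by
  refine inducedMap_of_neutral hα hε hε1 (intermittentMap_inc ?_ ?_) ?_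
  · exact ((three_eighths_lt_bpt hα hε _).trans hx.1).le
  · exact hx.2.trans_le (bptTop_le hα hε n)
  · refine ⟨bpt_lt_iff.1 hx.1, ?_⟩
    cases n with
    | zero =>
      have := hx.2
      rw [bptTop] at this
      rw [zpt_zero, incBranch]; linarith
    | succ n => exact (lt_bpt_iff.1 hx.2).le

/-- On either side of 3/8 the affine branch takes values in (0, 1/2 + ε], which is the disjoint
union of the intervals (z (n + 1), z n]; the branches and their end points are the preimages. -/
theorem left_cases (hα : 0 < α) (hε : 0 ≤ ε) {x : ℝ} (hx : x ∈ indDomL) :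
    x = 3 / 8 ∨ x = 1 / 2 ∨ (∃ n, x = apt α ε n) ∨ (∃ n, x = bpt α ε (n + 1)) ∨
      (∃ n, x ∈ Ioo (apt α ε n) (apt α ε (n + 1))) ∨
      ∃ n, x ∈ Ioo (bpt α ε (n + 1)) (bptTop α ε n) := by
  have hc := neutralCoeff_pos (α := α) hε
  rcases lt_trichotomy x (3 / 8) with h | h | h
  · have hy : 0 < decBranch ε x := by rw [decBranch]; nlinarith
    have hy1 : decBranch ε x ≤ zpt α ε 0 := by
      rw [zpt_zero, decBranch]; nlinarith [hx.1]
    obtain ⟨n, hn⟩ := exists_mem_backOrbit hα hc hy hy1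
    rcases hn.2.lt_or_eq with h2 | h2
    · right; right; right; right; left
      exact ⟨n, (apt_lt_iff hε).2 h2, (lt_apt_iff hε).2 hn.1⟩
    · right; right; left
      refine ⟨n, ?_⟩
      have : decBranch ε x = decBranch ε (apt α ε n) := by rw [decBranch_apt hε]; exact h2
      unfold decBranch at this
      have h3 : (-4 * (1 + 2 * ε)) * x = (-4 * (1 + 2 * ε)) * apt α ε n := by linarith
      exact mul_left_cancel₀ (by nlinarith) h3
  · exact Or.inl h
  · rcases hx.2.lt_or_eq with h' | h'
    · have hy : 0 < incBranch x := by rw [incBranch]; linarith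
      have hy1 : incBranch x ≤ zpt α ε 0 := by
        rw [zpt_zero, incBranch]; linarith
      obtain ⟨n, hn⟩ := exists_mem_backOrbit hα hc hy hy1
      cases n with
      | zero =>
        right; right; right; right; right
        exact ⟨0, bpt_lt_iff.2 hn.1, h'⟩
      | succ n =>
        rcases hn.2.lt_or_eq with h2 | h2
        · right; right; right; right; right
          exact ⟨n + 1, bpt_lt_iff.2 hn.1, lt_bpt_iff.2 h2⟩
        · right; right; right; left
          refine ⟨n, ?_⟩
          have : incBranch x = incBranch (bpt α ε (n + 1)) := by rw [incBranch_bpt]; exact h2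
          unfold incBranch at this
          linarith
    · exact Or.inr (Or.inl h')

end left

/-! ### Branches -/

/-- `F` is a `C²` expanding map on the interval `I` and satisfies Adler's condition there. -/
structure IsBranch (F : ℝ → ℝ) (I : Set ℝ) (D lam : ℝ) : Prop where
  isOpen : IsOpen I
  ordConnected : I.OrdConnected
  diff1 : ∀ x ∈ I, DifferentiableAt ℝ F x
  diff2 : ∀ x ∈ I, DifferentiableAt ℝ (deriv F) x
  expand : ∀ x ∈ I, lam ≤ |deriv F x|
  adler : ∀ x ∈ I, |deriv (deriv F) x| / (deriv F x) ^ 2 ≤ D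

namespace IsBranch

variable {F : ℝ → ℝ} {I : Set ℝ} {D lam : ℝ}

theorem mono (h : IsBranch F I D lam) {D' lam' : ℝ} (hD : D ≤ D') (hl : lam' ≤ lam) :
    IsBranch F I D' lam' :=
  ⟨h.isOpen, h.ordConnected, h.diff1, h.diff2, fun x hx => hl.trans (h.expand x hx),
    fun x hx => (h.adler x hx).trans hD⟩

theorem deriv_of_eqOn {G G' G'' : ℝ → ℝ} (hI : IsOpen I) (hFG : EqOn F G I)
    (h1 : ∀ x ∈ I, HasDerivAt G (G' x) x) (h2 : ∀ x ∈ I, HasDerivAt G' (G'' x) x) :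
    (∀ x ∈ I, HasDerivAt F (G' x) x) ∧ ∀ x ∈ I, HasDerivAt (deriv F) (G'' x) x := by
  have e1 : ∀ x ∈ I, HasDerivAt F (G' x) x := fun x hx =>
    (h1 x hx).congr_of_eventuallyEq (hFG.eventuallyEq_of_mem (hI.mem_nhds hx))
  refine ⟨e1, fun x hx => (h2 x hx).congr_of_eventuallyEq ?_⟩
  filter_upwards [hI.mem_nhds hx] with y hy using (e1 y hy).deriv

theorem of_eqOn {G G' G'' : ℝ → ℝ} (hI : IsOpen I) (hIo : I.OrdConnected) (hFG : EqOn F G I)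
    (h1 : ∀ x ∈ I, HasDerivAt G (G' x) x) (h2 : ∀ x ∈ I, HasDerivAt G' (G'' x) x)
    (h3 : ∀ x ∈ I, lam ≤ |G' x|) (h4 : ∀ x ∈ I, |G'' x| / (G' x) ^ 2 ≤ D) : IsBranch F I D lam := by
  obtain ⟨e1, e2⟩ := deriv_of_eqOn hI hFG h1 h2
  refine ⟨hI, hIo, fun x hx => (e1 x hx).differentiableAt, fun x hx => (e2 x hx).differentiableAt,
    fun x hx => ?_, fun x hx => ?_⟩
  · rw [(e1 x hx).deriv]; exact h3 x hx
  · rw [(e1 x hx).deriv, (e2 x hx).deriv]; exact h4 x hx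

theorem injOn (h : IsBranch F I D lam) (hl : 0 < lam) : InjOn F I := by
  intro x hx y hy hxy
  have := expand_of_deriv h.ordConnected h.diff1 h.expand x hx y hy
  rw [hxy, sub_self, abs_zero] at this
  have h0 : |x - y| ≤ 0 := by
    by_contra hlt
    rw [not_le] at hlt
    nlinarith
  exact sub_eq_zero.1 (abs_nonpos_iff.1 h0)

theorem distortion (h : IsBranch F I D lam) (hl : 0 < lam) : ∀ x ∈ I, ∀ y ∈ I,
    |deriv F x| ≤ Real.exp (D * |F x - F y|) * |deriv F y| :=
  distortion_of_adler h.ordConnected h.diff1 h.diff2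
    (fun x hx h0 => by have := h.expand x hx; rw [h0, abs_zero] at this; linarith) h.adler

end IsBranch

theorem IsPiecewiseExpanding.of_branches {ι κ : Type} {F : ℝ → ℝ} {I : ι → Set ℝ} {J : κ → Set ℝ}
    {σ : ι → κ} {D lam : ℝ} {Δ : Set ℝ} (hF : Measurable F) (hl : 2 < lam) (hD : 0 ≤ D)
    (hb : ∀ i, IsBranch F (I i) D lam) (hd : Pairwise fun i j => Disjoint (I i) (I j))
    (hs : ∀ i, I i ⊆ Δ) (hn : volume (Δ \ ⋃ i, I i) = 0) (hi : ∀ i, F '' I i = J (σ i))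
    (hJ : ∀ k, J k ⊆ Δ) (hJp : ∀ k, volume (J k) ≠ 0) (hΔ : Δ.OrdConnected)
    (hΔ1 : ∀ x ∈ Δ, ∀ y ∈ Δ, |x - y| ≤ 1) : IsPiecewiseExpanding F I J σ D lam Δ where
  measurable := hF
  lam_gt := hl
  dist_nonneg := hD
  ordConnected i := (hb i).ordConnected
  isOpen i := (hb i).isOpen
  disjoint := hd
  subset := hs
  null := hn
  differentiableAt i := (hb i).diff1
  injOn i := (hb i).injOn (by linarith)
  expand i := (hb i).expand
  distortion i := (hb i).distortion (by linarith)
  image := hi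
  image_subset := hJ
  image_pos := hJp
  ordConnected_dom := hΔ
  diam_dom := hΔ1

/-- The slope p cancels in Adler's quotient, which is therefore at most 2 / F x by
`neutralD2_bound`; since F x > 1/4 this is at most 8. The expansion 4 is that of the affine factor
alone, as the neutral iterates have derivative at least 1. -/
theorem isBranch_neutral {α c p q : ℝ} {F : ℝ → ℝ} {I : Set ℝ} (n : ℕ) (hα : 0 < α) (hα1 : α < 1)
    (hc : 0 ≤ c) (hp : 4 ≤ |p|) (hI : IsOpen I) (hIo : I.OrdConnected)
    (hF : ∀ x ∈ I, F x = (neutral α c)^[n] (p * x + q)) (hpos : ∀ x ∈ I, 0 < p * x + q)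
    (hF4 : ∀ x ∈ I, 1 / 4 < F x) : IsBranch F I 8 4 := by
  have hA : ∀ x, HasDerivAt (fun x => p * x + q) p x := fun x => by
    simpa using ((hasDerivAt_id x).const_mul p).add_const q
  refine IsBranch.of_eqOn (G := fun x => (neutral α c)^[n] (p * x + q))
    (G' := fun x => neutralD1 α c n (p * x + q) * p)
    (G'' := fun x => neutralD2 α c n (p * x + q) * p * p) hI hIo hF ?_ ?_ ?_ ?_
  · exact fun x hx => (hasDerivAt_iterate_neutral hc n (hpos x hx)).comp x (hA x)
  · exact fun x hx => ((hasDerivAt_neutralD1 hc n (hpos x hx)).comp x (hA x)).mul_const p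
  · intro x hx
    have := one_le_neutralD1 hα hc n (hpos x hx)
    rw [abs_mul, abs_of_pos (by linarith)]
    nlinarith
  · intro x hx
    have h1 := one_le_neutralD1 hα hc n (hpos x hx)
    obtain ⟨h2, h3⟩ := neutralD2_bound hα hα1 hc n (hpos x hx)
    have h4 := hF4 x hx
    rw [hF x hx] at h4
    have hp0 : 0 < p ^ 2 := by rw [← sq_abs]; nlinarith
    have h5 : 0 < neutralD1 α c n (p * x + q) := by linarith
    rw [mul_assoc, abs_mul, abs_of_nonneg h2, abs_of_nonneg (mul_self_nonneg p),
      div_le_iff₀ (by rw [mul_pow]; positivity)]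
    nlinarith

/-! ### The right component -/

theorem exists_mem_Icc_chain (d : ℕ → ℝ) {N : ℕ} (hN : 1 ≤ N) {x : ℝ} (h0 : d 0 ≤ x)
    (h1 : x ≤ d N) : ∃ j < N, x ∈ Icc (d j) (d (j + 1)) := by
  induction N, hN using Nat.le_induction with
  | base => exact ⟨0, by norm_num, h0, h1⟩
  | succ N hN ih =>
    by_cases h : x ≤ d N
    · obtain ⟨j, hj, hx⟩ := ih h
      exact ⟨j, by omega, hx⟩
    · exact ⟨N, by omega, (not_le.1 h).le, h1⟩

theorem chain_mono {d : ℕ → ℝ} {N : ℕ} (h : ∀ j < N, d j < d (j + 1)) {i j : ℕ} (hij : i ≤ j)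
    (hj : j ≤ N) : d i ≤ d j := by
  induction j, hij using Nat.le_induction with
  | base => exact le_rfl
  | succ j hij ih => exact (ih (by omega)).trans (h j (by omega)).le

/-- The data in the definition of `IsRightFamily`. -/
structure IsRightData (ε₀ : ℝ) (T4 : ℝ → ℝ → ℝ) (M p : ℕ) (s : ℝ) (c : ℕ → ℝ → ℝ)
    (g : ℕ → ℝ → ℝ → ℝ) : Prop where
  one_le : 1 ≤ p
  p_le : p ≤ M
  contDiff : ∀ j < 2 * M + 1, ContDiff ℝ 2 (fun z : ℝ × ℝ => g j z.1 z.2)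
  continuousOn : ∀ j ≤ 2 * M + 1, ContinuousOn (c j) (Ico 0 ε₀)
  c_zero : ∀ ε ∈ Ico 0 ε₀, c 0 ε = 1 / 2
  c_last : ∀ ε ∈ Ico 0 ε₀, c (2 * M + 1) ε = 1
  c_spike : ∀ ε ∈ Ico 0 ε₀, c (2 * p) ε = s
  c_lt : ∀ ε ∈ Ico 0 ε₀, ∀ j < 2 * M + 1, c j ε < c (j + 1) ε
  eqOn : ∀ ε ∈ Ico 0 ε₀, ∀ j < 2 * M + 1, EqOn (T4 ε) (g j ε) (Icc (c j ε) (c (j + 1) ε))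
  slope : ∀ ε ∈ Ico 0 ε₀, ∀ j < 2 * M + 1, ∀ x ∈ Icc (c j ε) (c (j + 1) ε), 2 < |deriv (g j ε) x|
  odd : ∀ ε ∈ Ico 0 ε₀, ∀ j ≤ 2 * M + 1, Odd j → T4 ε (c j ε) = 1
  even : ∀ ε ∈ Ico 0 ε₀, ∀ j ≤ 2 * M + 1, Even j → j ≠ 2 * p → T4 ε (c j ε) = 1 / 2
  spike : ∀ ε ∈ Ico 0 ε₀, T4 ε s = 1 / 2 - ε

theorem IsRightFamily.exists_data {ε₀ : ℝ} {T4 : ℝ → ℝ → ℝ} (h : IsRightFamily ε₀ T4) :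
    ∃ M p s c g, IsRightData ε₀ T4 M p s c g := by
  obtain ⟨M, p, s, c, g, h1, h2, h3, h4, h5⟩ := h
  exact ⟨M, p, s, c, g, h1, h2, h3, h4, fun ε hε => (h5 ε hε).1, fun ε hε => (h5 ε hε).2.1,
    fun ε hε => (h5 ε hε).2.2.1, fun ε hε => (h5 ε hε).2.2.2.1, fun ε hε => (h5 ε hε).2.2.2.2.1,
    fun ε hε => (h5 ε hε).2.2.2.2.2.1, fun ε hε => (h5 ε hε).2.2.2.2.2.2.1,
    fun ε hε => (h5 ε hε).2.2.2.2.2.2.2.1, fun ε hε => (h5 ε hε).2.2.2.2.2.2.2.2⟩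

/-- The lower end of the image of the `j`-th right branch. -/
noncomputable def lowEnd (p : ℕ) (ε : ℝ) (j : ℕ) : ℝ :=
  if j + 1 = 2 * p ∨ j = 2 * p then 1 / 2 - ε else 1 / 2

theorem lowEnd_le {p : ℕ} {ε : ℝ} (hε : 0 ≤ ε) (j : ℕ) : lowEnd p ε j ≤ 1 / 2 := by
  unfold lowEnd; split_ifs <;> linarith

theorem le_lowEnd {p : ℕ} {ε : ℝ} (hε : 0 ≤ ε) (j : ℕ) : 1 / 2 - ε ≤ lowEnd p ε j := by
  unfold lowEnd; split_ifs <;> linarith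

namespace IsRightData

variable {ε₀ : ℝ} {T4 : ℝ → ℝ → ℝ} {M p : ℕ} {s : ℝ} {c : ℕ → ℝ → ℝ} {g : ℕ → ℝ → ℝ → ℝ} {ε : ℝ}
  {j : ℕ}

theorem contDiff_branch (h : IsRightData ε₀ T4 M p s c g) (hj : j < 2 * M + 1) :
    ContDiff ℝ 2 (g j ε) :=
  (h.contDiff j hj).comp (contDiff_prodMk_right ε)

theorem value_even (h : IsRightData ε₀ T4 M p s c g) (hε : ε ∈ Ico 0 ε₀) (hj : j ≤ 2 * M + 1)
    (he : Even j) : T4 ε (c j ε) = if j = 2 * p then 1 / 2 - ε else 1 / 2 := by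
  split_ifs with h1
  · rw [h1, h.c_spike ε hε, h.spike ε hε]
  · exact h.even ε hε j hj he h1

theorem injOn (h : IsRightData ε₀ T4 M p s c g) (hε : ε ∈ Ico 0 ε₀) (hj : j < 2 * M + 1) :
    InjOn (g j ε) (Icc (c j ε) (c (j + 1) ε)) := by
  intro x hx y hy hxy
  have := expand_of_deriv (F := g j ε) (lam := 2) ordConnected_Icc
    (fun x _ => ((h.contDiff_branch hj).differentiable (by norm_num)).differentiableAt)
    (fun x hx => (h.slope ε hε j hj x hx).le) x hx y hy
  rw [hxy, sub_self, abs_zero] at this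
  have h0 : |x - y| ≤ 0 := by linarith
  exact sub_eq_zero.1 (abs_nonpos_iff.1 h0)

/-- Each branch is injective by its slope, hence strictly monotone, and the direction is read off
from the end values: 1 at odd branch points, at most 1/2 at even ones. -/
theorem strictMonoOn_or (h : IsRightData ε₀ T4 M p s c g) (hε : ε ∈ Ico 0 ε₀)
    (hj : j < 2 * M + 1) :
    (Even j ∧ StrictMonoOn (g j ε) (Icc (c j ε) (c (j + 1) ε)) ∧
      g j ε (c j ε) = lowEnd p ε j ∧ g j ε (c (j + 1) ε) = 1) ∨
    (Odd j ∧ StrictAntiOn (g j ε) (Icc (c j ε) (c (j + 1) ε)) ∧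
      g j ε (c (j + 1) ε) = lowEnd p ε j ∧ g j ε (c j ε) = 1) := by
  have hlt := h.c_lt ε hε j hj
  have hl : c j ε ∈ Icc (c j ε) (c (j + 1) ε) := left_mem_Icc.2 hlt.le
  have hr : c (j + 1) ε ∈ Icc (c j ε) (c (j + 1) ε) := right_mem_Icc.2 hlt.le
  have e1 := h.eqOn ε hε j hj hl
  have e2 := h.eqOn ε hε j hj hr
  have hmono := ((h.contDiff_branch hj).continuous.continuousOn
    (s := Icc (c j ε) (c (j + 1) ε))).strictMonoOn_of_injOn_Icc' hlt.le (h.injOn hε hj)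
  have hlow : lowEnd p ε j ≤ 1 / 2 := lowEnd_le hε.1 j
  rcases Nat.even_or_odd j with hev | hod
  · left
    have v1 : g j ε (c j ε) = lowEnd p ε j := by
      rw [← e1, h.value_even hε (by omega) hev, lowEnd]
      have : j + 1 ≠ 2 * p := by
        obtain ⟨k, rfl⟩ := hev; omega
      simp [this]
    have v2 : g j ε (c (j + 1) ε) = 1 := by
      rw [← e2, h.odd ε hε (j + 1) (by omega) hev.add_one]
    refine ⟨hev, ?_, v1, v2⟩
    rcases hmono with hm | hm
    · exact hm
    · have := hm hl hr hlt
      rw [v1, v2] at this; linarith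
  · right
    have v1 : g j ε (c (j + 1) ε) = lowEnd p ε j := by
      rw [← e2, h.value_even hε (by omega) hod.add_one, lowEnd]
      have : j ≠ 2 * p := by
        obtain ⟨k, rfl⟩ := hod; omega
      simp [this]
    have v2 : g j ε (c j ε) = 1 := by
      rw [← e1, h.odd ε hε j (by omega) hod]
    refine ⟨hod, ?_, v1, v2⟩
    rcases hmono with hm | hm
    · have := hm hl hr hlt
      rw [v1, v2] at this; linarith
    · exact hm

theorem image_Ioo (h : IsRightData ε₀ T4 M p s c g) (hε : ε ∈ Ico 0 ε₀) (hj : j < 2 * M + 1) :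
    g j ε '' Ioo (c j ε) (c (j + 1) ε) = Ioo (lowEnd p ε j) 1 := by
  have hlt := h.c_lt ε hε j hj
  have hc := (h.contDiff_branch (ε := ε) hj).continuous.continuousOn
    (s := Icc (c j ε) (c (j + 1) ε))
  rcases h.strictMonoOn_or hε hj with ⟨-, hm, v1, v2⟩ | ⟨-, hm, v1, v2⟩
  · rw [image_Ioo_of_strictMonoOn hlt.le hm hc, v1, v2]
  · rw [image_Ioo_of_strictAntiOn hlt.le hm hc, v1, v2]

theorem mem_range (h : IsRightData ε₀ T4 M p s c g) (hε : ε ∈ Ico 0 ε₀) (hj : j < 2 * M + 1) {x : ℝ}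
    (hx : x ∈ Icc (c j ε) (c (j + 1) ε)) : g j ε x ∈ Icc (lowEnd p ε j) 1 := by
  have hlt := h.c_lt ε hε j hj
  have hl : c j ε ∈ Icc (c j ε) (c (j + 1) ε) := left_mem_Icc.2 hlt.le
  have hr : c (j + 1) ε ∈ Icc (c j ε) (c (j + 1) ε) := right_mem_Icc.2 hlt.le
  rcases h.strictMonoOn_or hε hj with ⟨-, hm, v1, v2⟩ | ⟨-, hm, v1, v2⟩
  · exact ⟨v1 ▸ hm.monotoneOn hl hx hx.1, v2 ▸ hm.monotoneOn hx hr hx.2⟩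
  · exact ⟨v1 ▸ hm.antitoneOn hx hr hx.2, v2 ▸ hm.antitoneOn hl hx hx.1⟩

theorem exists_mem (h : IsRightData ε₀ T4 M p s c g) (hε : ε ∈ Ico 0 ε₀) {x : ℝ}
    (hx : x ∈ indDomR) : ∃ j < 2 * M + 1, x ∈ Icc (c j ε) (c (j + 1) ε) := by
  refine exists_mem_Icc_chain (fun j => c j ε) (by omega) ?_ ?_
  · simp only [h.c_zero ε hε]; exact hx.1
  · simp only [h.c_last ε hε]; exact hx.2

theorem c_mem (h : IsRightData ε₀ T4 M p s c g) (hε : ε ∈ Ico 0 ε₀) (hj : j ≤ 2 * M + 1) :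
    c j ε ∈ indDomR := by
  constructor
  · rw [← h.c_zero ε hε]; exact chain_mono (d := fun j => c j ε) (h.c_lt ε hε) (Nat.zero_le j) hj
  · rw [← h.c_last ε hε]; exact chain_mono (d := fun j => c j ε) (h.c_lt ε hε) hj le_rfl

theorem c_le (h : IsRightData ε₀ T4 M p s c g) (hε : ε ∈ Ico 0 ε₀) {i : ℕ} (hij : i ≤ j)
    (hj : j ≤ 2 * M + 1) : c i ε ≤ c j ε :=
  chain_mono (d := fun j => c j ε) (h.c_lt ε hε) hij hj

theorem Icc_subset (h : IsRightData ε₀ T4 M p s c g) (hε : ε ∈ Ico 0 ε₀) (hj : j < 2 * M + 1) :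
    Icc (c j ε) (c (j + 1) ε) ⊆ indDomR :=
  Icc_subset_Icc (h.c_mem hε (by omega)).1 (h.c_mem hε (by omega)).2

theorem T4_mem (h : IsRightData ε₀ T4 M p s c g) (hε : ε ∈ Ico 0 ε₀) {x : ℝ} (hx : x ∈ indDomR) :
    T4 ε x ∈ Icc (1 / 2 - ε) 1 := by
  obtain ⟨j, hj, hxj⟩ := h.exists_mem hε hx
  rw [h.eqOn ε hε j hj hxj]
  have := h.mem_range hε hj hxj
  exact ⟨(le_lowEnd hε.1 j).trans this.1, this.2⟩

/-- Even the bottom of the spike, 1/2 - ε, is above 1/4, so points on the right return in one step.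
-/
theorem inducedMap_eq (h : IsRightData ε₀ T4 M p s c g) (hε₀ : ε₀ ≤ 1 / 4) (hε : ε ∈ Ico 0 ε₀)
    {α x : ℝ} (hx : x ∈ indDomR) : inducedMap α T4 ε x = T4 ε x := by
  have hT : intermittentMap α T4 ε x = T4 ε x := intermittentMap_right hx.1 hx.2
  have hm := h.T4_mem hε hx
  have hrt : returnTime (intermittentMap α T4 ε) (Ioc (1 / 4) 1) x = 0 + 1 := by
    refine returnTime_eq ?_ fun k hk => absurd hk (by omega)
    rw [zero_add, Function.iterate_one, hT]
    exact ⟨by linarith [hm.1, hε.2], hm.2⟩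
  rw [inducedMap, hrt, zero_add, Function.iterate_one, hT]

theorem inducedMap_eqOn (h : IsRightData ε₀ T4 M p s c g) (hε₀ : ε₀ ≤ 1 / 4) (hε : ε ∈ Ico 0 ε₀)
    (hj : j < 2 * M + 1) (α : ℝ) :
    EqOn (inducedMap α T4 ε) (g j ε) (Icc (c j ε) (c (j + 1) ε)) := fun x hx => by
  rw [h.inducedMap_eq hε₀ hε (h.Icc_subset hε hj hx), h.eqOn ε hε j hj hx]

theorem inducedMap_half (h : IsRightData ε₀ T4 M p s c g) (hε₀ : ε₀ ≤ 1 / 4) (hε : ε ∈ Ico 0 ε₀)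
    (α : ℝ) : inducedMap α T4 ε (1 / 2) = 1 / 2 := by
  rw [h.inducedMap_eq hε₀ hε ⟨le_rfl, by norm_num⟩]
  have := h.even ε hε 0 (by omega) (by decide) (by have := h.one_le; omega)
  rwa [h.c_zero ε hε] at this

/-- Uniform expansion and Adler's condition on the right branches. -/
theorem exists_isBranch (h : IsRightData ε₀ T4 M p s c g) (hε₀ : ε₀ ≤ 1 / 4) (hε : ε ∈ Ico 0 ε₀)
    (α : ℝ) : ∃ D lam : ℝ, 0 ≤ D ∧ 2 < lam ∧ ∀ j < 2 * M + 1,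
      IsBranch (inducedMap α T4 ε) (Ioo (c j ε) (c (j + 1) ε)) D lam := by
  have hD1 : ∀ j < 2 * M + 1, Continuous (deriv (g j ε)) := fun j hj =>
    (h.contDiff_branch hj).continuous_deriv (by norm_num)
  have hCD : ∀ j < 2 * M + 1, ContDiff ℝ 1 (deriv (g j ε)) := fun j hj =>
    (contDiff_succ_iff_deriv (n := 1) (f := g j ε)).1 (h.contDiff_branch hj) |>.2.2
  have hD2 : ∀ j < 2 * M + 1, Continuous (deriv (deriv (g j ε))) := fun j hj =>
    (hCD j hj).continuous_deriv le_rfl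
  have hone : ∀ j, ∃ D lam : ℝ, j < 2 * M + 1 → (2 < lam ∧ ∀ x ∈ Icc (c j ε) (c (j + 1) ε),
      lam ≤ |deriv (g j ε) x| ∧ |deriv (deriv (g j ε)) x| / (deriv (g j ε) x) ^ 2 ≤ D) := by
    intro j
    by_cases hj : j < 2 * M + 1
    · have hne : (Icc (c j ε) (c (j + 1) ε)).Nonempty := nonempty_Icc.2 (h.c_lt ε hε j hj).le
      obtain ⟨x₀, hx₀, hmin⟩ := isCompact_Icc.exists_isMinOn hne (hD1 j hj).abs.continuousOn
      have hdiv : ContinuousOn (fun x => |deriv (deriv (g j ε)) x| / (deriv (g j ε) x) ^ 2)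
          (Icc (c j ε) (c (j + 1) ε)) := by
        refine (hD2 j hj).abs.continuousOn.div ((hD1 j hj).pow 2).continuousOn fun x hx h0 => ?_
        have := h.slope ε hε j hj x hx
        rw [pow_eq_zero_iff (by norm_num)] at h0
        rw [h0, abs_zero] at this
        linarith
      obtain ⟨x₁, hx₁, hmax⟩ := isCompact_Icc.exists_isMaxOn hne hdiv
      exact ⟨_, |deriv (g j ε) x₀|, fun _ => ⟨h.slope ε hε j hj x₀ hx₀, fun x hx =>
        ⟨hmin hx, hmax hx⟩⟩⟩
    · exact ⟨0, 0, fun h => absurd h hj⟩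
  choose D lam hDl using hone
  have hne : (Finset.range (2 * M + 1)).Nonempty := ⟨0, by simp⟩
  refine ⟨max 0 ((Finset.range (2 * M + 1)).sup' hne D), (Finset.range (2 * M + 1)).inf' hne lam,
    le_max_left _ _, ?_, fun j hj => ?_⟩
  · rw [Finset.lt_inf'_iff]
    exact fun j hj => (hDl j (Finset.mem_range.1 hj)).1
  · have hmem := Finset.mem_range.2 hj
    have hsub : Ioo (c j ε) (c (j + 1) ε) ⊆ Icc (c j ε) (c (j + 1) ε) := Ioo_subset_Icc_self
    refine IsBranch.of_eqOn (G := g j ε) (G' := deriv (g j ε)) (G'' := deriv (deriv (g j ε)))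
      isOpen_Ioo ordConnected_Ioo ((h.inducedMap_eqOn hε₀ hε hj α).mono hsub) ?_ ?_ ?_ ?_
    · exact fun x _ => ((h.contDiff_branch hj).differentiable (by norm_num) x).hasDerivAt
    · exact fun x _ => ((hCD j hj).differentiable (by norm_num) x).hasDerivAt
    · exact fun x hx => (Finset.inf'_le lam hmem).trans ((hDl j hj).2 x (hsub hx)).1
    · exact fun x hx => (((hDl j hj).2 x (hsub hx)).2.trans
        (Finset.le_sup' D hmem)).trans (le_max_right _ _)

/-! #### Measurability -/

theorem measurable_intermittentMap (h : IsRightData ε₀ T4 M p s c g) (hε : ε ∈ Ico 0 ε₀) (α : ℝ) :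
    Measurable (intermittentMap α T4 ε) := by
  classical
  -- Nothing is known about `T4 ε` off [1/2, 1], so only its restriction, glued from finitely many
  -- continuous branches, can be shown to be measurable.
  have hR : Measurable fun x => if x ∈ indDomR then T4 ε x else x := by
    intro B hB
    have e : (fun x => if x ∈ indDomR then T4 ε x else x) ⁻¹' B =
        (⋃ j : Fin (2 * M + 1), Icc (c j ε) (c (j + 1) ε) ∩ g j ε ⁻¹' B) ∪ (indDomRᶜ ∩ B) := by
      ext x
      simp only [mem_preimage, mem_union, mem_iUnion, mem_inter_iff, mem_compl_iff]
      by_cases hx : x ∈ indDomR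
      · simp only [hx, if_true, not_true_eq_false, false_and, or_false]
        constructor
        · intro hB'
          obtain ⟨j, hj, hxj⟩ := h.exists_mem hε hx
          exact ⟨⟨j, hj⟩, hxj, by rw [← h.eqOn ε hε j hj hxj]; exact hB'⟩
        · rintro ⟨j, hxj, hB'⟩
          rwa [h.eqOn ε hε j j.2 hxj]
      · simp only [hx, if_false, not_false_eq_true, true_and]
        constructor
        · exact fun hB' => Or.inr hB'
        · rintro (⟨j, hxj, -⟩ | hB')
          · exact absurd (h.Icc_subset hε j.2 hxj) hx
          · exact hB'
    rw [e]
    refine MeasurableSet.union (MeasurableSet.iUnion fun j => measurableSet_Icc.inter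
      ((h.contDiff_branch j.2).continuous.measurable hB)) ?_
    exact measurableSet_Icc.compl.inter hB
  have e : intermittentMap α T4 ε = fun x => if x < 0 then x
      else if x < 1 / 4 then x + (4 : ℝ) ^ α * (1 + 4 * ε) * x ^ (1 + α)
      else if x < 3 / 8 then -4 * (1 + 2 * ε) * x + 3 / 2 + 3 * ε
      else if x < 1 / 2 then 4 * x - 3 / 2
      else (fun x => if x ∈ indDomR then T4 ε x else x) x := by
    ext x
    unfold intermittentMap
    split_ifs with h1 h2 h3 h4 h5
    · rfl
    · rfl
    · rfl
    · rfl
    · exact (if_pos ⟨not_lt.1 h4, h5⟩).symm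
    · exact (if_neg fun h => h5 h.2).symm
  rw [e]
  refine Measurable.ite measurableSet_Iio measurable_id (Measurable.ite measurableSet_Iio
    (by fun_prop) (Measurable.ite measurableSet_Iio (by fun_prop) (Measurable.ite measurableSet_Iio
      (by fun_prop) hR)))

theorem measurable_inducedMap (h : IsRightData ε₀ T4 M p s c g) (hε : ε ∈ Ico 0 ε₀) (α : ℝ) :
    Measurable (inducedMap α T4 ε) := by
  have hT := h.measurable_intermittentMap hε α
  set T := intermittentMap α T4 ε with hTdef
  have hfirst : ∀ n, MeasurableSet {x | returnTime T (Ioc (1 / 4) 1) x = n + 1} := by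
    intro n
    have e : {x | returnTime T (Ioc (1 / 4) 1) x = n + 1} =
        (T^[n + 1] ⁻¹' Ioc (1 / 4) 1) ∩ ⋂ k : Fin n, (T^[k + 1] ⁻¹' Ioc (1 / 4) 1)ᶜ := by
      ext x
      simp only [mem_ofPred_eq, mem_inter_iff, mem_preimage, mem_iInter, mem_compl_iff]
      constructor
      · intro hx
        have hne : {n : ℕ | 1 ≤ n ∧ T^[n] x ∈ Ioc (1 / 4) 1}.Nonempty := by
          by_contra hemp
          rw [not_nonempty_iff_eq_empty] at hemp
          rw [returnTime, hemp, Nat.sInf_empty] at hx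
          omega
        have hmem := Nat.sInf_mem hne
        rw [returnTime] at hx
        rw [hx] at hmem
        refine ⟨hmem.2, fun k hk => ?_⟩
        have : sInf {n : ℕ | 1 ≤ n ∧ T^[n] x ∈ Ioc (1 / 4) 1} ≤ k + 1 :=
          Nat.sInf_le ⟨by omega, hk⟩
        have := k.2
        omega
      · rintro ⟨h1, h2⟩
        exact returnTime_eq h1 fun k hk => h2 ⟨k, hk⟩
    rw [e]
    exact (hT.iterate _ measurableSet_Ioc).inter
      (MeasurableSet.iInter fun k => (hT.iterate _ measurableSet_Ioc).compl)
  have hall : ∀ n, MeasurableSet {x | returnTime T (Ioc (1 / 4) 1) x = n} := by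
    intro n
    cases n with
    -- Time 0 is the default value for points that never return.
    | zero =>
      have e : {x | returnTime T (Ioc (1 / 4) 1) x = 0} =
          (⋃ n, {x | returnTime T (Ioc (1 / 4) 1) x = n + 1})ᶜ := by
        ext x
        simp only [mem_ofPred_eq, mem_compl_iff, mem_iUnion, not_exists]
        constructor
        · intro h n; omega
        · intro h
          by_contra h0
          exact h _ (Nat.succ_pred_eq_of_ne_zero h0).symm
      rw [e]
      exact (MeasurableSet.iUnion hfirst).compl
    | succ n => exact hfirst n
  intro B hB
  have e : inducedMap α T4 ε ⁻¹' B =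
      ⋃ n, {x | returnTime T (Ioc (1 / 4) 1) x = n} ∩ T^[n] ⁻¹' B := by
    ext x
    simp only [mem_preimage, mem_iUnion, mem_inter_iff, mem_ofPred_eq, inducedMap, ← hTdef]
    constructor
    · exact fun hx => ⟨_, rfl, hx⟩
    · rintro ⟨n, rfl, hx⟩; exact hx
  rw [e]
  exact MeasurableSet.iUnion fun n => (hall n).inter (hT.iterate n hB)

end IsRightData

/-! ### The branches of the induced map -/

/-- The branches of the induced map in the left component. -/
def leftI (α ε : ℝ) : ℕ ⊕ ℕ → Set ℝ :=
  Sum.elim (fun n => Ioo (apt α ε n) (apt α ε (n + 1)))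
    (fun n => Ioo (bpt α ε (n + 1)) (bptTop α ε n))

/-- The right end of the image of a left branch. -/
noncomputable def leftTop (ε : ℝ) : ℕ ⊕ ℕ → ℝ
  | .inl _ => 1 / 2 + ε
  | .inr 0 => 1 / 2
  | .inr (_ + 1) => 1 / 2 + ε

section left

variable {α ε : ℝ} {T4 : ℝ → ℝ → ℝ}

theorem leftI_subset (hα : 0 < α) (hε : 0 ≤ ε) (i : ℕ ⊕ ℕ) : leftI α ε i ⊆ Ioo (1 / 4) (1 / 2) := by
  rcases i with n | n
  · refine Ioo_subset_Ioo ?_ ((apt_lt_three_eighths hα hε _).le.trans (by norm_num))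
    rw [← apt_zero (α := α) hε]
    exact (apt_strictMono hα hε).monotone (Nat.zero_le n)
  · refine Ioo_subset_Ioo ?_ (bptTop_le hα hε n)
    linarith [three_eighths_lt_bpt hα hε (n + 1)]

/-- The branch `.inr 0` is exceptional: it is cut at 1/2 instead of `bpt α ε 0`, which equals 1/2 +
ε/4. It is the one left branch that does not overshoot 1/2 when ε > 0. -/
theorem image_leftI (hα : 0 < α) (hε : 0 ≤ ε) (hε1 : ε ≤ 1 / 4) (i : ℕ ⊕ ℕ) :
    inducedMap α T4 ε '' leftI α ε i = Ioo (1 / 4) (leftTop ε i) := by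
  have hc := neutralCoeff_pos (α := α) hε
  have hit : ∀ n, (neutral α (neutralCoeff α ε))^[n] (zpt α ε (n + 1)) = 1 / 4 := fun n =>
    (iterate_neutral_backOrbit hα hc n 1).trans (zpt_one hα hε)
  have hit0 : ∀ n, (neutral α (neutralCoeff α ε))^[n] (zpt α ε n) = 1 / 2 + ε := fun n =>
    (iterate_neutral_backOrbit hα hc n 0).trans zpt_zero
  have hm := fun n => iterate_neutral_strictMonoOn (α := α) hα hc.le n
  have hcont := fun n => (continuous_neutral (c := neutralCoeff α ε) hα).iterate n
  rcases i with n | n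
  · have e : inducedMap α T4 ε '' leftI α ε (.inl n) =
        (fun x => (neutral α (neutralCoeff α ε))^[n] (decBranch ε x)) ''
          Ioo (apt α ε n) (apt α ε (n + 1)) :=
      image_congr fun x hx => inducedMap_dec hα hε hε1 hx
    have hle := (apt_strictMono hα hε (Nat.lt_succ_self n)).le
    rw [e, image_Ioo_of_strictAntiOn hle, decBranch_apt hε, decBranch_apt hε, hit, hit0]
    · rfl
    · have hz := (zpt_pos hα hε (n + 1)).le
      refine (hm n).comp_strictAntiOn ?_ ?_
      · intro x _ y _ hxy
        unfold decBranch
        nlinarith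
      · intro x hx
        refine mem_Ici.2 (hz.trans ?_)
        by_contra hlt
        rw [not_le, ← apt_lt_iff hε] at hlt
        exact absurd hx.2 (not_le.2 hlt)
    · refine Continuous.continuousOn ?_
      have := hcont n
      unfold decBranch
      fun_prop
  · have e : inducedMap α T4 ε '' leftI α ε (.inr n) =
        (fun x => (neutral α (neutralCoeff α ε))^[n] (incBranch x)) ''
          Ioo (bpt α ε (n + 1)) (bptTop α ε n) :=
      image_congr fun x hx => inducedMap_inc hα hε hε1 hx
    have hle := (bpt_succ_lt_bptTop hα hε n).le
    rw [e, image_Ioo_of_strictMonoOn hle, incBranch_bpt, hit]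
    · congr 1
      cases n with
      | zero => rw [Function.iterate_zero, id, bptTop, incBranch, leftTop]; norm_num
      | succ n => rw [bptTop, incBranch_bpt, hit0]; rfl
    · have hz := (zpt_pos hα hε (n + 1)).le
      refine (hm n).comp ?_ ?_
      · intro x _ y _ hxy
        unfold incBranch
        linarith
      · intro x hx
        refine mem_Ici.2 (hz.trans ?_)
        by_contra hlt
        rw [not_le, ← lt_bpt_iff] at hlt
        exact absurd hx.1 (not_le.2 hlt)
    · refine Continuous.continuousOn ?_
      have := hcont n
      unfold incBranch
      fun_prop

theorem leftI_pos (hα : 0 < α) (hε : 0 ≤ ε) {n : ℕ} {x : ℝ} :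
    (x ∈ leftI α ε (.inl n) → 0 < decBranch ε x) ∧ (x ∈ leftI α ε (.inr n) → 0 < incBranch x) :=
  ⟨fun hx => (zpt_pos hα hε _).trans ((lt_apt_iff hε).1 hx.2),
    fun hx => (zpt_pos hα hε _).trans (bpt_lt_iff.1 hx.1)⟩

theorem isOpen_leftI (i : ℕ ⊕ ℕ) : IsOpen (leftI α ε i) := by
  rcases i with n | n <;> exact isOpen_Ioo

theorem ordConnected_leftI (i : ℕ ⊕ ℕ) : (leftI α ε i).OrdConnected := by
  rcases i with n | n <;> exact ordConnected_Ioo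

theorem isBranch_left (hα : 0 < α) (hα1 : α < 1) (hε : 0 ≤ ε) (hε1 : ε ≤ 1 / 4) (i : ℕ ⊕ ℕ) :
    IsBranch (inducedMap α T4 ε) (leftI α ε i) 8 4 := by
  have hc := neutralCoeff_pos (α := α) hε
  have hgt : ∀ x ∈ leftI α ε i, 1 / 4 < inducedMap α T4 ε x := fun x hx => by
    have : inducedMap α T4 ε x ∈ Ioo (1 / 4) (leftTop ε i) := by
      rw [← image_leftI hα hε hε1 i]; exact mem_image_of_mem _ hx
    exact this.1
  rcases i with n | n
  · refine isBranch_neutral (p := -4 * (1 + 2 * ε)) (q := 3 / 2 + 3 * ε) n hα hα1 hc.le ?_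
      (isOpen_leftI _) (ordConnected_leftI _) ?_ ?_ hgt
    · rw [abs_of_neg (by linarith)]; linarith
    · intro x hx
      rw [inducedMap_dec hα hε hε1 hx, decBranch, add_assoc]
    · intro x hx
      have := (leftI_pos hα hε).1 hx
      rw [decBranch] at this; linarith
  · refine isBranch_neutral (p := 4) (q := -(3 / 2)) n hα hα1 hc.le (by norm_num)
      (isOpen_leftI _) (ordConnected_leftI _) ?_ ?_ hgt
    · intro x hx
      rw [inducedMap_inc hα hε hε1 hx, incBranch, sub_eq_add_neg]
    · intro x hx
      have := (leftI_pos hα hε).2 hx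
      rw [incBranch] at this; linarith

theorem disjoint_leftI (hα : 0 < α) (hε : 0 ≤ ε) :
    Pairwise fun i j => Disjoint (leftI α ε i) (leftI α ε j) := by
  have hA := apt_strictMono hα hε
  have hB := bptTop_anti hα hε
  have key1 : ∀ m n, m < n → Disjoint (leftI α ε (.inl m)) (leftI α ε (.inl n)) := by
    intro m n hmn
    refine Set.disjoint_left.2 fun x hx hy => ?_
    have := hA.monotone (Nat.succ_le_of_lt hmn)
    exact absurd (hx.2.trans_le this) (not_lt.2 hy.1.le)
  have key2 : ∀ m n, m < n → Disjoint (leftI α ε (.inr m)) (leftI α ε (.inr n)) := by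
    intro m n hmn
    refine Set.disjoint_left.2 fun x hx hy => ?_
    have := hB.antitone (Nat.succ_le_of_lt hmn)
    exact absurd ((hy.2.trans_le this).trans hx.1) (lt_irrefl x)
  have key3 : ∀ m n, Disjoint (leftI α ε (.inl m)) (leftI α ε (.inr n)) := by
    intro m n
    refine Set.disjoint_left.2 fun x hx hy => ?_
    have h1 := hx.2.trans (apt_lt_three_eighths hα hε _)
    have h2 := (three_eighths_lt_bpt hα hε _).trans hy.1
    linarith
  rintro (m | m) (n | n) hne
  · rcases lt_or_gt_of_ne (fun h => hne (congrArg Sum.inl h)) with h | h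
    · exact key1 m n h
    · exact (key1 n m h).symm
  · exact key3 m n
  · exact (key3 n m).symm
  · rcases lt_or_gt_of_ne (fun h => hne (congrArg Sum.inr h)) with h | h
    · exact key2 m n h
    · exact (key2 n m h).symm

theorem countable_left (hα : 0 < α) (hε : 0 ≤ ε) :
    (indDomL \ ⋃ i, leftI α ε i).Countable := by
  have hsub : indDomL \ ⋃ i, leftI α ε i ⊆
      ({3 / 8, 1 / 2} ∪ range (apt α ε)) ∪ range fun n => bpt α ε (n + 1) := by
    rintro x ⟨hx, hxI⟩
    rcases left_cases hα hε hx with h | h | ⟨n, h⟩ | ⟨n, h⟩ | ⟨n, h⟩ | ⟨n, h⟩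
    · exact Or.inl (Or.inl (Or.inl h))
    · exact Or.inl (Or.inl (Or.inr h))
    · exact Or.inl (Or.inr ⟨n, h.symm⟩)
    · exact Or.inr ⟨n, h.symm⟩
    · exact absurd (mem_iUnion.2 ⟨.inl n, h⟩) hxI
    · exact absurd (mem_iUnion.2 ⟨.inr n, h⟩) hxI
  exact (((to_countable _).union (countable_range _)).union (countable_range _)).mono hsub

theorem mapsTo_left (hα : 0 < α) (hε : 0 ≤ ε) (hε1 : ε ≤ 1 / 4)
    (hhalf : inducedMap α T4 ε (1 / 2) = 1 / 2) :
    MapsTo (inducedMap α T4 ε) indDomL (Icc (1 / 4) (1 / 2 + ε)) := by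
  intro x hx
  have key : ∀ i, x ∈ leftI α ε i → inducedMap α T4 ε x ∈ Icc (1 / 4) (1 / 2 + ε) := by
    intro i hi
    have h1 := mem_image_of_mem (inducedMap α T4 ε) hi
    rw [image_leftI hα hε hε1] at h1
    refine ⟨h1.1.le, h1.2.le.trans ?_⟩
    rcases i with n | _ | n
    · exact le_rfl
    · change (1 : ℝ) / 2 ≤ _; linarith
    · exact le_rfl
  rcases left_cases hα hε hx with rfl | rfl | ⟨n, rfl⟩ | ⟨n, rfl⟩ | ⟨n, h⟩ | ⟨n, h⟩
  · rw [inducedMap_three_eighths hα]; constructor <;> linarith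
  · rw [hhalf]; constructor <;> linarith
  · rw [inducedMap_apt hα hε hε1]; constructor <;> linarith
  · rw [inducedMap_bpt hα hε hε1]; constructor <;> linarith
  · exact key (.inl n) h
  · exact key (.inr n) h

end left

namespace IsRightData

variable {ε₀ : ℝ} {T4 : ℝ → ℝ → ℝ} {M p : ℕ} {s : ℝ} {c : ℕ → ℝ → ℝ} {g : ℕ → ℝ → ℝ → ℝ} {ε α : ℝ}
  {j : ℕ}

theorem image_right (h : IsRightData ε₀ T4 M p s c g) (hε₀ : ε₀ ≤ 1 / 4) (hε : ε ∈ Ico 0 ε₀)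
    (hj : j < 2 * M + 1) :
    inducedMap α T4 ε '' Ioo (c j ε) (c (j + 1) ε) = Ioo (lowEnd p ε j) 1 := by
  rw [← h.image_Ioo hε hj]
  exact image_congr fun x hx => h.inducedMap_eqOn hε₀ hε hj α (Ioo_subset_Icc_self hx)

theorem disjoint_right (h : IsRightData ε₀ T4 M p s c g) (hε : ε ∈ Ico 0 ε₀) :
    Pairwise fun i j : Fin (2 * M + 1) =>
      Disjoint (Ioo (c i ε) (c (i + 1) ε)) (Ioo (c j ε) (c (j + 1) ε)) := by
  have key : ∀ i j : Fin (2 * M + 1), i < j →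
      Disjoint (Ioo (c i ε) (c (i + 1) ε)) (Ioo (c j ε) (c (j + 1) ε)) := by
    intro i j hij
    refine Set.disjoint_left.2 fun x hx hy => ?_
    have h1 := j.2
    have h2 : (i : ℕ) < j := hij
    have := h.c_le hε (i := i + 1) (j := j) (by omega) (by omega)
    linarith [hx.2, hy.1]
  intro i j hne
  rcases lt_or_gt_of_ne hne with h' | h'
  · exact key i j h'
  · exact (key j i h').symm

theorem right_cases (h : IsRightData ε₀ T4 M p s c g) (hε : ε ∈ Ico 0 ε₀) {x : ℝ}
    (hx : x ∈ indDomR) : (∃ j ≤ 2 * M + 1, x = c j ε) ∨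
      ∃ j < 2 * M + 1, x ∈ Ioo (c j ε) (c (j + 1) ε) := by
  obtain ⟨j, hj, hx⟩ := h.exists_mem hε hx
  rcases hx.1.eq_or_lt with h1 | h1
  · exact Or.inl ⟨j, hj.le, h1.symm⟩
  · rcases hx.2.eq_or_lt with h2 | h2
    · exact Or.inl ⟨j + 1, hj, h2⟩
    · exact Or.inr ⟨j, hj, h1, h2⟩

theorem countable_right (h : IsRightData ε₀ T4 M p s c g) (hε : ε ∈ Ico 0 ε₀) :
    (indDomR \ ⋃ j : Fin (2 * M + 1), Ioo (c j ε) (c (j + 1) ε)).Countable := by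
  refine (countable_range fun j => c j ε).mono ?_
  rintro x ⟨hx, hxI⟩
  rcases h.right_cases hε hx with ⟨j, -, h⟩ | ⟨j, hj, h⟩
  · exact ⟨j, h.symm⟩
  · exact absurd (mem_iUnion.2 ⟨⟨j, hj⟩, h⟩) hxI

theorem right_subset (h : IsRightData ε₀ T4 M p s c g) (hε : ε ∈ Ico 0 ε₀) (hj : j < 2 * M + 1) :
    Ioo (c j ε) (c (j + 1) ε) ⊆ Ioo (1 / 2) 1 :=
  Ioo_subset_Ioo (h.c_mem hε (by omega)).1 (h.c_mem hε (by omega)).2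

theorem mapsTo_right (h : IsRightData ε₀ T4 M p s c g) (hε₀ : ε₀ ≤ 1 / 4) (hε : ε ∈ Ico 0 ε₀) :
    MapsTo (inducedMap α T4 ε) indDomR (Icc (1 / 2 - ε) 1) := fun x hx => by
  rw [h.inducedMap_eq hε₀ hε hx]; exact h.T4_mem hε hx

theorem mapsTo_indDom (h : IsRightData ε₀ T4 M p s c g) (hα : 0 < α) (hε₀ : ε₀ ≤ 1 / 4)
    (hε : ε ∈ Ico 0 ε₀) : MapsTo (inducedMap α T4 ε) indDom indDom := by
  intro x hx
  rcases le_total x (1 / 2) with h1 | h1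
  · have := mapsTo_left hα hε.1 (hε.2.le.trans hε₀) (h.inducedMap_half hε₀ hε α) ⟨hx.1, h1⟩
    exact ⟨this.1, by linarith [this.2, hε.2]⟩
  · have := h.mapsTo_right (α := α) hε₀ hε ⟨h1, hx.2⟩
    exact ⟨by linarith [this.1, hε.2], this.2⟩

theorem mapsTo_indDomL_zero (h : IsRightData ε₀ T4 M p s c g) (hα : 0 < α) (h0 : 0 < ε₀)
    (hε₀ : ε₀ ≤ 1 / 4) : MapsTo (inducedMap α T4 0) indDomL indDomL := by
  have := mapsTo_left hα le_rfl (by norm_num) (h.inducedMap_half hε₀ ⟨le_rfl, h0⟩ α)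
  rwa [add_zero] at this

theorem mapsTo_indDomR_zero (h : IsRightData ε₀ T4 M p s c g) (h0 : 0 < ε₀)
    (hε₀ : ε₀ ≤ 1 / 4) : MapsTo (inducedMap α T4 0) indDomR indDomR := by
  have := h.mapsTo_right (α := α) hε₀ ⟨le_rfl, h0⟩
  rwa [sub_zero] at this

/-! ### The unperturbed induced map is piecewise expanding with full branches -/

theorem isPiecewiseExpanding_left (h : IsRightData ε₀ T4 M p s c g) (hα : 0 < α) (hα1 : α < 1)
    (h0 : 0 < ε₀) : IsPiecewiseExpanding (inducedMap α T4 0) (leftI α 0)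
      (fun _ : Unit => Ioo (1 / 4 : ℝ) (1 / 2)) (fun _ => ()) 8 4 (Ioo (1 / 4) (1 / 2)) := by
  refine IsPiecewiseExpanding.of_branches (h.measurable_inducedMap ⟨le_rfl, h0⟩ α) (by norm_num)
    (by norm_num) (isBranch_left hα hα1 le_rfl (by norm_num)) (disjoint_leftI hα le_rfl)
    (leftI_subset hα le_rfl) ?_ ?_ (fun _ => subset_rfl) (fun _ => ?_) ordConnected_Ioo ?_
  · exact ((countable_left hα le_rfl).mono
      (sdiff_subset_sdiff_left Ioo_subset_Icc_self)).measure_zero _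
  · intro i
    rw [image_leftI hα le_rfl (by norm_num)]
    rcases i with n | _ | n <;> simp [leftTop]
  · rw [Real.volume_Ioo]; norm_num
  · intro x hx y hy
    rw [abs_le]; constructor <;> linarith [hx.1, hx.2, hy.1, hy.2]

theorem exists_isPiecewiseExpanding_right (h : IsRightData ε₀ T4 M p s c g) (h0 : 0 < ε₀)
    (hε₀ : ε₀ ≤ 1 / 4) : ∃ D lam, IsPiecewiseExpanding (inducedMap α T4 0)
      (fun j : Fin (2 * M + 1) => Ioo (c j 0) (c (j + 1) 0))
      (fun _ : Unit => Ioo (1 / 2 : ℝ) 1) (fun _ => ()) D lam (Ioo (1 / 2) 1) := by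
  have hz : (0 : ℝ) ∈ Ico 0 ε₀ := ⟨le_rfl, h0⟩
  obtain ⟨D, lam, hD, hl, hb⟩ := h.exists_isBranch hε₀ hz α
  refine ⟨D, lam, IsPiecewiseExpanding.of_branches (h.measurable_inducedMap hz α) hl hD
    (fun j => hb j j.2) (h.disjoint_right hz) (fun j => h.right_subset hz j.2) ?_ ?_
    (fun _ => subset_rfl) (fun _ => ?_) ordConnected_Ioo ?_⟩
  · exact ((h.countable_right hz).mono (sdiff_subset_sdiff_left Ioo_subset_Icc_self)).measure_zero _
  · intro j
    rw [h.image_right hε₀ hz j.2]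
    simp [lowEnd]
  · rw [Real.volume_Ioo]; norm_num
  · intro x hx y hy
    rw [abs_le]; constructor <;> linarith [hx.1, hx.2, hy.1, hy.2]

/-! ### The perturbed induced map -/

/-- The images of the branches of the perturbed map. -/
noncomputable def imageJ (ε : ℝ) : Bool ⊕ Bool → Set ℝ
  | .inl b => Ioo (1 / 4) (if b then 1 / 2 + ε else 1 / 2)
  | .inr b => Ioo (if b then 1 / 2 - ε else 1 / 2) 1

open Classical in
theorem exists_isPiecewiseExpanding (h : IsRightData ε₀ T4 M p s c g) (hα : 0 < α) (hα1 : α < 1)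
    (hε₀ : ε₀ ≤ 1 / 4) (hε : ε ∈ Ico 0 ε₀) : ∃ D lam σ, IsPiecewiseExpanding (inducedMap α T4 ε)
      (Sum.elim (leftI α ε) fun j : Fin (2 * M + 1) => Ioo (c j ε) (c (j + 1) ε))
      (imageJ ε) σ D lam indDom := by
  obtain ⟨D, lam, hD, hl, hb⟩ := h.exists_isBranch hε₀ hε α
  have hε1 : ε ≤ 1 / 4 := hε.2.le.trans hε₀
  have hε0 := hε.1
  have hsubL : Ioo (1 / 4 : ℝ) (1 / 2) ⊆ indDom :=
    Ioo_subset_Icc_self.trans (Icc_subset_Icc_right (by norm_num))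
  have hsubR : Ioo (1 / 2 : ℝ) 1 ⊆ indDom :=
    Ioo_subset_Icc_self.trans (Icc_subset_Icc_left (by norm_num))
  -- The constants 8 and 4 belong to the left branches, D and lam to the right ones. The Boolean
  -- records whether the image extends beyond 1/2.
  refine ⟨max 8 D, min 4 lam, Sum.elim
    (fun i => match i with
      | .inl _ => .inl true
      | .inr 0 => .inl false
      | .inr (_ + 1) => .inl true)
    (fun j => .inr (decide ((j : ℕ) + 1 = 2 * p ∨ (j : ℕ) = 2 * p))),
    IsPiecewiseExpanding.of_branches (h.measurable_inducedMap hε α) (lt_min (by norm_num) hl)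
    (le_max_of_le_right hD) ?_ ?_ ?_ ?_ ?_ ?_ ?_ ordConnected_Icc ?_⟩
  · rintro (i | j)
    · exact (isBranch_left hα hα1 hε0 hε1 i).mono (le_max_left _ _) (min_le_left _ _)
    · exact (hb j j.2).mono (le_max_right _ _) (min_le_right _ _)
  · have hLR : ∀ i (j : Fin (2 * M + 1)), Disjoint (leftI α ε i) (Ioo (c j ε) (c (j + 1) ε)) := by
      intro i j
      refine Set.disjoint_left.2 fun x hx hy => ?_
      have h1 := (leftI_subset hα hε0 i hx).2
      have h2 := (h.right_subset hε j.2 hy).1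
      linarith
    rintro (i | i) (j | j) hne
    · exact disjoint_leftI hα hε0 fun h => hne (congrArg _ h)
    · exact hLR i j
    · exact (hLR j i).symm
    · exact h.disjoint_right hε fun h => hne (congrArg _ h)
  · rintro (i | j)
    · exact (leftI_subset hα hε0 i).trans hsubL
    · exact (h.right_subset hε j.2).trans hsubR
  · refine (((countable_left hα hε0).union (h.countable_right hε)).mono ?_).measure_zero _
    rintro x ⟨hx, hxI⟩
    rw [iUnion_sumElim] at hxI
    rcases le_total x (1 / 2) with h1 | h1
    · exact Or.inl ⟨⟨hx.1, h1⟩, fun h => hxI (Or.inl h)⟩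
    · exact Or.inr ⟨⟨h1, hx.2⟩, fun h => hxI (Or.inr h)⟩
  · rintro (i | j)
    · rw [Sum.elim_inl, image_leftI hα hε0 hε1]
      rcases i with n | _ | n <;> simp [leftTop, imageJ]
    · rw [Sum.elim_inr, h.image_right hε₀ hε j.2]
      simp [imageJ, lowEnd]
  · rintro (b | b) x hx
    · have h1 := hx.1
      have h2 := hx.2
      refine ⟨h1.le, ?_⟩
      split_ifs at h2 <;> linarith
    · have h1 := hx.1
      have h2 := hx.2
      refine ⟨?_, h2.le⟩
      split_ifs at h1 <;> linarith
  · rintro (b | b)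
    · simp only [imageJ, Real.volume_Ioo, ne_eq, ENNReal.ofReal_eq_zero, not_le]
      split_ifs <;> linarith
    · simp only [imageJ, Real.volume_Ioo, ne_eq, ENNReal.ofReal_eq_zero, not_le]
      split_ifs <;> linarith
  · intro x hx y hy
    rw [abs_le]; constructor <;> linarith [hx.1, hx.2, hy.1, hy.2]

theorem ordConnected_imageJ (ε : ℝ) (k : Bool ⊕ Bool) : (imageJ ε k).OrdConnected := by
  rcases k with b | b <;> exact ordConnected_Ioo

end IsRightData

/-! ### Uniqueness of the a.c.i.m. of the perturbed map. -/

/-- For invariant `A` the set `F '' U ∩ A` is contained in `F '' (U ∩ A)`, and differentiable maps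
send null sets to null sets. Nullity thus spreads along images of branches. -/
theorem volume_image_inter_eq_zero {F : ℝ → ℝ} {A U : Set ℝ} (hFA : F ⁻¹' A = A)
    (hd : ∀ x ∈ U, DifferentiableAt ℝ F x) (h0 : volume (U ∩ A) = 0) :
    volume (F '' U ∩ A) = 0 := by
  have hsub : F '' U ∩ A ⊆ F '' (U ∩ A) := by
    rintro _ ⟨⟨x, hx, rfl⟩, hA⟩
    exact ⟨x, ⟨hx, by rw [← hFA]; exact hA⟩, rfl⟩
  exact measure_mono_null hsub (addHaar_image_eq_zero_of_differentiableOn_of_addHaar_eq_zero _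
    (fun x hx => (hd x hx.1).differentiableWithinAt) h0)

theorem volume_inter_mono {A U V : Set ℝ} (hUV : U ⊆ V) (h0 : volume (V ∩ A) = 0) :
    volume (U ∩ A) = 0 :=
  measure_mono_null (inter_subset_inter_left A hUV) h0

namespace IsRightData

variable {ε₀ : ℝ} {T4 : ℝ → ℝ → ℝ} {M p : ℕ} {s : ℝ} {c : ℕ → ℝ → ℝ} {g : ℕ → ℝ → ℝ → ℝ} {ε α : ℝ}
  {j : ℕ} {A : Set ℝ}

/-- The first right branch is increasing, fixes 1/2 and has slope above 2. A null interval to the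
right of 1/2 can therefore be doubled repeatedly until it fills the branch, whose image is (1/2, 1).
-/
theorem null_right_of_null (h : IsRightData ε₀ T4 M p s c g) (hε₀ : ε₀ ≤ 1 / 4)
    (hε : ε ∈ Ico 0 ε₀) (hFA : inducedMap α T4 ε ⁻¹' A = A) {t : ℝ} (ht : 0 < t)
    (h0 : volume (Ioo (1 / 2) (1 / 2 + t) ∩ A) = 0) : volume (Ioo (1 / 2) 1 ∩ A) = 0 := by
  obtain ⟨D, lam, -, -, hb⟩ := h.exists_isBranch hε₀ hε α
  have hb0 := hb 0 (by omega)
  have hc0 := h.c_zero ε hε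
  have hlow : lowEnd p ε 0 = 1 / 2 := by
    have := h.one_le
    rw [lowEnd, if_neg (by omega)]
  have hlt := h.c_lt ε hε 0 (by omega)
  rw [hc0] at hb0 hlt
  rw [zero_add] at hb0 hlt
  have hg := h.strictMonoOn_or hε (j := 0) (by omega)
  obtain ⟨-, hm, v1, -⟩ := hg.resolve_right fun h => by have := h.1; revert this; decide
  rw [hc0, hlow] at v1
  rw [hc0, zero_add] at hm
  have heq := h.inducedMap_eqOn hε₀ hε (j := 0) (by omega) α
  rw [hc0, zero_add] at heq
  have key : ∀ n : ℕ, volume (Ioo (1 / 2) (min (c 1 ε) (1 / 2 + 2 ^ n * t)) ∩ A) = 0 := by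
    intro n
    induction n with
    | zero =>
      refine volume_inter_mono (Ioo_subset_Ioo_right ?_) h0
      simp
    | succ n ih =>
      rcases le_total (c 1 ε) (1 / 2 + 2 ^ n * t) with hle | hle
      · rw [min_eq_left hle] at ih
        exact volume_inter_mono (Ioo_subset_Ioo_right (min_le_left _ _)) ih
      · rw [min_eq_right hle] at ih
        set m := 1 / 2 + 2 ^ n * t with hmdef
        have hm0 : 1 / 2 < m := by rw [hmdef]; have : 0 < 2 ^ n * t := by positivity
                                   linarith
        have himg := volume_image_inter_eq_zero hFA
          (fun x hx => hb0.diff1 x (Ioo_subset_Ioo_right hle hx)) ih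
        refine volume_inter_mono ?_ himg
        have himg2 : inducedMap α T4 ε '' Ioo (1 / 2) m = g 0 ε '' Ioo (1 / 2) m :=
          image_congr fun x hx => heq ⟨hx.1.le, hx.2.le.trans hle⟩
        rw [himg2]
        refine Subset.trans ?_ (intermediate_value_Ioo hm0.le
          (h.contDiff_branch (ε := ε) (j := 0) (by omega)).continuous.continuousOn)
        rw [v1]
        refine Ioo_subset_Ioo_right ((min_le_right _ _).trans ?_)
        have hexp := expand_of_deriv (F := g 0 ε) (lam := 2) (W := Icc (1 / 2) (c 1 ε))
          ordConnected_Icc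
          (fun x _ => ((h.contDiff_branch (by omega)).differentiable (by norm_num)).differentiableAt)
          (fun x hx => (h.slope ε hε 0 (by omega) x (by rw [hc0, zero_add]; exact hx)).le)
          m ⟨hm0.le, hle⟩ (1 / 2) ⟨le_rfl, hlt.le⟩
        have hgm := hm ⟨le_rfl, hlt.le⟩ ⟨hm0.le, hle⟩ hm0
        rw [v1] at hexp hgm
        rw [abs_of_pos (by linarith), abs_of_pos (by linarith)] at hexp
        rw [pow_succ]
        linarith
  obtain ⟨n, hn⟩ := pow_unbounded_of_one_lt ((c 1 ε - 1 / 2) / t) (by norm_num : (1 : ℝ) < 2)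
  rw [div_lt_iff₀ ht] at hn
  have hfin := key n
  rw [min_eq_left (by linarith)] at hfin
  have := volume_image_inter_eq_zero hFA (fun x hx => hb0.diff1 x hx) hfin
  have himg := h.image_right (α := α) hε₀ hε (j := 0) (by omega)
  rw [hc0, zero_add, hlow] at himg
  rwa [himg] at this

/-- The mirror image of the argument on the right, with the branch x ↦ 4x - 3/2 on (7/16, 1/2): it
fixes 1/2, quadruples the distance to it and has image (1/4, 1/2). -/
theorem null_left_of_null (hα : 0 < α) (hα1 : α < 1) (hε : 0 ≤ ε) (hε1 : ε ≤ 1 / 4)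
    (hFA : inducedMap α T4 ε ⁻¹' A = A) {t : ℝ} (ht : 0 < t)
    (h0 : volume (Ioo (1 / 2 - t) (1 / 2) ∩ A) = 0) : volume (Ioo (1 / 4) (1 / 2) ∩ A) = 0 := by
  have hb := isBranch_left (T4 := T4) hα hα1 hε hε1 (.inr 0)
  have himg := image_leftI (T4 := T4) hα hε hε1 (.inr 0)
  have hI : leftI α ε (.inr 0) = Ioo (7 / 16) (1 / 2) := by
    change Ioo (bpt α ε (0 + 1)) _ = _
    rw [zero_add, bpt_one hα hε]; rfl
  have hval : ∀ x ∈ Ioo (7 / 16 : ℝ) (1 / 2), inducedMap α T4 ε x = 4 * x - 3 / 2 := by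
    intro x hx
    rw [← hI] at hx
    rw [inducedMap_inc hα hε hε1 hx]; rfl
  rw [hI] at hb himg
  have key : ∀ n : ℕ, volume (Ioo (max (7 / 16) (1 / 2 - 4 ^ n * t)) (1 / 2) ∩ A) = 0 := by
    intro n
    induction n with
    | zero =>
      refine volume_inter_mono (Ioo_subset_Ioo_left ?_) h0
      simp
    | succ n ih =>
      have := volume_image_inter_eq_zero hFA
        (fun x hx => hb.diff1 x (Ioo_subset_Ioo_left (le_max_left _ _) hx)) ih
      refine volume_inter_mono ?_ this
      rintro y ⟨hy1, hy2⟩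
      obtain ⟨hy3, hy4⟩ := max_lt_iff.1 hy1
      rw [pow_succ] at hy4
      refine ⟨(y + 3 / 2) / 4, ⟨max_lt ?_ ?_, ?_⟩, ?_⟩
      · linarith
      · linarith
      · linarith
      · rw [hval _ ⟨by linarith, by linarith⟩]; ring
  obtain ⟨n, hn⟩ := pow_unbounded_of_one_lt (1 / t) (by norm_num : (1 : ℝ) < 4)
  rw [div_lt_iff₀ ht] at hn
  have hfin := key n
  rw [max_eq_left (by linarith)] at hfin
  have := volume_image_inter_eq_zero hFA (fun x hx => hb.diff1 x hx) hfin
  rwa [himg] at this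

/-- If `A` is not full, it is null in one of the images, and each image contains one whole side of
1/2. From the left, nullity crosses to (1/2, 1/2 + ε) through the branch `.inl 0`; from the right,
to (1/2 - ε, 1/2) through the branch starting at the spike. Then it spreads over the other side. -/
theorem trivial_of_invariant (h : IsRightData ε₀ T4 M p s c g) (hα : 0 < α) (hα1 : α < 1)
    (hε₀ : ε₀ ≤ 1 / 4) (hε : ε ∈ Ioo 0 ε₀) (hA : MeasurableSet A)
    (hFA : inducedMap α T4 ε ⁻¹' A = A) :
    volume (indDom ∩ A) = 0 ∨ volume (indDom \ A) = 0 := by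
  have hε' : ε ∈ Ico 0 ε₀ := ⟨hε.1.le, hε.2⟩
  have hε1 : ε ≤ 1 / 4 := hε.2.le.trans hε₀
  have hε0 : 0 < ε := hε.1
  rw [or_iff_not_imp_right]
  intro hne
  have hL : volume (Ioo (1 / 4) (1 / 2) ∩ A) = 0 → volume (indDom ∩ A) = 0 := by
    intro h0
    have h1 : volume (Ioo (1 / 4) (1 / 2 + ε) ∩ A) = 0 := by
      have := volume_image_inter_eq_zero hFA
        (fun x hx => (isBranch_left (T4 := T4) hα hα1 hε0.le hε1 (.inl 0)).diff1 x hx)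
        (volume_inter_mono (leftI_subset hα hε0.le (.inl 0)) h0)
      rwa [image_leftI hα hε0.le hε1] at this
    have h2 := h.null_right_of_null hε₀ hε' hFA hε0
      (volume_inter_mono (Ioo_subset_Ioo_left (by norm_num)) h1)
    have hsub : indDom ∩ A ⊆
        (Ioo (1 / 4) (1 / 2) ∩ A ∪ Ioo (1 / 2) 1 ∩ A) ∪ {1 / 4, 1 / 2, 1} := by
      rintro x ⟨hx, hxA⟩
      rcases hx.1.eq_or_lt with e | e
      · right; left; exact e.symm
      rcases hx.2.eq_or_lt with e' | e'
      · right; right; right; exact e'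
      rcases lt_trichotomy x (1 / 2) with e'' | e'' | e''
      · exact Or.inl (Or.inl ⟨⟨e, e''⟩, hxA⟩)
      · right; right; left; exact e''
      · exact Or.inl (Or.inr ⟨⟨e'', e'⟩, hxA⟩)
    exact measure_mono_null hsub (measure_union_null (measure_union_null h0 h2)
      ((to_countable _).measure_zero _))
  have hR : volume (Ioo (1 / 2) 1 ∩ A) = 0 → volume (indDom ∩ A) = 0 := by
    intro h0
    obtain ⟨D, lam, -, -, hb⟩ := h.exists_isBranch hε₀ hε' α
    have hj : 2 * p < 2 * M + 1 := by have := h.p_le; omega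
    have := volume_image_inter_eq_zero hFA (fun x hx => (hb _ hj).diff1 x hx)
      (volume_inter_mono (h.right_subset hε' hj) h0)
    rw [h.image_right hε₀ hε' hj, lowEnd, if_pos (Or.inr rfl)] at this
    exact hL (null_left_of_null hα hα1 hε0.le hε1 hFA hε0
      (volume_inter_mono (Ioo_subset_Ioo_right (by norm_num)) this))
  obtain ⟨D, lam, σ, hpe⟩ := h.exists_isPiecewiseExpanding hα hα1 hε₀ hε'
  have hk : ∃ k, volume (imageJ ε k ∩ A) = 0 := by
    by_contra hcon
    push Not at hcon
    exact hne (hpe.null_compl_of_invariant hA hFA hcon (ordConnected_imageJ ε))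
  obtain ⟨k, hk⟩ := hk
  rcases k with b | b
  · refine hL (volume_inter_mono (Ioo_subset_Ioo_right ?_) hk)
    split_ifs <;> linarith
  · refine hR (volume_inter_mono (Ioo_subset_Ioo_left ?_) hk)
    split_ifs <;> linarith

theorem condB3 (h : IsRightData ε₀ T4 M p s c g) (hα : 0 < α) (hα1 : α < 1)
    (hε₀ : ε₀ ≤ 1 / 4) : CondB3 (inducedMap α T4) indDom ε₀ := by
  intro ε hε
  obtain ⟨D, lam, σ, hpe⟩ := h.exists_isPiecewiseExpanding hα hα1 hε₀ ⟨hε.1.le, hε.2⟩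
  obtain ⟨C, hC, hb⟩ := hpe.exists_bound (ordConnected_imageJ ε)
  have hm0 : volume.restrict indDom ≠ 0 := by
    rw [Ne, Measure.restrict_eq_zero, indDom, Real.volume_Icc]
    norm_num
  have hfin : IsFiniteMeasure (volume.restrict indDom) := by
    rw [indDom]; infer_instance
  obtain ⟨μ, h1, h2, h3⟩ := exists_invariant_of_bound hpe.measurable hm0 hC hb
  refine ⟨μ, ⟨h1, h2, h3⟩, fun ν hν => ?_⟩
  exact hν.eq_of_trivial (fun A hA hFA => h.trivial_of_invariant hα hα1 hε₀ hε hA hFA) ⟨h1, h2, h3⟩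

end IsRightData

/-! ### The invariant densities of the unperturbed map -/

theorem support_withDensity_Icc {a b : ℝ} (hab : a < b) {g : ℝ → ℝ} (hg : ∀ x, 0 < g x)
    (hm : Measurable g) :
    ((volume.restrict (Icc a b)).withDensity fun x => ENNReal.ofReal (g x)).support = Icc a b := by
  ext x
  rw [Measure.mem_support_iff_forall]
  constructor
  · intro hx
    by_contra hnot
    have hU : (Icc a b)ᶜ ∈ 𝓝 x := isClosed_Icc.isOpen_compl.mem_nhds hnot
    refine (hx _ hU).ne' ?_
    refine withDensity_absolutelyContinuous _ _ ?_
    rw [Measure.restrict_apply measurableSet_Icc.compl]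
    simp
  · intro hx U hU
    rw [pos_iff_ne_zero]
    intro h0
    have hac : volume.restrict (Icc a b) ≪
        (volume.restrict (Icc a b)).withDensity fun x => ENNReal.ofReal (g x) := by
      refine withDensity_absolutelyContinuous' (by fun_prop) (ae_of_all _ fun x => ?_)
      simpa using hg x
    have h1 := hac h0
    obtain ⟨δ, hδ, hball⟩ := Metric.mem_nhds_iff.1 hU
    have h2 := measure_mono_null hball h1
    rw [Measure.restrict_apply Metric.isOpen_ball.measurableSet, Real.ball_eq_Ioo] at h2
    have h3 : Ioo (max (x - δ) a) (min (x + δ) b) ⊆ Ioo (x - δ) (x + δ) ∩ Icc a b := by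
      rintro y ⟨hy1, hy2⟩
      obtain ⟨h4, h5⟩ := max_lt_iff.1 hy1
      obtain ⟨h6, h7⟩ := lt_min_iff.1 hy2
      exact ⟨⟨h4, h6⟩, h5.le, h7.le⟩
    have h4 := measure_mono_null h3 h2
    rw [Real.volume_Ioo, ENNReal.ofReal_eq_zero, sub_nonpos, min_le_iff, le_max_iff,
      le_max_iff] at h4
    have := hx.1
    have := hx.2
    rcases h4 with (h4 | h4) | (h4 | h4)
    · linarith
    · linarith
    · linarith
    · linarith

/-- A full-branched map has exactly one a.c.i.m.; it is ergodic with a Lipschitz density bounded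
away from zero. -/
theorem exists_full_component {ι : Type} [Countable ι] {F : ℝ → ℝ} {I : ι → Set ℝ} {D lam a b : ℝ}
    (hab : a < b) (h : IsPiecewiseExpanding F I (fun _ : Unit => Ioo a b) (fun _ => ()) D lam
      (Ioo a b)) :
    ∃ (μ : Measure ℝ) (g : ℝ → ℝ) (L : NNReal) (a₀ : ℝ), LipschitzWith L g ∧ 0 < a₀ ∧
      (∀ x, a₀ ≤ g x) ∧ IsDensityOn μ g (Icc a b) ∧ IsACIM F (Icc a b) μ ∧ Ergodic F μ ∧
      (∀ ν, IsACIM F (Icc a b) ν → ν = μ) ∧ μ.support = Icc a b := by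
  obtain ⟨μ, g, L, a₀, h1, h2, h3, h4, h5, h6⟩ := h.exists_lipschitz_density
  have hr : volume.restrict (Ioo a b) = volume.restrict (Icc a b) :=
    Measure.restrict_congr_set Ioo_ae_eq_Icc
  rw [hr] at h6
  have hac : IsACIM F (Icc a b) μ := ⟨h1, by rw [h6]; exact withDensity_absolutelyContinuous _ _, h2⟩
  have htriv : ∀ A, MeasurableSet A → F ⁻¹' A = A →
      volume (Icc a b ∩ A) = 0 ∨ volume (Icc a b \ A) = 0 := by
    intro A hA hFA
    have e1 : volume (Icc a b ∩ A) = volume (Ioo a b ∩ A) := by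
      rw [inter_comm, ← Measure.restrict_apply hA, ← hr, Measure.restrict_apply hA, inter_comm]
    have e2 : volume (Icc a b \ A) = volume (Ioo a b \ A) := by
      rw [sdiff_eq, inter_comm, ← Measure.restrict_apply hA.compl, ← hr,
        Measure.restrict_apply hA.compl, inter_comm, ← sdiff_eq]
    rw [e1, e2, or_iff_not_imp_left]
    exact fun h0 => h.null_compl_of_invariant hA hFA (fun _ => h0) (fun _ => ordConnected_Ioo)
  refine ⟨μ, g, L, a₀, h3, h4, h5, ⟨fun x _ => h4.le.trans (h5 x), h6⟩, hac,
    ergodic_of_trivial htriv hac.2.1 h2, fun ν hν => hν.eq_of_trivial htriv hac, ?_⟩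
  rw [h6]
  exact support_withDensity_Icc hab (fun x => h4.trans_le (h5 x)) h3.continuous.measurable

/-- If the domain splits into two invariant intervals, each carrying a unique a.c.i.m., these are
the ergodic a.c.i.m.s. -/
theorem acim_ergodic_iff {F : ℝ → ℝ} {Δ Δl Δr : Set ℝ} (hΔ : Δl ∪ Δr = Δ)
    (hl : MeasurableSet Δl) (hFl : MapsTo F Δl Δl) {μl μr : Measure ℝ}
    (al : IsACIM F Δl μl) (el : Ergodic F μl) (ul : ∀ ν, IsACIM F Δl ν → ν = μl)
    (ar : IsACIM F Δr μr) (er : Ergodic F μr) (ur : ∀ ν, IsACIM F Δr ν → ν = μr) (μ : Measure ℝ) :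
    (IsACIM F Δ μ ∧ Ergodic F μ) ↔ (μ = μl ∨ μ = μr) := by
  constructor
  · rintro ⟨⟨hp, hac, hinv⟩, herg⟩
    -- Forward invariance means that `Δl` is contained in its preimage, which suffices for an
    -- ergodic measure to give it mass 0 or full mass.
    rcases herg.ae_empty_or_univ_of_ae_le_preimage hl.nullMeasurableSet
      (ae_of_all _ fun x hx => hFl hx) with h0 | h1
    · right
      refine ur μ ⟨hp, ?_, hinv⟩
      refine Measure.AbsolutelyContinuous.mk fun B hB hB0 => ?_
      rw [Measure.restrict_apply hB] at hB0
      have hsplit : B ⊆ (B \ Δl) ∪ Δl := fun x hx => by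
        by_cases hxl : x ∈ Δl
        · exact Or.inr hxl
        · exact Or.inl ⟨hx, hxl⟩
      refine measure_mono_null hsplit (measure_union_null (hac ?_) (measure_congr h0 ▸ measure_empty))
      rw [Measure.restrict_apply (hB.diff hl)]
      refine measure_mono_null ?_ hB0
      rintro x ⟨⟨hxB, hxl⟩, hx⟩
      rw [← hΔ] at hx
      exact ⟨hxB, hx.resolve_left hxl⟩
    · left
      refine ul μ ⟨hp, ?_, hinv⟩
      refine Measure.AbsolutelyContinuous.mk fun B hB hB0 => ?_
      rw [Measure.restrict_apply hB] at hB0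
      have hc : μ Δlᶜ = 0 := ae_eq_univ.1 h1
      have hsplit : B ⊆ (B ∩ Δl) ∪ Δlᶜ := fun x hx => by
        by_cases hxl : x ∈ Δl
        · exact Or.inl ⟨hx, hxl⟩
        · exact Or.inr hxl
      refine measure_mono_null hsplit (measure_union_null (hac ?_) hc)
      rw [Measure.restrict_apply (hB.inter hl)]
      exact measure_mono_null inter_subset_left hB0
  · rintro (rfl | rfl)
    · refine ⟨⟨al.1, al.2.1.trans ?_, al.2.2⟩, el⟩
      exact Measure.absolutelyContinuous_of_le
        (Measure.restrict_mono (hΔ ▸ subset_union_left) le_rfl)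
    · refine ⟨⟨ar.1, ar.2.1.trans ?_, ar.2.2⟩, er⟩
      exact Measure.absolutelyContinuous_of_le
        (Measure.restrict_mono (hΔ ▸ subset_union_right) le_rfl)

/-! ### Parametrised `C²` functions -/

theorem deriv_slice {G : ℝ → ℝ → ℝ} (hG : Differentiable ℝ fun z : ℝ × ℝ => G z.1 z.2) (e x : ℝ) :
    deriv (G e) x = fderiv ℝ (fun z : ℝ × ℝ => G z.1 z.2) (e, x) (0, 1) := by
  have h1 : HasFDerivAt (fun z : ℝ × ℝ => G z.1 z.2)
    (fderiv ℝ (fun z : ℝ × ℝ => G z.1 z.2) (e, x)) (e, x) := (hG (e, x)).hasFDerivAt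
  have h2 : HasDerivAt (fun t : ℝ => (e, t)) ((0 : ℝ), (1 : ℝ)) x :=
    (hasDerivAt_const x e).prodMk (hasDerivAt_id x)
  exact (h1.comp_hasDerivAt x h2).deriv

theorem contDiff_deriv_slice {G : ℝ → ℝ → ℝ} {m n : WithTop ℕ∞}
    (hG : ContDiff ℝ n fun z : ℝ × ℝ => G z.1 z.2) (hmn : m + 1 ≤ n) :
    ContDiff ℝ m fun z : ℝ × ℝ => deriv (G z.1) z.2 := by
  have h0 : n ≠ 0 := by
    rintro rfl
    simp at hmn
  have h1 : (fun z : ℝ × ℝ => deriv (G z.1) z.2) =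
      fun z => fderiv ℝ (fun z : ℝ × ℝ => G z.1 z.2) z (0, 1) := by
    funext z
    exact deriv_slice (hG.differentiable h0) z.1 z.2
  rw [h1]
  exact (hG.fderiv_right hmn).clm_apply contDiff_const

theorem contDiff_slice {G : ℝ → ℝ → ℝ} {n : WithTop ℕ∞}
    (hG : ContDiff ℝ n fun z : ℝ × ℝ => G z.1 z.2) (e : ℝ) : ContDiff ℝ n (G e) :=
  hG.comp (contDiff_const.prodMk contDiff_id)

theorem tendstoUniformlyOn_slice {G : ℝ → ℝ → ℝ} (hG : Continuous fun z : ℝ × ℝ => G z.1 z.2)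
    (e : ℝ) (a b : ℝ) : TendstoUniformlyOn G (G e) (𝓝 e) (Icc a b) := by
  have h1 : UniformContinuousOn (fun z : ℝ × ℝ => G z.1 z.2) (Icc (e - 1) (e + 1) ×ˢ Icc a b) :=
    (isCompact_Icc.prod isCompact_Icc).uniformContinuousOn_of_continuous hG.continuousOn
  have h2 : (e : ℝ) ∈ Icc (e - 1) (e + 1) := ⟨by linarith, by linarith⟩
  have h3 := UniformContinuousOn.tendstoUniformlyOn (F := G) h1 h2
  rwa [nhdsWithin_eq_nhds.2 (Icc_mem_nhds (by linarith) (by linarith))] at h3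

/-- The derivatives in x up to order two are jointly continuous in (ε, x), hence uniformly
continuous on compact rectangles. -/
theorem tendstoUniformlyOn_iteratedDeriv {G : ℝ → ℝ → ℝ}
    (hG : ContDiff ℝ 2 fun z : ℝ × ℝ => G z.1 z.2) {k : ℕ} (hk : k ≤ 2) (a b : ℝ) :
    TendstoUniformlyOn (fun ε => iteratedDeriv k (G ε)) (iteratedDeriv k (G 0)) (𝓝 0)
      (Icc a b) := by
  have h1 : ContDiff ℝ 1 fun z : ℝ × ℝ => deriv (G z.1) z.2 := contDiff_deriv_slice hG (by norm_num)
  have h2 : ContDiff ℝ 0 fun z : ℝ × ℝ => deriv (deriv (G z.1)) z.2 :=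
    contDiff_deriv_slice (G := fun e => deriv (G e)) h1 (by norm_num)
  interval_cases k
  · simpa only [iteratedDeriv_zero] using tendstoUniformlyOn_slice hG.continuous 0 a b
  · simpa only [iteratedDeriv_one] using
      tendstoUniformlyOn_slice (G := fun e => deriv (G e)) h1.continuous 0 a b
  · simpa only [iteratedDeriv_succ, iteratedDeriv_zero] using
      tendstoUniformlyOn_slice (G := fun e => deriv (deriv (G e))) h2.continuous 0 a b

/-- Implicit function theorem for a `C²` function of two real variables. -/
theorem exists_implicit {G : ℝ → ℝ → ℝ} (hG : ContDiff ℝ 2 fun z : ℝ × ℝ => G z.1 z.2) {e x : ℝ}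
    (hd : deriv (G e) x ≠ 0) : ∃ ψ : ℝ → ℝ, ContDiffAt ℝ 2 ψ e ∧ ψ e = x ∧
      (∀ᶠ t in 𝓝 e, G t (ψ t) = G e x) ∧
      ∀ᶠ v : ℝ × ℝ in 𝓝 (e, x), G v.1 v.2 = G e x → ψ v.1 = v.2 := by
  have hc : ContDiffAt ℝ 2 (fun z : ℝ × ℝ => G z.1 z.2) (e, x) := hG.contDiffAt
  have h2 : (2 : WithTop ℕ∞) ≠ 0 := by norm_num
  have hi : (fderiv ℝ (fun z : ℝ × ℝ => G z.1 z.2) (e, x) ∘L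
      ContinuousLinearMap.inr ℝ ℝ ℝ).IsInvertible := by
    refine ⟨ContinuousLinearEquiv.unitsEquivAut ℝ (Units.mk0 _ hd), ?_⟩
    refine ContinuousLinearMap.ext_ring ?_
    simp [deriv_slice (hG.differentiable h2)]
  refine ⟨hc.implicitFunction h2 hi, hc.contDiffAt_implicitFunction h2 hi,
    hc.implicitFunction_apply_self h2 hi, hc.eventually_apply_implicitFunction h2 hi, ?_⟩
  filter_upwards [hc.eventually_apply_eq_iff_implicitFunction h2 hi] with v hv hv'
  exact hv.1 hv'

theorem contDiffOn_of_implicit {G : ℝ → ℝ → ℝ} (hG : ContDiff ℝ 2 fun z : ℝ × ℝ => G z.1 z.2)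
    {c : ℝ → ℝ} {S : Set ℝ} (hc : ContinuousOn c S) {v : ℝ} (hv : ∀ e ∈ S, G e (c e) = v)
    (hd : ∀ e ∈ S, deriv (G e) (c e) ≠ 0) : ContDiffOn ℝ 2 c S := by
  intro e he
  obtain ⟨ψ, h1, h2, -, h4⟩ := exists_implicit hG (hd e he)
  refine h1.contDiffWithinAt.congr_of_eventuallyEq ?_ h2.symm
  have h5 : Tendsto (fun t => (t, c t)) (𝓝[S] e) (𝓝 (e, c e)) :=
    (continuousWithinAt_id.prodMk (hc e he))
  filter_upwards [h5.eventually h4, self_mem_nhdsWithin] with t ht htS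
  exact (ht (by rw [hv t htS, hv e he])).symm

/-- A variant for roots not known to depend continuously on the parameter: uniqueness of the root
near `c e`, for all parameters in S, identifies `c` with the implicit function. -/
theorem contDiffOn_of_implicit_unique {G : ℝ → ℝ → ℝ}
    (hG : ContDiff ℝ 2 fun z : ℝ × ℝ => G z.1 z.2) {c : ℝ → ℝ} {S : Set ℝ} {v : ℝ}
    (hv : ∀ e ∈ S, G e (c e) = v) (hd : ∀ e ∈ S, deriv (G e) (c e) ≠ 0)
    (hu : ∀ e ∈ S, ∀ᶠ x in 𝓝 (c e), ∀ t ∈ S, G t x = v → x = c t) : ContDiffOn ℝ 2 c S := by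
  intro e he
  obtain ⟨ψ, h1, h2, h3, -⟩ := exists_implicit hG (hd e he)
  refine h1.contDiffWithinAt.congr_of_eventuallyEq ?_ h2.symm
  have h5 : Tendsto ψ (𝓝 e) (𝓝 (c e)) := h2 ▸ h1.continuousAt
  filter_upwards [(h5.eventually (hu e he)).filter_mono nhdsWithin_le_nhds,
    h3.filter_mono nhdsWithin_le_nhds, self_mem_nhdsWithin] with t ht ht' htS
  exact (ht t htS (by rw [ht', hv e he])).symm

/-! ### Gluing -/

theorem hasDerivAt_glue {u v u' v' : ℝ → ℝ} {a : ℝ} (hu : ∀ x, HasDerivAt u (u' x) x)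
    (hv : ∀ x, HasDerivAt v (v' x) x) (h0 : u a = v a) (h1 : u' a = v' a) (x : ℝ) :
    HasDerivAt (fun x => if x ≤ a then u x else v x) (if x ≤ a then u' x else v' x) x := by
  rcases lt_trichotomy x a with h | rfl | h
  · rw [if_pos h.le]
    refine (hu x).congr_of_eventuallyEq ?_
    filter_upwards [Iio_mem_nhds h] with y hy
    rw [if_pos (le_of_lt hy)]
  · rw [if_pos le_rfl]
    have hl : HasDerivWithinAt (fun y => if y ≤ x then u y else v y) (u' x) (Iic x) x :=
      (hu x).hasDerivWithinAt.congr (fun y hy => if_pos hy) (if_pos le_rfl)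
    have hr : HasDerivWithinAt (fun y => if y ≤ x then u y else v y) (u' x) (Ici x) x := by
      rw [h1]
      refine (hv x).hasDerivWithinAt.congr (fun y hy => ?_) (by rw [if_pos le_rfl, h0])
      rcases (mem_Ici.1 hy).eq_or_lt with rfl | hy
      · rw [if_pos le_rfl, h0]
      · rw [if_neg (not_le.2 hy)]
    have := hl.union hr
    rwa [Iic_union_Ici, hasDerivWithinAt_univ] at this
  · rw [if_neg (not_le.2 h)]
    refine (hv x).congr_of_eventuallyEq ?_
    filter_upwards [Ioi_mem_nhds h] with y hy
    rw [if_neg (not_le.2 hy)]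

/-- Two `C²` functions with the same 2-jet at `a` can be glued at `a`. -/
theorem glue_contDiff {u v : ℝ → ℝ} {a : ℝ} (hu : ContDiff ℝ 2 u) (hv : ContDiff ℝ 2 v)
    (h0 : u a = v a) (h1 : deriv u a = deriv v a) (h2 : deriv (deriv u) a = deriv (deriv v) a) :
    ContDiff ℝ 2 (fun x => if x ≤ a then u x else v x) ∧
    ∀ k ≤ 2, iteratedDeriv k (fun x => if x ≤ a then u x else v x) =
      fun x => if x ≤ a then iteratedDeriv k u x else iteratedDeriv k v x := by
  have d1 : ∀ {w : ℝ → ℝ}, ContDiff ℝ 2 w → ∀ x, HasDerivAt w (deriv w x) x := fun hw x =>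
    (hw.differentiable (by norm_num) x).hasDerivAt
  have c1 : ∀ {w : ℝ → ℝ}, ContDiff ℝ 2 w → ContDiff ℝ 1 (deriv w) := fun {w} hw =>
    ((contDiff_succ_iff_deriv (n := 1) (f := w)).1 hw).2.2
  have d2 : ∀ {w : ℝ → ℝ}, ContDiff ℝ 2 w → ∀ x, HasDerivAt (deriv w) (deriv (deriv w) x) x :=
    fun hw x => ((c1 hw).differentiable (by norm_num) x).hasDerivAt
  have c2 : ∀ {w : ℝ → ℝ}, ContDiff ℝ 2 w → Continuous (deriv (deriv w)) := fun {w} hw =>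
    (c1 hw).continuous_deriv le_rfl
  have g1 := hasDerivAt_glue (d1 hu) (d1 hv) h0 h1
  have g2 := hasDerivAt_glue (d2 hu) (d2 hv) h1 h2
  have e1 : deriv (fun x => if x ≤ a then u x else v x) =
      fun x => if x ≤ a then deriv u x else deriv v x := funext fun x => (g1 x).deriv
  have e2 : deriv (fun x => if x ≤ a then deriv u x else deriv v x) =
      fun x => if x ≤ a then deriv (deriv u) x else deriv (deriv v) x := funext fun x => (g2 x).deriv
  have hcont : Continuous fun x => if x ≤ a then deriv (deriv u) x else deriv (deriv v) x := by
    refine Continuous.if_le (c2 hu) (c2 hv) continuous_id continuous_const ?_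
    rintro x rfl
    exact h2
  refine ⟨?_, ?_⟩
  · refine (contDiff_succ_iff_deriv (n := 1)).2 ⟨fun x => (g1 x).differentiableAt, by simp, ?_⟩
    rw [e1]
    refine contDiff_one_iff_deriv.2 ⟨fun x => (g2 x).differentiableAt, ?_⟩
    rwa [e2]
  · intro k hk
    interval_cases k
    · simp only [iteratedDeriv_zero]
    · simp only [iteratedDeriv_one, e1]
    · simp only [iteratedDeriv_succ, iteratedDeriv_zero, e1, e2]

/-! ### A globally smooth version of the neutral branch -/

/-- A smooth positive function that is the identity on `[κ, ∞)`. -/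
noncomputable def flooredId (κ x : ℝ) : ℝ :=
  κ / 2 + (x - κ / 2) * Real.smoothTransition ((x - κ / 2) / (κ / 2))

theorem flooredId_eq {κ x : ℝ} (hκ : 0 < κ) (hx : κ ≤ x) : flooredId κ x = x := by
  rw [flooredId, Real.smoothTransition.one_of_one_le]
  · ring
  · rw [le_div_iff₀ (by linarith)]; linarith

theorem flooredId_pos {κ : ℝ} (hκ : 0 < κ) (x : ℝ) : 0 < flooredId κ x := by
  rcases le_total x (κ / 2) with h | h
  · rw [flooredId, Real.smoothTransition.zero_of_nonpos]
    · linarith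
    · exact div_nonpos_of_nonpos_of_nonneg (by linarith) (by linarith)
  · have h1 : 0 ≤ (x - κ / 2) * Real.smoothTransition ((x - κ / 2) / (κ / 2)) :=
      mul_nonneg (by linarith) (Real.smoothTransition.nonneg _)
    rw [flooredId]
    linarith

theorem contDiff_flooredId (κ : ℝ) : ContDiff ℝ 2 (flooredId κ) := by
  unfold flooredId
  have h : ContDiff ℝ 2 Real.smoothTransition := Real.smoothTransition.contDiff (n := 2)
  exact contDiff_const.add ((contDiff_id.sub contDiff_const).mul
    (h.comp ((contDiff_id.sub contDiff_const).div_const _)))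

/-- The iterates of the neutral branch, modified to the left of `κ`. -/
noncomputable def smoothIter (α κ : ℝ) : ℕ → ℝ → ℝ → ℝ
  | 0, _, x => x
  | n + 1, ε, x =>
    smoothIter α κ n ε x + neutralCoeff α ε * flooredId κ (smoothIter α κ n ε x) ^ (1 + α)

/-- The base of the power never vanishes after the modification; the original x ^ (1 + α) with 0 < α
< 1 is not C² at 0. -/
theorem contDiff_smoothIter {α κ : ℝ} (hκ : 0 < κ) (n : ℕ) {f : ℝ × ℝ → ℝ} (hf : ContDiff ℝ 2 f) :
    ContDiff ℝ 2 fun z : ℝ × ℝ => smoothIter α κ n z.1 (f z) := by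
  induction n with
  | zero => exact hf
  | succ n ih =>
    refine ih.add (ContDiff.mul ?_ ?_)
    · unfold neutralCoeff
      fun_prop
    · exact ((contDiff_flooredId κ).comp ih).rpow_const_of_ne fun z => (flooredId_pos hκ _).ne'

/-- Neutral steps move points to the right, so an orbit that starts at or above κ never meets the
modified region. -/
theorem smoothIter_eq {α κ ε : ℝ} (hκ : 0 < κ) (hε : 0 ≤ ε) (n : ℕ) {x : ℝ} (hx : κ ≤ x) :
    smoothIter α κ n ε x = (neutral α (neutralCoeff α ε))^[n] x ∧
      κ ≤ (neutral α (neutralCoeff α ε))^[n] x := by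
  induction n with
  | zero => exact ⟨rfl, hx⟩
  | succ n ih =>
    rw [Function.iterate_succ_apply']
    refine ⟨?_, ih.2.trans (neutral_gt (neutralCoeff_pos hε) (hκ.trans_le ih.2)).le⟩
    rw [smoothIter, ih.1, flooredId_eq hκ ih.2, neutral]

/-! ### Smooth dependence of the left branch points on the parameter. -/

section endpoints

variable {α : ℝ}

/-- A lower bound for the `n`-th point of the backward orbit, uniform in `ε ≤ 1/4`. -/
noncomputable def zlow (α : ℝ) (n : ℕ) : ℝ := backOrbit α (neutralCoeff α (1 / 4)) (n + 1)

theorem zlow_pos (hα : 0 < α) (n : ℕ) : 0 < zlow α n :=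
  backOrbit_pos hα (neutralCoeff_pos (by norm_num)) _

theorem zlow_le (hα : 0 < α) {ε : ℝ} (hε : 0 ≤ ε) (hε1 : ε ≤ 1 / 4) (n : ℕ) :
    zlow α n ≤ zpt α ε (n + 1) :=
  backOrbit_anti_coeff hα (neutralCoeff_pos hε) (neutralCoeff_mono hε1) n

theorem hasDerivAt_smoothIter {κ ε : ℝ} (hκ : 0 < κ) (hε : 0 ≤ ε) (n : ℕ) {x : ℝ}
    (hκ' : κ < x) :
    HasDerivAt (smoothIter α κ n ε) (neutralD1 α (neutralCoeff α ε) n x) x := by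
  refine (hasDerivAt_iterate_neutral (neutralCoeff_pos hε).le n (hκ.trans hκ')).congr_of_eventuallyEq ?_
  filter_upwards [Ioi_mem_nhds hκ'] with y hy
  exact (smoothIter_eq hκ hε n (le_of_lt hy)).1

theorem iterate_neutral_zpt (hα : 0 < α) {ε : ℝ} (hε : 0 ≤ ε) (n : ℕ) :
    (neutral α (neutralCoeff α ε))^[n] (zpt α ε (n + 1)) = 1 / 4 := by
  rw [← zpt_one hα hε]
  induction n with
  | zero => rfl
  | succ n ih =>
    rw [Function.iterate_succ_apply]
    exact (congrArg _ (neutral_backOrbit_succ hα (neutralCoeff_pos hε) (n + 1))).trans ih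

/-- For index n + 1 the point is the unique positive root of "n-th neutral iterate = 1/4", an
equation whose derivative in x is at least 1 there. -/
theorem contDiffOn_zpt (hα : 0 < α) {ε₀ : ℝ} (hε₀ : ε₀ ≤ 1 / 4) (n : ℕ) :
    ContDiffOn ℝ 2 (fun ε => zpt α ε n) (Ico 0 ε₀) := by
  cases n with
  | zero =>
    simp only [zpt_zero]
    fun_prop
  | succ n =>
    -- Halving puts the root strictly above the threshold for every ε, so the smoothed iterate
    -- agrees with the true one in a neighbourhood and can be differentiated.
    have hκ : 0 < zlow α n / 2 := half_pos (zlow_pos hα n)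
    have hlt : ∀ e ∈ Ico 0 ε₀, zlow α n / 2 < zpt α e (n + 1) := fun e he =>
      (half_lt_self (zlow_pos hα n)).trans_le (zlow_le hα he.1 (he.2.le.trans hε₀) n)
    refine contDiffOn_of_implicit_unique (G := smoothIter α (zlow α n / 2) n) (v := 1 / 4)
      (contDiff_smoothIter hκ n contDiff_snd) ?_ ?_ ?_
    · intro e he
      rw [(smoothIter_eq hκ he.1 n (hlt e he).le).1, iterate_neutral_zpt hα he.1]
    · intro e he
      rw [(hasDerivAt_smoothIter hκ he.1 n (hlt e he)).deriv]
      exact (zero_lt_one.trans_le (one_le_neutralD1 hα (neutralCoeff_pos he.1).le n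
        (zpt_pos hα he.1 _))).ne'
    · intro e he
      filter_upwards [Ioi_mem_nhds (hlt e he)] with x hx t ht hxt
      have hx' : zlow α n / 2 < x := hx
      rw [(smoothIter_eq hκ ht.1 n hx'.le).1, ← iterate_neutral_zpt hα ht.1 n] at hxt
      exact (iterate_neutral_strictMonoOn hα (neutralCoeff_pos ht.1).le n).injOn
        (hκ.trans hx').le (zpt_pos hα ht.1 _).le hxt

theorem contDiffOn_apt (hα : 0 < α) {ε₀ : ℝ} (hε₀ : ε₀ ≤ 1 / 4) (n : ℕ) :
    ContDiffOn ℝ 2 (fun ε => apt α ε n) (Ico 0 ε₀) := by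
  unfold apt
  refine ContDiffOn.div (ContDiffOn.sub (by fun_prop) (contDiffOn_zpt hα hε₀ n)) (by fun_prop) ?_
  intro e he
  have := he.1
  positivity

theorem contDiffOn_bpt (hα : 0 < α) {ε₀ : ℝ} (hε₀ : ε₀ ≤ 1 / 4) (n : ℕ) :
    ContDiffOn ℝ 2 (fun ε => bpt α ε n) (Ico 0 ε₀) := by
  unfold bpt
  exact ((contDiffOn_zpt hα hε₀ n).add contDiffOn_const).div_const _

theorem contDiffOn_bptTop (hα : 0 < α) {ε₀ : ℝ} (hε₀ : ε₀ ≤ 1 / 4) (n : ℕ) :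
    ContDiffOn ℝ 2 (fun ε => bptTop α ε n) (Ico 0 ε₀) := by
  cases n with
  | zero => exact contDiffOn_const
  | succ n => exact contDiffOn_bpt hα hε₀ (n + 1)

end endpoints

/-! ### Smoothly varying partitions -/

/-- A branch of `F ε` on `(l ε, r ε)` with a `C²` extension `B ε`, all depending smoothly on `ε`. -/
structure IsSmoothBranch (F : ℝ → ℝ → ℝ) (ε₀ : ℝ) (l r : ℝ → ℝ) (B : ℝ → ℝ → ℝ) : Prop where
  left_smooth : ContDiffOn ℝ 2 l (Ico 0 ε₀)
  right_smooth : ContDiffOn ℝ 2 r (Ico 0 ε₀)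
  contDiff : ∀ ε ∈ Ico 0 ε₀, ContDiff ℝ 2 (B ε)
  eqOn : ∀ ε ∈ Ico 0 ε₀, EqOn (B ε) (F ε) (Ioo (l ε) (r ε))
  tendsto : ∀ k ≤ 2, ∀ a b, TendstoUniformlyOn (fun ε => iteratedDeriv k (B ε))
    (iteratedDeriv k (B 0)) (𝓝[>] 0) (Icc a b)

theorem IsSmoothBranch.of_contDiff {F : ℝ → ℝ → ℝ} {ε₀ : ℝ} {l r : ℝ → ℝ} {B : ℝ → ℝ → ℝ}
    (hl : ContDiffOn ℝ 2 l (Ico 0 ε₀)) (hr : ContDiffOn ℝ 2 r (Ico 0 ε₀))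
    (hB : ContDiff ℝ 2 fun z : ℝ × ℝ => B z.1 z.2)
    (h : ∀ ε ∈ Ico 0 ε₀, EqOn (B ε) (F ε) (Ioo (l ε) (r ε))) : IsSmoothBranch F ε₀ l r B where
  left_smooth := hl
  right_smooth := hr
  contDiff ε _ := contDiff_slice hB ε
  eqOn := h
  tendsto _ hk a b := fun U hU =>
    (tendstoUniformlyOn_iteratedDeriv hB hk a b U hU).filter_mono nhdsWithin_le_nhds

/-- A family of partitions into smoothly varying, uniformly expanding branches. -/
structure IsSmoothPartition {ι : Type} (F : ℝ → ℝ → ℝ) (ε₀ : ℝ) (Δ : Set ℝ) (l r : ℝ → ι → ℝ)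
    (B : ℝ → ι → ℝ → ℝ) : Prop where
  branch : ∀ i, IsSmoothBranch F ε₀ (fun ε => l ε i) (fun ε => r ε i) (fun ε => B ε i)
  lt : ∀ ε ∈ Ico 0 ε₀, ∀ i, l ε i < r ε i
  subset : ∀ ε ∈ Ico 0 ε₀, ∀ i, Icc (l ε i) (r ε i) ⊆ Δ
  disjoint : ∀ ε ∈ Ico 0 ε₀, ∀ i j, i ≠ j → Disjoint (Ioo (l ε i) (r ε i)) (Ioo (l ε j) (r ε j))
  countable : ∀ ε ∈ Ico 0 ε₀, (Δ \ ⋃ i, Ioo (l ε i) (r ε i)).Countable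
  finite : ∀ ε ∈ Ico 0 ε₀, (range fun i => F ε '' Ioo (l ε i) (r ε i)).Finite
  expand : ∃ D lam : ℝ, 0 < D ∧ 2 < lam ∧ ∀ i, ∀ x ∈ Ioo (l 0 i) (r 0 i),
    lam ≤ |deriv (B 0 i) x| ∧ |deriv (deriv (B 0 i)) x| ≤ D * deriv (B 0 i) x ^ 2

theorem eqOn_deriv_of_isOpen {u v : ℝ → ℝ} {I : Set ℝ} (hI : IsOpen I) (h : EqOn u v I) :
    EqOn (deriv u) (deriv v) I := fun _ hx =>
  (h.eventuallyEq_of_mem (hI.mem_nhds hx)).deriv_eq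

namespace IsSmoothPartition

variable {ι κ : Type} {F : ℝ → ℝ → ℝ} {ε₀ : ℝ} {Δ : Set ℝ} {l r : ℝ → ι → ℝ} {B : ℝ → ι → ℝ → ℝ}

theorem reindex (h : IsSmoothPartition F ε₀ Δ l r B) (e : κ ≃ ι) :
    IsSmoothPartition F ε₀ Δ (fun ε k => l ε (e k)) (fun ε k => r ε (e k))
      (fun ε k => B ε (e k)) where
  branch k := h.branch (e k)
  lt ε hε k := h.lt ε hε (e k)
  subset ε hε k := h.subset ε hε (e k)
  disjoint ε hε i j hij := h.disjoint ε hε _ _ (e.injective.ne hij)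
  countable ε hε := by
    rw [e.surjective.iUnion_comp (fun i => Ioo (l ε i) (r ε i))]
    exact h.countable ε hε
  finite ε hε := (h.finite ε hε).subset (by rintro _ ⟨k, rfl⟩; exact ⟨e k, rfl⟩)
  expand := by
    obtain ⟨D, lam, h1, h2, h3⟩ := h.expand
    exact ⟨D, lam, h1, h2, fun k => h3 (e k)⟩

theorem ordConnected_image (h : IsSmoothPartition F ε₀ Δ l r B) {ε : ℝ} (hε : ε ∈ Ico 0 ε₀)
    (i : ι) : (F ε '' Ioo (l ε i) (r ε i)).OrdConnected := by
  rw [← ((h.branch i).eqOn ε hε).image_eq]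
  exact (isPreconnected_Ioo.image _ ((h.branch i).contDiff ε hε).continuous.continuousOn).ordConnected

/-- Merging two adjacent branches with the same 2-jets at the common end point. -/
theorem merge (h : IsSmoothPartition F ε₀ Δ l r B) (h0 : 0 < ε₀) {a b : ι} (hab : a ≠ b) {t : ℝ}
    (hra : ∀ ε, r ε a = t) (hlb : ∀ ε ∈ Ico 0 ε₀, l ε b = t)
    (hF : ∀ ε ∈ Ico 0 ε₀, F ε t = B ε a t)
    (hj0 : ∀ ε ∈ Ico 0 ε₀, B ε a t = B ε b t)
    (hj1 : ∀ ε ∈ Ico 0 ε₀, deriv (B ε a) t = deriv (B ε b) t)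
    (hj2 : ∀ ε ∈ Ico 0 ε₀, deriv (deriv (B ε a)) t = deriv (deriv (B ε b)) t) :
    ∃ (l' r' : ℝ → {i // i ≠ a} → ℝ) (B' : ℝ → {i // i ≠ a} → ℝ → ℝ),
      IsSmoothPartition F ε₀ Δ l' r' B' ∧
      (∀ ε ∈ Ico 0 ε₀, (⋃ i, Ioo (l ε i) (r ε i)) ⊆ ⋃ i, Ioo (l' ε i) (r' ε i)) ∧
      ∀ ε ∈ Ico 0 ε₀, t ∈ ⋃ i, Ioo (l' ε i) (r' ε i) := by
  classical
  -- The merged branch keeps the index `b` and takes over the left end point of `a`; the index `a`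
  -- is dropped.
  let l' : ℝ → {i // i ≠ a} → ℝ := fun ε i => if i.1 = b then l ε a else l ε i.1
  let r' : ℝ → {i // i ≠ a} → ℝ := fun ε i => r ε i.1
  let B' : ℝ → {i // i ≠ a} → ℝ → ℝ := fun ε i x =>
    if i.1 = b then (if x ≤ t then B ε a x else B ε b x) else B ε i.1 x
  have hlb' : ∀ {i : {i // i ≠ a}}, i.1 = b → ∀ ε, l' ε i = l ε a := fun hi ε => if_pos hi
  have hln : ∀ {i : {i // i ≠ a}}, i.1 ≠ b → ∀ ε, l' ε i = l ε i.1 := fun hi ε => if_neg hi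
  have hBb : ∀ {i : {i // i ≠ a}}, i.1 = b → ∀ ε,
      B' ε i = fun x => if x ≤ t then B ε a x else B ε b x := fun hi ε => by
    funext x; exact if_pos hi
  have hBn : ∀ {i : {i // i ≠ a}}, i.1 ≠ b → ∀ ε, B' ε i = B ε i.1 := fun hi ε => by
    funext x; exact if_neg hi
  have hlt : ∀ ε ∈ Ico 0 ε₀, l ε a < t ∧ t < r ε b := fun ε hε =>
    ⟨hra ε ▸ h.lt ε hε a, hlb ε hε ▸ h.lt ε hε b⟩
  have hsplit : ∀ ε ∈ Ico 0 ε₀, ∀ x ∈ Ioo (l ε a) (r ε b),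
      x ∈ Ioo (l ε a) (r ε a) ∨ x = t ∨ x ∈ Ioo (l ε b) (r ε b) := by
    intro ε hε x hx
    rw [hra, hlb ε hε]
    rcases lt_trichotomy x t with hxt | hxt | hxt
    · exact Or.inl ⟨hx.1, hxt⟩
    · exact Or.inr (Or.inl hxt)
    · exact Or.inr (Or.inr ⟨hxt, hx.2⟩)
  have hglue : ∀ ε ∈ Ico 0 ε₀, _ := fun ε hε =>
    glue_contDiff ((h.branch a).contDiff ε hε) ((h.branch b).contDiff ε hε) (hj0 ε hε) (hj1 ε hε)
      (hj2 ε hε)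
  have hz : (0 : ℝ) ∈ Ico 0 ε₀ := ⟨le_rfl, h0⟩
  -- An open interval containing `t` would meet the branch `a` just to the left of `t`.
  have ht_notMem : ∀ ε ∈ Ico 0 ε₀, ∀ i, i ≠ a → i ≠ b → t ∉ Ioo (l ε i) (r ε i) := by
    intro ε hε i hia hib hti
    have h1 : Ioo (max (l ε i) (l ε a)) t ⊆ Ioo (l ε i) (r ε i) ∩ Ioo (l ε a) (r ε a) := by
      intro x hx
      rw [hra]
      exact ⟨⟨(le_max_left _ _).trans_lt hx.1, hx.2.trans hti.2⟩,
        ⟨(le_max_right _ _).trans_lt hx.1, hx.2⟩⟩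
    obtain ⟨x, hx⟩ := nonempty_Ioo.2 (max_lt hti.1 (hlt ε hε).1)
    exact Set.disjoint_left.1 (h.disjoint ε hε i a hia) (h1 hx).1 (h1 hx).2
  have hdisj : ∀ ε ∈ Ico 0 ε₀, ∀ i : {i // i ≠ a}, i.1 ≠ b →
      Disjoint (Ioo (l ε a) (r ε b)) (Ioo (l ε i.1) (r ε i.1)) := by
    intro ε hε i hib
    refine Set.disjoint_left.2 fun x hx hxi => ?_
    rcases hsplit ε hε x hx with hx | rfl | hx
    · exact Set.disjoint_left.1 (h.disjoint ε hε a i.1 i.2.symm) hx hxi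
    · exact ht_notMem ε hε i.1 i.2 hib hxi
    · exact Set.disjoint_left.1 (h.disjoint ε hε b i.1 (Ne.symm hib)) hx hxi
  have hcover : ∀ ε ∈ Ico 0 ε₀, (⋃ i, Ioo (l ε i) (r ε i)) ⊆ ⋃ i, Ioo (l' ε i) (r' ε i) := by
    intro ε hε x hx
    obtain ⟨i, hi⟩ := mem_iUnion.1 hx
    by_cases hib : i = a ∨ i = b
    · refine mem_iUnion.2 ⟨⟨b, hab.symm⟩, ?_⟩
      rw [hlb' rfl]
      rcases hib with rfl | rfl
      · exact ⟨hi.1, (hra ε ▸ hi.2).trans (hlt ε hε).2⟩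
      · exact ⟨(hlt ε hε).1.trans (hlb ε hε ▸ hi.1), hi.2⟩
    · push Not at hib
      refine mem_iUnion.2 ⟨⟨i, hib.1⟩, ?_⟩
      rw [hln hib.2]
      exact hi
  refine ⟨l', r', B', ⟨fun i => ?_, fun ε hε i => ?_, fun ε hε i => ?_, fun ε hε i j hij => ?_,
    fun ε hε => ?_, fun ε hε => ?_, ?_⟩, hcover, fun ε hε => ?_⟩
  · by_cases hib : i.1 = b
    · simp only [hlb' hib, hBb hib]
      refine ⟨(h.branch a).left_smooth, ?_, fun ε hε => (hglue ε hε).1, fun ε hε => ?_,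
        fun k hk p q => ?_⟩
      · exact (h.branch i.1).right_smooth
      · have hr : r' ε i = r ε b := by simp only [r', hib]
        rw [hr]
        intro x hx
        rcases hsplit ε hε x hx with hx | rfl | hx
        · have := (h.branch a).eqOn ε hε hx
          simp only
          rw [if_pos (hra ε ▸ hx.2.le)]; exact this
        · simp only
          rw [if_pos le_rfl, hF ε hε]
        · have := (h.branch b).eqOn ε hε hx
          simp only
          rw [if_neg (not_le.2 (hlb ε hε ▸ hx.1))]; exact this
      · rw [Metric.tendstoUniformlyOn_iff]
        intro η hη
        have ha := Metric.tendstoUniformlyOn_iff.1 ((h.branch a).tendsto k hk p q) η hη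
        have hb := Metric.tendstoUniformlyOn_iff.1 ((h.branch b).tendsto k hk p q) η hη
        have hs : ∀ᶠ ε in 𝓝[>] (0 : ℝ), ε ∈ Ico 0 ε₀ := by
          filter_upwards [Ioo_mem_nhdsGT h0] with ε hε using ⟨hε.1.le, hε.2⟩
        filter_upwards [ha, hb, hs] with ε ha hb hε x hx
        rw [(hglue ε hε).2 k hk, (hglue 0 hz).2 k hk]
        simp only
        split_ifs
        · exact ha x hx
        · exact hb x hx
    · simp only [hln hib, hBn hib]
      exact h.branch i.1
  · by_cases hib : i.1 = b
    · rw [hlb' hib]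
      simp only [r', hib]
      exact (hlt ε hε).1.trans (hlt ε hε).2
    · rw [hln hib]
      exact h.lt ε hε i.1
  · by_cases hib : i.1 = b
    · rw [hlb' hib]
      simp only [r', hib]
      intro x hx
      rcases le_total x t with hxt | hxt
      · exact h.subset ε hε a ⟨hx.1, hra ε ▸ hxt⟩
      · exact h.subset ε hε b ⟨hlb ε hε ▸ hxt, hx.2⟩
    · rw [hln hib]
      exact h.subset ε hε i.1
  · have hij' : i.1 ≠ j.1 := fun hh => hij (Subtype.ext hh)
    by_cases hib : i.1 = b
    · have hjb : j.1 ≠ b := fun hh => hij' (hib.trans hh.symm)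
      rw [hlb' hib, hln hjb]
      simp only [r', hib]
      exact hdisj ε hε j hjb
    · by_cases hjb : j.1 = b
      · rw [hlb' hjb, hln hib]
        simp only [r', hjb]
        exact (hdisj ε hε i hib).symm
      · rw [hln hib, hln hjb]
        exact h.disjoint ε hε _ _ hij'
  · exact (h.countable ε hε).mono (sdiff_subset_sdiff_right (hcover ε hε))
  · refine ((h.finite ε hε).insert (F ε '' Ioo (l ε a) (r ε b))).subset ?_
    rintro _ ⟨i, rfl⟩
    by_cases hib : i.1 = b
    · left
      simp only [hlb' hib, r', hib]
    · right
      simp only [hln hib]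
      exact ⟨i.1, rfl⟩
  · obtain ⟨D, lam, hD, hlam, hexp⟩ := h.expand
    refine ⟨D, lam, hD, hlam, fun i x hx => ?_⟩
    by_cases hib : i.1 = b
    · have hd1 := (hglue 0 hz).2 1 (by norm_num)
      have hd2 := (hglue 0 hz).2 2 le_rfl
      simp only [iteratedDeriv_succ, iteratedDeriv_zero] at hd1 hd2
      rw [hBb hib, hd2, hd1]
      rw [hlb' hib] at hx
      simp only [r', hib] at hx
      simp only
      rcases hsplit 0 hz x hx with hx | rfl | hx
      · rw [if_pos (hra 0 ▸ hx.2.le), if_pos (hra 0 ▸ hx.2.le)]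
        exact hexp a x hx
      · rw [if_pos le_rfl, if_pos le_rfl]
        have hc2 := (h.branch a).contDiff 0 hz
        have hc1 : ContDiff ℝ 1 (deriv (B 0 a)) :=
          ((contDiff_succ_iff_deriv (n := 1) (f := B 0 a)).1 hc2).2.2
        have hc0 : Continuous (deriv (deriv (B 0 a))) := hc1.continuous_deriv le_rfl
        -- At the junction itself the estimates hold by continuity, as limits from the branch `a`.
        have hcl : IsClosed {x | lam ≤ |deriv (B 0 a) x| ∧
            |deriv (deriv (B 0 a)) x| ≤ D * deriv (B 0 a) x ^ 2} :=
          (isClosed_le continuous_const hc1.continuous.abs).inter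
            (isClosed_le hc0.abs (continuous_const.mul (hc1.continuous.pow 2)))
        have hsub := closure_minimal (hexp a) hcl
        rw [closure_Ioo (h.lt 0 hz a).ne] at hsub
        exact hsub ⟨hx.1.le, (hra 0).ge⟩
      · rw [if_neg (not_le.2 (hlb 0 hz ▸ hx.1)), if_neg (not_le.2 (hlb 0 hz ▸ hx.1))]
        exact hexp b x hx
    · rw [hBn hib]
      rw [hln hib] at hx
      exact hexp i.1 x hx
  · refine mem_iUnion.2 ⟨⟨b, hab.symm⟩, ?_⟩
    rw [hlb' rfl]
    exact hlt ε hε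

end IsSmoothPartition

/-! ### Two-jets from smoothness of a piecewise map -/

theorem deriv_eq_of_eqOn {F u : ℝ → ℝ} {S : Set ℝ} {t : ℝ} (hF : DifferentiableAt ℝ F t)
    (hu : DifferentiableAt ℝ u t) (h : EqOn F u S) (ht : t ∈ S) (hS : UniqueDiffWithinAt ℝ S t) :
    deriv F t = deriv u t :=
  hS.eq_deriv _ hF.hasDerivAt.hasDerivWithinAt
    (hu.hasDerivAt.hasDerivWithinAt.congr h (h ht))

/-- Derivatives at `t` are determined by the values on a one-sided neighbourhood. The argument is
applied to `F`, and then to its derivative, which agrees with that of `u` on all of `S`. -/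
theorem jet_eq_of_eqOn {F u : ℝ → ℝ} {S : Set ℝ} {t : ℝ} (hF : ContDiffAt ℝ 2 F t)
    (hu : ContDiff ℝ 2 u) (h : EqOn F u S) (ht : t ∈ S) (hS : UniqueDiffWithinAt ℝ S t)
    (hSo : S \ {t} ⊆ interior S) : F t = u t ∧ deriv F t = deriv u t ∧
      deriv (deriv F) t = deriv (deriv u) t := by
  have hF1 : ContDiffAt ℝ 1 (deriv F) t := by
    simpa using ContDiffAt.derivWithin (m := 1) hF (by norm_num)
  have hd : DifferentiableAt ℝ (deriv F) t := hF1.differentiableAt (by norm_num)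
  have hu1 : Differentiable ℝ u := hu.differentiable (by norm_num)
  have h1 : deriv F t = deriv u t :=
    deriv_eq_of_eqOn (hF.differentiableAt (by norm_num)) (hu1 t) h ht hS
  refine ⟨h ht, h1, deriv_eq_of_eqOn hd (hu.differentiable_deriv_two t) (fun x hx => ?_) ht hS⟩
  by_cases hxt : x = t
  · rw [hxt, h1]
  · exact eqOn_deriv_of_isOpen isOpen_interior (h.mono interior_subset) (hSo ⟨hx, hxt⟩)

/-! ### The partition of the induced map -/

/-- Left end points of the branches. -/
noncomputable def branchL (N : ℕ) (α : ℝ) (c : ℕ → ℝ → ℝ) (ε : ℝ) : (ℕ ⊕ ℕ) ⊕ Fin N → ℝ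
  | .inl (.inl n) => apt α ε n
  | .inl (.inr n) => bpt α ε (n + 1)
  | .inr j => c j ε

/-- Right end points of the branches. -/
noncomputable def branchR (N : ℕ) (α : ℝ) (c : ℕ → ℝ → ℝ) (ε : ℝ) : (ℕ ⊕ ℕ) ⊕ Fin N → ℝ
  | .inl (.inl n) => apt α ε (n + 1)
  | .inl (.inr n) => bptTop α ε n
  | .inr j => c (j + 1) ε

/-- Smooth extensions of the branches to the left of `1/2`. -/
noncomputable def leftExt (α ε : ℝ) : ℕ ⊕ ℕ → ℝ → ℝ
  | .inl n, x => smoothIter α (zlow α n) n ε (decBranch ε x)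
  | .inr n, x => smoothIter α (zlow α n) n ε (incBranch x)

/-- Smooth extensions of the branches. -/
noncomputable def branchExt (N : ℕ) (α : ℝ) (g : ℕ → ℝ → ℝ → ℝ) (ε : ℝ) :
    (ℕ ⊕ ℕ) ⊕ Fin N → ℝ → ℝ
  | .inl i, x => leftExt α ε i x
  | .inr j, x => g j ε x

theorem Ioo_branch (N : ℕ) (α : ℝ) (c : ℕ → ℝ → ℝ) (ε : ℝ) (i : (ℕ ⊕ ℕ) ⊕ Fin N) :
    Ioo (branchL N α c ε i) (branchR N α c ε i) =
      Sum.elim (leftI α ε) (fun j : Fin N => Ioo (c j ε) (c (j + 1) ε)) i := by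
  rcases i with (n | n) | j <;> rfl

theorem contDiff_leftExt {α : ℝ} (hα : 0 < α) (i : ℕ ⊕ ℕ) :
    ContDiff ℝ 2 fun z : ℝ × ℝ => leftExt α z.1 i z.2 := by
  rcases i with n | n
  · refine contDiff_smoothIter (f := fun z : ℝ × ℝ => decBranch z.1 z.2) (zlow_pos hα n) n ?_
    unfold decBranch
    fun_prop
  · refine contDiff_smoothIter (f := fun z : ℝ × ℝ => incBranch z.2) (zlow_pos hα n) n ?_
    unfold incBranch
    fun_prop

theorem leftExt_eqOn {α ε : ℝ} {T4 : ℝ → ℝ → ℝ} (hα : 0 < α) (hε : 0 ≤ ε) (hε1 : ε ≤ 1 / 4)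
    (i : ℕ ⊕ ℕ) : EqOn (leftExt α ε i) (inducedMap α T4 ε) (leftI α ε i) := by
  intro x hx
  rcases i with n | n
  · have hx' : x ∈ Ioo (apt α ε n) (apt α ε (n + 1)) := hx
    rw [inducedMap_dec hα hε hε1 hx']
    exact (smoothIter_eq (zlow_pos hα n) hε n
      ((zlow_le hα hε hε1 n).trans ((lt_apt_iff hε).1 hx'.2).le)).1
  · have hx' : x ∈ Ioo (bpt α ε (n + 1)) (bptTop α ε n) := hx
    rw [inducedMap_inc hα hε hε1 hx']
    exact (smoothIter_eq (zlow_pos hα n) hε n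
      ((zlow_le hα hε hε1 n).trans (bpt_lt_iff.1 hx'.1).le)).1

namespace IsRightData

variable {ε₀ : ℝ} {T4 : ℝ → ℝ → ℝ} {M p : ℕ} {s : ℝ} {c : ℕ → ℝ → ℝ} {g : ℕ → ℝ → ℝ → ℝ} {ε α : ℝ}
  {j : ℕ}

/-- A branch point where the height is fixed (1 or 1/2) is an implicit function, by the slope
condition. The spike has variable height but fixed position, and the last point is the constant 1.
-/
theorem contDiffOn_c (h : IsRightData ε₀ T4 M p s c g) (hj : j ≤ 2 * M + 1) :
    ContDiffOn ℝ 2 (c j) (Ico 0 ε₀) := by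
  have hp := h.p_le
  have h1 := h.one_le
  rcases hj.lt_or_eq with hj' | rfl
  · by_cases hjp : j = 2 * p
    · subst hjp
      exact (contDiffOn_const (c := s)).congr h.c_spike
    have hmem : ∀ e ∈ Ico 0 ε₀, c j e ∈ Icc (c j e) (c (j + 1) e) := fun e he =>
      left_mem_Icc.2 (h.c_lt e he j hj').le
    refine contDiffOn_of_implicit (v := if Even j then 1 / 2 else 1) (h.contDiff j hj')
      (h.continuousOn j hj) (fun e he => ?_) (fun e he h0 => ?_)
    · rw [← h.eqOn e he j hj' (hmem e he)]
      split_ifs with hev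
      · exact h.even e he j hj hev hjp
      · exact h.odd e he j hj (Nat.not_even_iff_odd.1 hev)
    · have := h.slope e he j hj' _ (hmem e he)
      rw [h0, abs_zero] at this
      linarith
  · exact (contDiffOn_const (c := (1 : ℝ))).congr h.c_last

theorem isSmoothPartition (h : IsRightData ε₀ T4 M p s c g) (hα : 0 < α) (hα1 : α < 1)
    (h0 : 0 < ε₀) (hε₀ : ε₀ ≤ 1 / 4) :
    IsSmoothPartition (inducedMap α T4) ε₀ indDom (branchL (2 * M + 1) α c)
      (branchR (2 * M + 1) α c) (branchExt (2 * M + 1) α g) := by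
  have he1 : ∀ ε ∈ Ico 0 ε₀, ε ≤ 1 / 4 := fun ε hε => hε.2.le.trans hε₀
  have heq : ∀ ε ∈ Ico 0 ε₀, ∀ i, EqOn (branchExt (2 * M + 1) α g ε i) (inducedMap α T4 ε)
      (Ioo (branchL (2 * M + 1) α c ε i) (branchR (2 * M + 1) α c ε i)) := by
    intro ε hε i
    rw [Ioo_branch]
    rcases i with i | j
    · exact leftExt_eqOn hα hε.1 (he1 ε hε) i
    · exact ((h.inducedMap_eqOn hε₀ hε j.2 α).mono Ioo_subset_Icc_self).symm
  refine ⟨fun i => ?_, fun ε hε i => ?_, fun ε hε i => ?_, fun ε hε i j hij => ?_,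
    fun ε hε => ?_, fun ε hε => ?_, ?_⟩
  · rcases i with (n | n) | j
    · exact .of_contDiff (contDiffOn_apt hα hε₀ n) (contDiffOn_apt hα hε₀ (n + 1))
        (contDiff_leftExt hα (.inl n)) fun ε hε => heq ε hε (.inl (.inl n))
    · exact .of_contDiff (contDiffOn_bpt hα hε₀ (n + 1)) (contDiffOn_bptTop hα hε₀ n)
        (contDiff_leftExt hα (.inr n)) fun ε hε => heq ε hε (.inl (.inr n))
    · exact .of_contDiff (h.contDiffOn_c j.2.le) (h.contDiffOn_c j.2)
        (h.contDiff j j.2) fun ε hε => heq ε hε (.inr j)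
  · rcases i with (n | n) | j
    · exact apt_strictMono hα hε.1 n.lt_succ_self
    · exact bpt_succ_lt_bptTop hα hε.1 n
    · exact h.c_lt ε hε j j.2
  · rcases i with (n | n) | j
    · refine Icc_subset_Icc ?_ ?_
      · rw [← apt_zero (α := α) hε.1]
        exact (apt_strictMono hα hε.1).monotone n.zero_le
      · exact (apt_lt_three_eighths hα hε.1 (n + 1)).le.trans (by norm_num)
    · refine Icc_subset_Icc ?_ ?_
      · exact le_trans (by norm_num) (three_eighths_lt_bpt hα hε.1 (n + 1)).le
      · exact (bptTop_le hα hε.1 n).trans (by norm_num)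
    · exact (h.Icc_subset hε j.2).trans (Icc_subset_Icc (by norm_num) le_rfl)
  · rw [Ioo_branch, Ioo_branch]
    have hlr : ∀ (i : ℕ ⊕ ℕ) (j : Fin (2 * M + 1)),
        Disjoint (leftI α ε i) (Ioo (c j ε) (c (j + 1) ε)) := fun i j =>
      Set.disjoint_left.2 fun x hx hx' =>
        lt_asymm (leftI_subset hα hε.1 i hx).2 (h.right_subset hε j.2 hx').1
    rcases i with i | i <;> rcases j with j | j
    · exact disjoint_leftI hα hε.1 fun hh => hij (congrArg _ hh)
    · exact hlr i j
    · exact (hlr j i).symm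
    · exact h.disjoint_right hε fun hh => hij (congrArg _ hh)
  · refine ((countable_left hα hε.1).union (h.countable_right hε)).mono ?_
    rintro x ⟨hx, hx'⟩
    rcases le_total x (1 / 2) with hxh | hxh
    · refine Or.inl ⟨⟨hx.1, hxh⟩, fun hh => hx' ?_⟩
      obtain ⟨i, hi⟩ := mem_iUnion.1 hh
      exact mem_iUnion.2 ⟨.inl i, by rw [Ioo_branch]; exact hi⟩
    · refine Or.inr ⟨⟨hxh, hx.2⟩, fun hh => hx' ?_⟩
      obtain ⟨i, hi⟩ := mem_iUnion.1 hh
      exact mem_iUnion.2 ⟨.inr i, by rw [Ioo_branch]; exact hi⟩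
  · have hfin : ({Ioo (1 / 4) (1 / 2 + ε), Ioo (1 / 4) (1 / 2)} ∪
        range fun j : Fin (2 * M + 1) => Ioo (lowEnd p ε j) 1 : Set (Set ℝ)).Finite :=
      (toFinite _).union (finite_range _)
    refine hfin.subset ?_
    rintro _ ⟨i, rfl⟩
    simp only [Ioo_branch]
    rcases i with i | j
    · rw [Sum.elim_inl, image_leftI hα hε.1 (he1 ε hε)]
      left
      rcases i with n | n | n
      · exact Or.inl rfl
      · exact Or.inr rfl
      · exact Or.inl rfl
    · rw [Sum.elim_inr, h.image_right hε₀ hε j.2]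
      exact Or.inr ⟨j, rfl⟩
  · have hz : (0 : ℝ) ∈ Ico 0 ε₀ := ⟨le_rfl, h0⟩
    obtain ⟨D, lam, hD, hlam, hbr⟩ := h.exists_isBranch hε₀ hz α
    refine ⟨max D 8, min lam 4, lt_max_of_lt_right (by norm_num), lt_min hlam (by norm_num),
      fun i x hx => ?_⟩
    have hb : IsBranch (inducedMap α T4 0)
        (Ioo (branchL (2 * M + 1) α c 0 i) (branchR (2 * M + 1) α c 0 i)) (max D 8) (min lam 4) := by
      rw [Ioo_branch]
      rcases i with i | j
      · exact (isBranch_left hα hα1 le_rfl (by norm_num) i).mono (le_max_right _ _) (min_le_right _ _)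
      · exact (hbr j j.2).mono (le_max_left _ _) (min_le_left _ _)
    have e1 := eqOn_deriv_of_isOpen isOpen_Ioo (heq 0 hz i)
    have e2 := eqOn_deriv_of_isOpen isOpen_Ioo e1
    rw [e1 hx, e2 hx]
    have hpos : 0 < |deriv (inducedMap α T4 0) x| :=
      (lt_min (by linarith) (by norm_num)).trans_le (hb.expand x hx)
    refine ⟨hb.expand x hx, ?_⟩
    have := hb.adler x hx
    rwa [div_le_iff₀ (by rw [← sq_abs]; positivity)] at this

/-- The three possible values are fixed points of the unperturbed induced map, which is what
`condA5` needs. -/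
theorem inducedMap_of_notMem (h : IsRightData ε₀ T4 M p s c g) (hα : 0 < α)
    (h0 : 0 < ε₀) (hε₀ : ε₀ ≤ 1 / 4) {x : ℝ} (hx : x ∈ indDom)
    (hx' : x ∉ ⋃ i, Ioo (branchL (2 * M + 1) α c 0 i) (branchR (2 * M + 1) α c 0 i)) :
    inducedMap α T4 0 x ∈ ({1 / 2, 3 / 8, 1} : Set ℝ) := by
  have hz : (0 : ℝ) ∈ Ico 0 ε₀ := ⟨le_rfl, h0⟩
  simp only [mem_iUnion, not_exists] at hx'
  rcases le_total x (1 / 2) with hxh | hxh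
  · rcases left_cases hα le_rfl (x := x) ⟨hx.1, hxh⟩ with
      rfl | rfl | ⟨n, rfl⟩ | ⟨n, rfl⟩ | ⟨n, hn⟩ | ⟨n, hn⟩
    · rw [inducedMap_three_eighths hα]; simp
    · rw [h.inducedMap_half hε₀ hz]; simp
    · rw [inducedMap_apt hα le_rfl (by norm_num)]; simp
    · rw [inducedMap_bpt hα le_rfl (by norm_num)]; simp
    · exact (hx' (.inl (.inl n)) hn).elim
    · exact (hx' (.inl (.inr n)) hn).elim
  · rcases h.right_cases hz (x := x) ⟨hxh, hx.2⟩ with ⟨j, hj, rfl⟩ | ⟨j, hj, hj'⟩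
    · rw [h.inducedMap_eq hε₀ hz ⟨hxh, hx.2⟩]
      rcases Nat.even_or_odd j with he | ho
      · rw [h.value_even hz hj he]; simp
      · rw [h.odd 0 hz j hj ho]; simp
    · exact (hx' (.inr ⟨j, hj⟩) hj').elim

/-- Both one-sided limits of the unperturbed induced map at 1/2 equal 1/2, so `CondB4` can hold only
if 1/2 is not a partition point. If all maps are C² at 1/2, the adjacent branches have equal 2-jets
there and are merged; otherwise nothing is demanded at 1/2 and the natural partition is kept. -/
theorem exists_partition (h : IsRightData ε₀ T4 M p s c g) (hα : 0 < α) (hα1 : α < 1)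
    (h0 : 0 < ε₀) (hε₀ : ε₀ ≤ 1 / 4) :
    ∃ (l r : ℝ → ℕ → ℝ) (B : ℝ → ℕ → ℝ → ℝ),
      IsSmoothPartition (inducedMap α T4) ε₀ indDom l r B ∧
      (∀ x ∈ partitionPoints indDom (l 0) (r 0),
        inducedMap α T4 0 x ∈ ({1 / 2, 3 / 8, 1} : Set ℝ)) ∧
      ((∀ ε ∈ Ico 0 ε₀, ContDiffAt ℝ 2 (intermittentMap α T4 ε) (1 / 2)) →
        1 / 2 ∉ partitionPoints indDom (l 0) (r 0)) := by
  have hz : (0 : ℝ) ∈ Ico 0 ε₀ := ⟨le_rfl, h0⟩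
  have hP := h.isSmoothPartition hα hα1 h0 hε₀
  have hnot := fun x => h.inducedMap_of_notMem hα h0 hε₀ (x := x)
  by_cases H : ∀ ε ∈ Ico 0 ε₀, ContDiffAt ℝ 2 (intermittentMap α T4 ε) (1 / 2)
  · have hl : ∀ ε ∈ Ico 0 ε₀, EqOn (intermittentMap α T4 ε)
        (branchExt (2 * M + 1) α g ε (.inl (.inr 0))) (Ioc (3 / 8) (1 / 2)) := by
      intro ε hε x hx
      have e : branchExt (2 * M + 1) α g ε (.inl (.inr 0)) x = incBranch x := rfl
      rw [e]
      rcases hx.2.lt_or_eq with hx2 | rfl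
      · exact intermittentMap_inc hx.1.le hx2
      · rw [intermittentMap_right le_rfl (by norm_num)]
        have := h.value_even hε (Nat.zero_le _) Even.zero
        rw [h.c_zero ε hε, if_neg (by have := h.one_le; omega)] at this
        rw [this, incBranch]
        norm_num
    have hr : ∀ ε ∈ Ico 0 ε₀, EqOn (intermittentMap α T4 ε)
        (branchExt (2 * M + 1) α g ε (.inr 0)) (Ico (1 / 2) (c 1 ε)) := by
      intro ε hε x hx
      have hx1 : x ≤ 1 := hx.2.le.trans (h.c_mem hε (by omega)).2
      rw [intermittentMap_right hx.1 hx1]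
      exact h.eqOn ε hε 0 (by omega) ⟨(h.c_zero ε hε).trans_le hx.1, hx.2.le⟩
    have hc1 : ∀ ε ∈ Ico 0 ε₀, 1 / 2 < c 1 ε := fun ε hε =>
      (h.c_zero ε hε).symm.trans_lt (h.c_lt ε hε 0 (by omega))
    have jl := fun ε hε => jet_eq_of_eqOn (H ε hε) ((hP.branch (.inl (.inr 0))).contDiff ε hε)
      (hl ε hε) ⟨by norm_num, le_rfl⟩ (uniqueDiffOn_Ioc _ _ _ ⟨by norm_num, le_rfl⟩)
      (by rw [interior_Ioc]; exact fun x hx => ⟨hx.1.1, lt_of_le_of_ne hx.1.2 hx.2⟩)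
    have jr := fun ε hε => jet_eq_of_eqOn (H ε hε) ((hP.branch (.inr 0)).contDiff ε hε)
      (hr ε hε) ⟨le_rfl, hc1 ε hε⟩ (uniqueDiffOn_Ico _ _ _ ⟨le_rfl, hc1 ε hε⟩)
      (by rw [interior_Ico]; exact fun x hx => ⟨lt_of_le_of_ne hx.1.1 (Ne.symm hx.2), hx.1.2⟩)
    obtain ⟨l, r, B, h1, h2, h3⟩ := hP.merge h0 (a := .inl (.inr 0)) (b := .inr 0) (by simp)
      (t := 1 / 2) (fun _ => rfl) (fun ε hε => h.c_zero ε hε)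
      (fun ε hε => by
        rw [h.inducedMap_half hε₀ hε]
        change _ = incBranch (1 / 2)
        rw [incBranch]; norm_num)
      (fun ε hε => (jl ε hε).1.symm.trans (jr ε hε).1)
      (fun ε hε => (jl ε hε).2.1.symm.trans (jr ε hε).2.1)
      (fun ε hε => (jl ε hε).2.2.symm.trans (jr ε hε).2.2)
    have : Infinite {i : (ℕ ⊕ ℕ) ⊕ Fin (2 * M + 1) // i ≠ .inl (.inr 0)} :=
      Infinite.of_injective (fun n : ℕ => ⟨.inl (.inl n), by simp⟩) fun m n hmn => by simpa using hmn
    obtain ⟨_⟩ := nonempty_denumerable {i : (ℕ ⊕ ℕ) ⊕ Fin (2 * M + 1) // i ≠ .inl (.inr 0)}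
    let e' := (Denumerable.eqv {i : (ℕ ⊕ ℕ) ⊕ Fin (2 * M + 1) // i ≠ .inl (.inr 0)}).symm
    have hU : (⋃ k, Ioo (l 0 (e' k)) (r 0 (e' k))) = ⋃ i, Ioo (l 0 i) (r 0 i) :=
      e'.surjective.iUnion_comp fun i => Ioo (l 0 i) (r 0 i)
    refine ⟨_, _, _, h1.reindex e', fun x hx => ?_, fun _ hh => ?_⟩
    · refine hnot x hx.1 fun hx' => hx.2 ?_
      rw [hU]
      exact h2 0 hz hx'
    · refine hh.2 ?_
      rw [hU]
      exact h3 0 hz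
  · obtain ⟨_⟩ := nonempty_denumerable ((ℕ ⊕ ℕ) ⊕ Fin (2 * M + 1))
    let e' := (Denumerable.eqv ((ℕ ⊕ ℕ) ⊕ Fin (2 * M + 1))).symm
    refine ⟨_, _, _, hP.reindex e', fun x hx => ?_, fun hH => (H hH).elim⟩
    refine hnot x hx.1 fun hx' => hx.2 ?_
    rw [e'.surjective.iUnion_comp fun i =>
      Ioo (branchL (2 * M + 1) α c 0 i) (branchR (2 * M + 1) α c 0 i)]
    exact hx'

end IsRightData

/-! ### Expansion, distortion and stability conditions for a smooth partition. -/

namespace IsSmoothPartition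

variable {F : ℝ → ℝ → ℝ} {ε₀ : ℝ} {Δ : Set ℝ} {l r : ℝ → ℕ → ℝ} {B : ℝ → ℕ → ℝ → ℝ}

theorem isIntervalPartition (h : IsSmoothPartition F ε₀ Δ l r B) {ε : ℝ} (hε : ε ∈ Ico 0 ε₀) :
    IsIntervalPartition Δ (l ε) (r ε) :=
  ⟨h.lt ε hε, h.subset ε hε, h.disjoint ε hε, h.countable ε hε⟩

theorem condA1 (h : IsSmoothPartition F ε₀ Δ l r B) (h0 : 0 < ε₀) {δ : ℝ} (hδ : 0 < δ) :
    CondA1 (F 0) Δ (l 0) (r 0) δ (B 0) := by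
  have hz : (0 : ℝ) ∈ Ico 0 ε₀ := ⟨le_rfl, h0⟩
  exact ⟨h.isIntervalPartition hz, hδ, fun i =>
    ⟨((h.branch i).contDiff 0 hz).contDiffOn.congr ((h.branch i).eqOn 0 hz).symm,
      (h.branch i).contDiff 0 hz, (h.branch i).eqOn 0 hz⟩⟩

theorem exists_expand (h : IsSmoothPartition F ε₀ Δ l r B) (h0 : 0 < ε₀) :
    ∃ D lam : ℝ, 0 < D ∧ 2 < lam ∧ ∀ i, ∀ x ∈ Ioo (l 0 i) (r 0 i),
      lam ≤ |deriv (F 0) x| ∧ |deriv (deriv (F 0)) x| / deriv (F 0) x ^ 2 ≤ D := by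
  have hz : (0 : ℝ) ∈ Ico 0 ε₀ := ⟨le_rfl, h0⟩
  obtain ⟨D, lam, hD, hlam, hexp⟩ := h.expand
  refine ⟨D, lam, hD, hlam, fun i x hx => ?_⟩
  have e1 := eqOn_deriv_of_isOpen isOpen_Ioo ((h.branch i).eqOn 0 hz)
  have e2 := eqOn_deriv_of_isOpen isOpen_Ioo e1
  obtain ⟨h1, h2⟩ := hexp i x hx
  rw [e1 hx] at h1 h2
  rw [e2 hx] at h2
  refine ⟨h1, ?_⟩
  have hpos : 0 < |deriv (F 0) x| := by linarith
  rwa [div_le_iff₀ (by rw [← sq_abs]; positivity)]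

theorem condA2 (h : IsSmoothPartition F ε₀ Δ l r B) (h0 : 0 < ε₀) : CondA2 (F 0) Δ (l 0) (r 0) := by
  obtain ⟨D, lam, hD, hlam, hexp⟩ := h.exists_expand h0
  refine ⟨lam⁻¹, by positivity, by rwa [inv_inv], ?_⟩
  rintro x ⟨hx, hx'⟩
  rw [inv_inv]
  have hU : x ∈ ⋃ i, Ioo (l 0 i) (r 0 i) := by
    by_contra hn
    exact hx' ⟨hx, hn⟩
  obtain ⟨i, hi⟩ := mem_iUnion.1 hU
  exact (hexp i x hi).1

theorem condA3 (h : IsSmoothPartition F ε₀ Δ l r B) {ε : ℝ} (hε : ε ∈ Ico 0 ε₀) :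
    CondA3 (F ε) (l ε) (r ε) :=
  ⟨h.ordConnected_image hε, h.finite ε hε⟩

/-- With `δ` at least the length of the domain, every `δ`-neighbourhood contains the whole domain,
so all perturbed intervals are inside; the convergence of the extensions holds on every compact
interval. -/
theorem condB1 {F : ℝ → ℝ → ℝ} {ε₀ a b : ℝ} {l r : ℝ → ℕ → ℝ} {B : ℝ → ℕ → ℝ → ℝ}
    (h : IsSmoothPartition F ε₀ (Icc a b) l r B) (h0 : 0 < ε₀) {δ : ℝ} (hδ : b - a ≤ δ) :
    CondB1 F (Icc a b) ε₀ l r δ B := by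
  have hz : (0 : ℝ) ∈ Ico 0 ε₀ := ⟨le_rfl, h0⟩
  refine ⟨fun ε hε => h.isIntervalPartition ⟨hε.1.le, hε.2⟩,
    fun i => ⟨(h.branch i).left_smooth, (h.branch i).right_smooth⟩,
    ⟨1, one_pos, fun ε hε _ i => ?_⟩, fun ε hε i => ?_, fun i k hk => (h.branch i).tendsto k hk _ _⟩
  · have h1 := h.subset ε ⟨hε.1.le, hε.2⟩ i
    have hl := h.subset 0 hz i (left_mem_Icc.2 (h.lt 0 hz i).le)
    have hr := h.subset 0 hz i (right_mem_Icc.2 (h.lt 0 hz i).le)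
    exact h1.trans (Icc_subset_Icc (by linarith [hl.2]) (by linarith [hr.1]))
  · exact ⟨(h.branch i).contDiff ε ⟨hε.1.le, hε.2⟩, (h.branch i).eqOn ε ⟨hε.1.le, hε.2⟩⟩

end IsSmoothPartition

/-! ### Asymptotics of small holes -/

/-- The `h`-mass of a set `S ε`, shrinking to a point `e₀` and mapped by `G ε` onto a set of
length `ε`. -/
theorem tendsto_edge_integral {G : ℝ → ℝ → ℝ} (hG : ContDiff ℝ 2 fun z : ℝ × ℝ => G z.1 z.2)
    {S : ℝ → Set ℝ} {e : ℝ → ℝ} {e₀ : ℝ} (he : Tendsto e (𝓝[>] 0) (𝓝 e₀))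
    (hS : ∀ᶠ ε in 𝓝[>] 0, MeasurableSet (S ε) ∧ InjOn (G ε) (S ε) ∧
      volume (G ε '' S ε) = ENNReal.ofReal ε ∧ ∀ x ∈ S ε, |x - e ε| ≤ ε)
    (hd : deriv (G 0) e₀ ≠ 0) {h : ℝ → ℝ} (hh : Continuous h) :
    Tendsto (fun ε => (∫ x in S ε, h x) / ε) (𝓝[>] 0) (𝓝 (h e₀ / |deriv (G 0) e₀|)) := by
  have hG1 : Continuous fun z : ℝ × ℝ => deriv (G z.1) z.2 :=
    (contDiff_deriv_slice (m := 1) hG (by norm_num)).continuous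
  set C := h e₀ / |deriv (G 0) e₀| with hC
  have hd0 : 0 < |deriv (G 0) e₀| := abs_pos.2 hd
  rw [Metric.tendsto_nhds]
  intro η hη
  -- The constant C is chosen so that h = C |G'| at (0, e₀). Nearby the two differ by at most (η /
  -- 2) |G'|, and |G'| integrates over `S ε` to the length ε of the image.
  have hcont : Continuous fun z : ℝ × ℝ =>
      abs (h z.2 - C * |deriv (G z.1) z.2|) - η / 2 * |deriv (G z.1) z.2| := by
    have h2 : Continuous fun z : ℝ × ℝ => h z.2 := hh.comp continuous_snd
    fun_prop
  have hneg : ∀ᶠ z : ℝ × ℝ in 𝓝 (0, e₀),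
      abs (h z.2 - C * |deriv (G z.1) z.2|) - η / 2 * |deriv (G z.1) z.2| < 0 := by
    refine hcont.continuousAt.eventually_lt continuousAt_const ?_
    have : h e₀ - C * |deriv (G 0) e₀| = 0 := by rw [hC]; field_simp; ring
    simp only [this, abs_zero]
    have := mul_pos (half_pos hη) hd0
    linarith
  obtain ⟨ρ, hρ, hball⟩ := Metric.eventually_nhds_iff.1 hneg
  have h1 : ∀ᶠ ε in 𝓝[>] (0 : ℝ), ε < ρ / 2 := by
    filter_upwards [Ioo_mem_nhdsGT (half_pos hρ)] with ε hε using hε.2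
  filter_upwards [hS, h1, self_mem_nhdsWithin,
    Metric.tendsto_nhds.1 he (ρ / 2) (half_pos hρ)] with ε ⟨hm, hinj, hvol, hsm⟩ hε1 hε0 hεe
  have hε0' : 0 < ε := hε0
  have hsub : S ε ⊆ Icc (e ε - ε) (e ε + ε) := fun x hx => by
    have := abs_le.1 (hsm x hx)
    exact ⟨by linarith [this.1], by linarith [this.2]⟩
  have hGε : Differentiable ℝ (G ε) := (contDiff_slice hG ε).differentiable (by norm_num)
  have hGd : Continuous fun x => |deriv (G ε) x| :=
    (hG1.comp (Continuous.prodMk continuous_const continuous_id)).abs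
  have hint : IntegrableOn (fun x => |deriv (G ε) x|) (S ε) :=
    hGd.continuousOn.integrableOn_Icc.mono_set hsub
  have hinth : IntegrableOn h (S ε) := hh.continuousOn.integrableOn_Icc.mono_set hsub
  have hcv : ∫ x in S ε, |deriv (G ε) x| = ε := by
    have := integral_image_eq_integral_abs_deriv_smul hm
      (fun x _ => (hGε x).hasDerivAt.hasDerivWithinAt) hinj (fun _ => (1 : ℝ))
    simp only [smul_eq_mul, mul_one, integral_const] at this
    rw [← this, measureReal_restrict_apply_univ, measureReal_def, hvol,
      ENNReal.toReal_ofReal hε0'.le]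
  have hle : |(∫ x in S ε, h x) - C * ε| ≤ η / 2 * ε := by
    have e1 : (∫ x in S ε, h x) - C * ε = ∫ x in S ε, (h x - C * |deriv (G ε) x|) := by
      rw [integral_sub hinth (hint.const_mul C), integral_const_mul, hcv]
    have e2 : η / 2 * ε = ∫ x in S ε, η / 2 * |deriv (G ε) x| := by
      rw [integral_const_mul, hcv]
    rw [e1, e2, ← Real.norm_eq_abs]
    refine norm_integral_le_of_norm_le (hint.const_mul _) ?_
    refine (ae_restrict_iff' hm).2 (ae_of_all _ fun x hx => ?_)
    have hdist : dist (ε, x) ((0 : ℝ), e₀) < ρ := by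
      rw [Prod.dist_eq, max_lt_iff]
      refine ⟨?_, ?_⟩
      · rw [Real.dist_eq, sub_zero, abs_of_pos hε0']; linarith
      · calc dist x e₀ ≤ dist x (e ε) + dist (e ε) e₀ := dist_triangle _ _ _
          _ < ρ := by rw [Real.dist_eq]; linarith [hsm x hx]
    have := hball hdist
    simp only at this
    rw [Real.norm_eq_abs]
    linarith
  rw [Real.dist_eq]
  have e3 : (∫ x in S ε, h x) / ε - C = ((∫ x in S ε, h x) - C * ε) / ε := by field_simp
  rw [e3, abs_div, abs_of_pos hε0', div_lt_iff₀ hε0']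
  nlinarith

/-- An expanding branch mapped onto an interval of length at least `1/4` contracts backwards at
least at the rate of its length. -/
theorem IsBranch.diam_bound {F : ℝ → ℝ} {a b D lam : ℝ} (h : IsBranch F (Ioo a b) D lam)
    (hl : 0 < lam) (hD : 0 ≤ D) (hdiam : ∀ x ∈ Ioo a b, ∀ y ∈ Ioo a b, |F x - F y| ≤ 1)
    (him : Ioo (1 / 4) (1 / 2) ⊆ F '' Ioo a b) {x y : ℝ} (hx : x ∈ Ioo a b) (hy : y ∈ Ioo a b) :
    |x - y| ≤ 8 * Real.exp D * (b - a) * |F x - F y| := by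
  -- The values 5/16 and 7/16 are 1/8 apart and their preimages at most b - a, so the derivative
  -- somewhere is at least 1 / (8 (b - a)); distortion carries this to every point.
  obtain ⟨u, hu, hFu⟩ := him (show (5 / 16 : ℝ) ∈ Ioo (1 / 4) (1 / 2) by constructor <;> norm_num)
  obtain ⟨v, hv, hFv⟩ := him (show (7 / 16 : ℝ) ∈ Ioo (1 / 4) (1 / 2) by constructor <;> norm_num)
  have hba : 0 < b - a := by linarith [hu.1, hu.2]
  have hexp := Real.exp_pos D
  -- a uniform lower bound for the derivative
  have key : ∀ z ∈ Ioo a b, (8 * Real.exp D * (b - a))⁻¹ ≤ |deriv F z| := by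
    intro z hz
    have hup : ∀ w ∈ Ioo a b, ‖deriv F w‖ ≤ Real.exp D * |deriv F z| := fun w hw => by
      rw [Real.norm_eq_abs]
      refine (h.distortion hl w hw z hz).trans ?_
      gcongr
      exact mul_le_of_le_one_right hD (hdiam w hw z hz)
    have := (convex_Ioo a b).norm_image_sub_le_of_norm_deriv_le h.diff1 hup hu hv
    rw [hFu, hFv, Real.norm_eq_abs, Real.norm_eq_abs] at this
    have huv : |v - u| ≤ b - a := abs_le.2 ⟨by linarith [hu.2, hv.1], by linarith [hu.1, hv.2]⟩
    have h2 : (1 : ℝ) / 8 ≤ Real.exp D * |deriv F z| * (b - a) := by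
      have e : |(7 / 16 : ℝ) - 5 / 16| = 1 / 8 := by norm_num [abs_of_pos]
      rw [e] at this
      exact this.trans (mul_le_mul_of_nonneg_left huv (by positivity))
    rw [inv_le_iff_one_le_mul₀ (by positivity)]
    linarith
  have := expand_of_deriv ordConnected_Ioo h.diff1 key x hx y hy
  rwa [inv_mul_le_iff₀ (by positivity)] at this

theorem nhdsGT_le_Ioo {ε₀ : ℝ} (h0 : 0 < ε₀) : ∀ᶠ ε in 𝓝[>] (0 : ℝ), ε ∈ Ioo 0 ε₀ :=
  Ioo_mem_nhdsGT h0

/-- The `h`-mass of the points of one branch that fall into `B`, if these are the points within `ε`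
of the value at one end point. -/
theorem tendsto_component {F G : ℝ → ℝ → ℝ} {a b e : ℝ → ℝ} {B : Set ℝ} {ε₀ : ℝ} (h0 : 0 < ε₀)
    (hG : ContDiff ℝ 2 fun z : ℝ × ℝ => G z.1 z.2) (hF : ∀ ε ∈ Ico 0 ε₀, Measurable (F ε))
    (hFG : ∀ ε ∈ Ico 0 ε₀, EqOn (G ε) (F ε) (Ioo (a ε) (b ε)))
    (hslope : ∀ ε ∈ Ico 0 ε₀, ∀ x ∈ Icc (a ε) (b ε), 1 ≤ |deriv (G ε) x|)
    (hmem : ∀ ε ∈ Ico 0 ε₀, e ε ∈ Icc (a ε) (b ε)) (hcont : ContinuousOn e (Ico 0 ε₀))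
    (hB : MeasurableSet B)
    (hvol : ∀ ε ∈ Ioo 0 ε₀, volume (F ε '' Ioo (a ε) (b ε) ∩ B) = ENNReal.ofReal ε)
    (hend : ∀ ε ∈ Ioo 0 ε₀, ∀ y ∈ F ε '' Ioo (a ε) (b ε) ∩ B, |y - G ε (e ε)| ≤ ε)
    {h : ℝ → ℝ} (hh : Continuous h) :
    Tendsto (fun ε => (∫ x in Ioo (a ε) (b ε) ∩ F ε ⁻¹' B, h x) / ε) (𝓝[>] 0)
      (𝓝 (h (e 0) / |deriv (G 0) (e 0)|)) := by
  have hz : (0 : ℝ) ∈ Ico 0 ε₀ := ⟨le_rfl, h0⟩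
  refine tendsto_edge_integral hG (e := e) ?_ ?_ ?_ hh
  · have : Tendsto e (𝓝[Ioo 0 ε₀] 0) (𝓝 (e 0)) := (hcont 0 hz).mono Ioo_subset_Ico_self
    rwa [nhdsWithin_Ioo_eq_nhdsGT h0] at this
  · filter_upwards [nhdsGT_le_Ioo h0] with ε hε
    have hε' : ε ∈ Ico 0 ε₀ := ⟨hε.1.le, hε.2⟩
    have hexp := expand_of_deriv ordConnected_Icc
      (fun x _ => (contDiff_slice hG ε).differentiable (by norm_num) x) (hslope ε hε')
    have hsub : Ioo (a ε) (b ε) ∩ F ε ⁻¹' B ⊆ Icc (a ε) (b ε) :=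
      inter_subset_left.trans Ioo_subset_Icc_self
    have himg : G ε '' (Ioo (a ε) (b ε) ∩ F ε ⁻¹' B) = F ε '' Ioo (a ε) (b ε) ∩ B := by
      rw [((hFG ε hε').mono inter_subset_left).image_eq, image_inter_preimage]
    refine ⟨measurableSet_Ioo.inter (hF ε hε' hB), fun x hx y hy hxy => ?_, ?_, fun x hx => ?_⟩
    · have := hexp x (hsub hx) y (hsub hy)
      rw [hxy, sub_self, abs_zero, one_mul] at this
      exact sub_eq_zero.1 (abs_eq_zero.1 (le_antisymm this (abs_nonneg _)))
    · rw [himg]; exact hvol ε hε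
    · have h1 := hexp x (hsub hx) (e ε) (hmem ε hε')
      rw [one_mul] at h1
      exact h1.trans (hend ε hε _ (himg ▸ mem_image_of_mem _ hx))
  · intro hd
    have := hslope 0 hz (e 0) (hmem 0 hz)
    rw [hd, abs_zero] at this
    linarith

/-- The mass of a set as a sum over the elements of a partition. -/
theorem IsDensityOn.toReal_eq_tsum {ι : Type} [Countable ι] {μ : Measure ℝ} {h : ℝ → ℝ} {a b : ℝ}
    (hμ : IsDensityOn μ h (Icc a b)) (hh : Continuous h) {A : Set ℝ} (hA : MeasurableSet A)
    (hAs : A ⊆ Icc a b) {I : ι → Set ℝ} (hI : ∀ i, MeasurableSet (I i))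
    (hd : Pairwise fun i j => Disjoint (I i) (I j)) (hc : (Icc a b \ ⋃ i, I i).Countable) :
    (μ A).toReal = ∑' i, ∫ x in I i ∩ A, h x := by
  have hint : IntegrableOn h A := hh.continuousOn.integrableOn_Icc.mono_set hAs
  have h1 : (μ A).toReal = ∫ x in A, h x := by
    rw [hμ.2, withDensity_apply _ hA, Measure.restrict_restrict hA,
      inter_eq_left.2 hAs, ← ofReal_integral_eq_lintegral_ofReal hint, ENNReal.toReal_ofReal]
    · exact setIntegral_nonneg hA fun x hx => hμ.1 x (hAs hx)
    · exact (ae_restrict_iff' hA).2 (ae_of_all _ fun x hx => hμ.1 x (hAs hx))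
  have h2 : (⋃ i, I i ∩ A : Set ℝ) =ᵐ[volume] A := by
    rw [← iUnion_inter]
    refine (ae_eq_set.2 ⟨?_, ?_⟩)
    · rw [sdiff_eq_empty.2 inter_subset_right, measure_empty]
    · refine (hc.mono ?_).measure_zero _
      rintro x ⟨hx, hx'⟩
      exact ⟨hAs hx, fun hU => hx' ⟨hU, hx⟩⟩
  rw [h1, ← setIntegral_congr_set h2]
  refine integral_iUnion (fun i => (hI i).inter hA) (fun i j hij => ?_) ?_
  · exact (hd hij).mono inter_subset_left inter_subset_left
  · exact hint.mono_set (iUnion_subset fun i => inter_subset_right)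

/-! ### The hole on the right. -/

namespace IsRightData

variable {ε₀ : ℝ} {T4 : ℝ → ℝ → ℝ} {M p : ℕ} {s : ℝ} {c : ℕ → ℝ → ℝ} {g : ℕ → ℝ → ℝ → ℝ} {ε α : ℝ}
  {j : ℕ}

/-- Only the two branches meeting at the spike have images reaching below 1/2, down to 1/2 - ε. Each
contributes density over slope at s; the remaining branches contribute nothing. -/
theorem tendsto_hole_right (h : IsRightData ε₀ T4 M p s c g) (h0 : 0 < ε₀)
    (hε₀ : ε₀ ≤ 1 / 4) {μ : Measure ℝ} {w : ℝ → ℝ} (hμ : IsDensityOn μ w indDomR)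
    (hw : Continuous w) (hpos : ∀ x, 0 < w x) : ∃ L : ℝ, 0 < L ∧
      Tendsto (fun ε => (μ (hole (inducedMap α T4 ε) indDomR indDomL)).toReal / ε) (𝓝[>] 0)
        (𝓝 L) := by
  have hp1 := h.one_le
  have hpM := h.p_le
  have hz : (0 : ℝ) ∈ Ico 0 ε₀ := ⟨le_rfl, h0⟩
  let P : Fin (2 * M + 1) → Prop := fun j => (j : ℕ) + 1 = 2 * p ∨ (j : ℕ) = 2 * p
  have hterm : ∀ j : Fin (2 * M + 1), Tendsto (fun ε =>
      (∫ x in Ioo (c j ε) (c (j + 1) ε) ∩ hole (inducedMap α T4 ε) indDomR indDomL, w x) / ε)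
      (𝓝[>] 0) (𝓝 (if P j then w s / |deriv (g j 0) s| else 0)) := by
    intro j
    have hset : ∀ ε ∈ Ico 0 ε₀, Ioo (c j ε) (c (j + 1) ε) ∩ hole (inducedMap α T4 ε) indDomR indDomL
        = Ioo (c j ε) (c (j + 1) ε) ∩ inducedMap α T4 ε ⁻¹' indDomL := by
      intro ε hε
      rw [hole, ← inter_assoc, inter_eq_left.2 (Ioo_subset_Icc_self.trans (h.Icc_subset hε j.2))]
    by_cases hP : P j
    · rw [if_pos hP]
      have hlow : ∀ ε, lowEnd p ε j = 1 / 2 - ε := fun ε => by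
        rw [lowEnd, if_pos (by simpa [P] using hP)]
      have himg : ∀ ε ∈ Ioo 0 ε₀, inducedMap α T4 ε '' Ioo (c j ε) (c (j + 1) ε) ∩ indDomL =
          Ioc (1 / 2 - ε) (1 / 2) := by
        intro ε hε
        rw [h.image_right hε₀ ⟨hε.1.le, hε.2⟩ j.2, hlow]
        ext y
        simp only [indDomL, mem_inter_iff, mem_Ioo, mem_Icc, mem_Ioc]
        constructor
        · rintro ⟨⟨h1, -⟩, -, h2⟩; exact ⟨h1, h2⟩
        · rintro ⟨h1, h2⟩
          exact ⟨⟨h1, by linarith⟩, by linarith [hε.2], h2⟩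
      have hs : ∀ ε ∈ Ico 0 ε₀, s ∈ Icc (c j ε) (c (j + 1) ε) := by
        intro ε hε
        have hlt := (h.c_lt ε hε j j.2).le
        rw [← h.c_spike ε hε]
        rcases hP with hP | hP
        · rw [hP] at hlt ⊢; exact right_mem_Icc.2 hlt
        · rw [← hP]; exact left_mem_Icc.2 hlt
      have key := tendsto_component (F := inducedMap α T4) (G := g j) (a := c j) (b := c (j + 1))
        (e := fun _ => s) (B := indDomL) h0 (h.contDiff j j.2)
        (fun ε hε => h.measurable_inducedMap hε α)
        (fun ε hε => ((h.inducedMap_eqOn hε₀ hε j.2 α).mono Ioo_subset_Icc_self).symm)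
        (fun ε hε x hx => by linarith [h.slope ε hε j j.2 x hx]) hs continuousOn_const
        measurableSet_Icc
        (fun ε hε => by rw [himg ε hε, Real.volume_Ioc]; congr 1; ring)
        (fun ε hε y hy => by
          rw [himg ε hε] at hy
          have hε' : ε ∈ Ico 0 ε₀ := ⟨hε.1.le, hε.2⟩
          rw [← h.eqOn ε hε' j j.2 (hs ε hε'), h.spike ε hε', abs_le]
          constructor <;> linarith [hy.1, hy.2]) hw
      refine key.congr' ?_
      filter_upwards [nhdsGT_le_Ioo h0] with ε hε
      rw [hset ε ⟨hε.1.le, hε.2⟩]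
    · rw [if_neg hP]
      refine tendsto_const_nhds.congr' ?_
      filter_upwards [nhdsGT_le_Ioo h0] with ε hε
      have hε' : ε ∈ Ico 0 ε₀ := ⟨hε.1.le, hε.2⟩
      have hempty : Ioo (c j ε) (c (j + 1) ε) ∩ inducedMap α T4 ε ⁻¹' indDomL = ∅ := by
        refine eq_empty_of_forall_notMem fun x hx => ?_
        have hx1 : inducedMap α T4 ε x ∈ Ioo (lowEnd p ε j) 1 :=
          h.image_right hε₀ hε' j.2 ▸ mem_image_of_mem _ hx.1
        rw [lowEnd, if_neg (by simpa [P] using hP)] at hx1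
        exact absurd hx.2.2 (not_le.2 hx1.1)
      rw [hset ε hε', hempty, setIntegral_empty, zero_div]
  have hsum := tendsto_finsetSum Finset.univ fun j _ => hterm j
  have hder : ∀ j, P j → 0 < w s / |deriv (g j 0) s| := by
    intro j hP
    have hs : s ∈ Icc (c j 0) (c (j + 1) 0) := by
      have hlt := (h.c_lt 0 hz j j.2).le
      rw [← h.c_spike 0 hz]
      rcases hP with hP | hP
      · rw [hP] at hlt ⊢; exact right_mem_Icc.2 hlt
      · rw [← hP]; exact left_mem_Icc.2 hlt
    have := h.slope 0 hz j j.2 s hs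
    exact div_pos (hpos s) (by linarith)
  refine ⟨_, ?_, hsum.congr' ?_⟩
  · refine Finset.sum_pos' (fun j _ => ?_) ⟨⟨2 * p, by omega⟩, Finset.mem_univ _, ?_⟩
    · split_ifs with hP
      · exact (hder j hP).le
      · exact le_rfl
    · rw [if_pos (Or.inr rfl)]
      exact hder _ (Or.inr rfl)
  · filter_upwards [nhdsGT_le_Ioo h0] with ε hε
    have hε' : ε ∈ Ico 0 ε₀ := ⟨hε.1.le, hε.2⟩
    have hA : MeasurableSet (hole (inducedMap α T4 ε) indDomR indDomL) :=
      measurableSet_Icc.inter (h.measurable_inducedMap hε' α measurableSet_Icc)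
    rw [hμ.toReal_eq_tsum hw hA inter_subset_left (fun _ => measurableSet_Ioo)
      (h.disjoint_right hε') (h.countable_right hε'), tsum_fintype, Finset.sum_div]

end IsRightData

/-! ### The hole on the left, spread over infinitely many branches. -/

section left

variable {α ε : ℝ} {T4 : ℝ → ℝ → ℝ}

theorem zpt_gap_nonneg (hα : 0 < α) (n : ℕ) : 0 ≤ zpt α 0 n - zpt α 0 (n + 1) :=
  sub_nonneg.2 (zpt_anti hα le_rfl n.lt_succ_self).le

/-- By `backOrbit_gap` the gap is the coefficient times a power of z (n + 1). The point moves left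
as ε grows, and the coefficient at most doubles because 1 + 4ε ≤ 2. -/
theorem zpt_gap_le (hα : 0 < α) (hε : 0 ≤ ε) (hε1 : ε ≤ 1 / 4) (n : ℕ) :
    zpt α ε n - zpt α ε (n + 1) ≤ 2 * (zpt α 0 n - zpt α 0 (n + 1)) := by
  have h4 : (0 : ℝ) < 4 ^ α := Real.rpow_pos_of_pos (by norm_num) α
  have hz := zpt_pos hα hε (n + 1)
  have hle : zpt α ε (n + 1) ≤ zpt α 0 (n + 1) :=
    backOrbit_anti_coeff hα (neutralCoeff_pos le_rfl) (neutralCoeff_mono hε) n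
  have hr : zpt α ε (n + 1) ^ (1 + α) ≤ zpt α 0 (n + 1) ^ (1 + α) :=
    Real.rpow_le_rpow hz.le hle (by linarith)
  have e1 := backOrbit_gap hα (neutralCoeff_pos (α := α) hε) n
  have e2 := backOrbit_gap hα (neutralCoeff_pos (α := α) (le_refl 0)) n
  have hc : neutralCoeff α ε ≤ 2 * neutralCoeff α 0 := by
    unfold neutralCoeff
    nlinarith
  have h0 : 0 ≤ neutralCoeff α 0 := (neutralCoeff_pos le_rfl).le
  calc zpt α ε n - zpt α ε (n + 1) = neutralCoeff α ε * zpt α ε (n + 1) ^ (1 + α) := e1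
    _ ≤ 2 * neutralCoeff α 0 * zpt α 0 (n + 1) ^ (1 + α) := by
        have := Real.rpow_nonneg hz.le (1 + α)
        gcongr
    _ = 2 * (zpt α 0 n - zpt α 0 (n + 1)) := by rw [mul_assoc]; exact congrArg _ e2.symm

theorem summable_zpt_gap (hα : 0 < α) : Summable fun n => zpt α 0 n - zpt α 0 (n + 1) := by
  refine summable_of_sum_range_le (c := zpt α 0 0) (zpt_gap_nonneg hα) fun n => ?_
  rw [Finset.sum_range_sub']
  linarith [zpt_pos hα (le_refl 0) n]

/-- The end point of a left branch at which the induced map takes the value `1/2 + ε`. -/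
noncomputable def leftEnd (α ε : ℝ) : ℕ ⊕ ℕ → ℝ
  | .inl n => apt α ε n
  | .inr n => bptTop α ε n

/-- With `N = 0` there are no right branches and the function `c` is a dummy, so the end points
defined for the whole partition can be reused on the left. -/
theorem leftI_eq (α ε : ℝ) (i : ℕ ⊕ ℕ) :
    leftI α ε i = Ioo (branchL 0 α (fun _ => id) ε (.inl i)) (branchR 0 α (fun _ => id) ε (.inl i)) :=
  (Ioo_branch 0 α _ ε (.inl i)).symm

theorem leftTop_eq {i : ℕ ⊕ ℕ} (hi : i ≠ .inr 0) (ε : ℝ) : leftTop ε i = 1 / 2 + ε := by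
  rcases i with n | n | n
  · rfl
  · exact (hi rfl).elim
  · rfl

theorem leftExt_leftEnd (hα : 0 < α) (hε : 0 ≤ ε) (hε1 : ε ≤ 1 / 4) {i : ℕ ⊕ ℕ}
    (hi : i ≠ .inr 0) : leftExt α ε i (leftEnd α ε i) = 1 / 2 + ε := by
  have key : ∀ n, smoothIter α (zlow α n) n ε (zpt α ε n) = 1 / 2 + ε := fun n => by
    rw [(smoothIter_eq (zlow_pos hα n) hε n ((zlow_le hα hε hε1 n).trans
      (zpt_anti hα hε n.lt_succ_self).le)).1, ← zpt_zero (α := α)]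
    exact iterate_neutral_backOrbit hα (neutralCoeff_pos hε) n 0
  rcases i with n | n | n
  · change smoothIter α (zlow α n) n ε (decBranch ε (apt α ε n)) = _
    rw [decBranch_apt hε, key]
  · exact (hi rfl).elim
  · change smoothIter α (zlow α (n + 1)) (n + 1) ε (incBranch (bpt α ε (n + 1))) = _
    rw [incBranch_bpt, key]

theorem continuousOn_leftEnd (hα : 0 < α) {ε₀ : ℝ} (hε₀ : ε₀ ≤ 1 / 4) (i : ℕ ⊕ ℕ) :
    ContinuousOn (fun ε => leftEnd α ε i) (Ico 0 ε₀) := by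
  rcases i with n | n
  · exact (contDiffOn_apt hα hε₀ n).continuousOn
  · exact (contDiffOn_bptTop hα hε₀ n).continuousOn

theorem branch_left_lt (hα : 0 < α) (hε : 0 ≤ ε) (i : ℕ ⊕ ℕ) :
    branchL 0 α (fun _ => id) ε (.inl i) < branchR 0 α (fun _ => id) ε (.inl i) := by
  rcases i with n | n
  · exact apt_strictMono hα hε n.lt_succ_self
  · exact bpt_succ_lt_bptTop hα hε n

theorem leftEnd_mem (hα : 0 < α) (hε : 0 ≤ ε) (i : ℕ ⊕ ℕ) : leftEnd α ε i ∈
    Icc (branchL 0 α (fun _ => id) ε (.inl i)) (branchR 0 α (fun _ => id) ε (.inl i)) := by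
  have := (branch_left_lt hα hε i).le
  rcases i with n | n
  · exact left_mem_Icc.2 this
  · exact right_mem_Icc.2 this

/-- The bound does not depend on ε: the factor 2 of `zpt_gap_le` is absorbed by the affine branches,
whose slopes are at least 4 in absolute value. -/
theorem branch_left_length (hα : 0 < α) (hε : 0 ≤ ε) (hε1 : ε ≤ 1 / 4) {i : ℕ ⊕ ℕ}
    (hi : i ≠ .inr 0) :
    branchR 0 α (fun _ => id) ε (.inl i) - branchL 0 α (fun _ => id) ε (.inl i) ≤
      Sum.elim (fun n => zpt α 0 n - zpt α 0 (n + 1)) (fun n => zpt α 0 n - zpt α 0 (n + 1)) i := by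
  rcases i with n | n | n
  · have h1 := zpt_gap_le hα hε hε1 n
    have h2 := zpt_gap_nonneg hα n
    change apt α ε (n + 1) - apt α ε n ≤ zpt α 0 n - zpt α 0 (n + 1)
    rw [apt, apt, div_sub_div_same, div_le_iff₀ (by positivity)]
    nlinarith
  · exact (hi rfl).elim
  · have h1 := zpt_gap_le hα hε hε1 (n + 1)
    have h2 := zpt_gap_nonneg hα (n + 1)
    change bpt α ε (n + 1) - bpt α ε (n + 1 + 1) ≤ zpt α 0 (n + 1) - zpt α 0 (n + 1 + 1)
    rw [bpt, bpt, div_sub_div_same, div_le_iff₀ (by norm_num)]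
    linarith

theorem image_left_inter (hα : 0 < α) (hε : 0 ≤ ε) (hε1 : ε ≤ 1 / 4) {i : ℕ ⊕ ℕ}
    (hi : i ≠ .inr 0) : inducedMap α T4 ε '' leftI α ε i ∩ indDomR = Ico (1 / 2) (1 / 2 + ε) := by
  rw [image_leftI hα hε hε1, leftTop_eq hi]
  ext y
  simp only [indDomR, mem_inter_iff, mem_Ioo, mem_Icc, mem_Ico]
  constructor
  · rintro ⟨⟨-, h1⟩, h2, -⟩; exact ⟨h2, h1⟩
  · rintro ⟨h1, h2⟩
    exact ⟨⟨by linarith, h2⟩, h1, by linarith⟩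

theorem left_inter_eq_empty (hα : 0 < α) (hε : 0 ≤ ε) (hε1 : ε ≤ 1 / 4) :
    leftI α ε (.inr 0) ∩ inducedMap α T4 ε ⁻¹' indDomR = ∅ := by
  refine eq_empty_of_forall_notMem fun x hx => ?_
  have hx1 : inducedMap α T4 ε x ∈ Ioo (1 / 4) (leftTop ε (.inr 0)) :=
    image_leftI hα hε hε1 (.inr 0) ▸ mem_image_of_mem _ hx.1
  exact absurd hx.2.1 (not_le.2 hx1.2)

/-- The part of a branch landing in an interval of length ε has, by bounded distortion, length at
most ε times a constant times the length of the branch. After division by ε this is the summable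
majorant for `tendsto_hole_left`. -/
theorem volume_left_inter_le (hα : 0 < α) (hα1 : α < 1) (hε : 0 ≤ ε) (hε1 : ε ≤ 1 / 4)
    {i : ℕ ⊕ ℕ} (hi : i ≠ .inr 0) :
    volume (leftI α ε i ∩ inducedMap α T4 ε ⁻¹' indDomR) ≤ ENNReal.ofReal (8 * Real.exp 8 *
      Sum.elim (fun n => zpt α 0 n - zpt α 0 (n + 1)) (fun n => zpt α 0 n - zpt α 0 (n + 1)) i
      * ε) := by
  have hb := isBranch_left (T4 := T4) hα hα1 hε hε1 i
  have him := image_leftI (T4 := T4) hα hε hε1 i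
  have hlen := branch_left_length hα hε hε1 hi
  have hinter := image_left_inter (T4 := T4) hα hε hε1 hi
  have hlt := branch_left_lt hα hε i
  rw [leftI_eq] at *
  refine (Real.volume_le_diam _).trans (Metric.ediam_le fun x hx y hy => ?_)
  rw [edist_dist, Real.dist_eq]
  refine ENNReal.ofReal_le_ofReal ?_
  have hFx : inducedMap α T4 ε x ∈ Ico (1 / 2) (1 / 2 + ε) := by
    rw [← hinter]; exact ⟨mem_image_of_mem _ hx.1, hx.2⟩
  have hFy : inducedMap α T4 ε y ∈ Ico (1 / 2) (1 / 2 + ε) := by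
    rw [← hinter]; exact ⟨mem_image_of_mem _ hy.1, hy.2⟩
  have hFxy : |inducedMap α T4 ε x - inducedMap α T4 ε y| ≤ ε :=
    abs_le.2 ⟨by linarith [hFx.1, hFy.2], by linarith [hFx.2, hFy.1]⟩
  refine (hb.diam_bound (by norm_num) (by norm_num) (fun u hu v hv => ?_) ?_ hx.1 hy.1).trans ?_
  · have hu' := him ▸ mem_image_of_mem (inducedMap α T4 ε) hu
    have hv' := him ▸ mem_image_of_mem (inducedMap α T4 ε) hv
    rw [leftTop_eq hi] at hu' hv'
    exact abs_le.2 ⟨by linarith [hu'.1, hv'.2], by linarith [hu'.2, hv'.1]⟩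
  · rw [him, leftTop_eq hi]
    exact Ioo_subset_Ioo le_rfl (by linarith)
  · have hp := Real.exp_pos 8
    have h1 := sub_nonneg.2 hlt.le
    gcongr
    exact mul_nonneg (by positivity) (h1.trans hlen)

/-- Each branch except `.inr 0` contributes density over slope at the end point where the value 1/2
+ ε is taken. Limit and infinite sum are interchanged by dominated convergence, and the limit is
positive since its terms are nonnegative and the one of `.inl 0` is positive. -/
theorem IsRightData.tendsto_hole_left {ε₀ : ℝ} {M p : ℕ} {s : ℝ} {c : ℕ → ℝ → ℝ}
    {g : ℕ → ℝ → ℝ → ℝ} (h : IsRightData ε₀ T4 M p s c g) (hα : 0 < α) (hα1 : α < 1) (h0 : 0 < ε₀)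
    (hε₀ : ε₀ ≤ 1 / 4) {μ : Measure ℝ} {w : ℝ → ℝ} (hμ : IsDensityOn μ w indDomL)
    (hw : Continuous w) (hpos : ∀ x, 0 < w x) : ∃ L : ℝ, 0 < L ∧
      Tendsto (fun ε => (μ (hole (inducedMap α T4 ε) indDomL indDomR)).toReal / ε) (𝓝[>] 0)
        (𝓝 L) := by
  have hz : (0 : ℝ) ∈ Ico 0 ε₀ := ⟨le_rfl, h0⟩
  have he1 : ∀ ε ∈ Ico 0 ε₀, ε ≤ 1 / 4 := fun ε hε => hε.2.le.trans hε₀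
  obtain ⟨K, hK⟩ := (isCompact_Icc (a := (1 / 4 : ℝ)) (b := 1 / 2)).exists_bound_of_continuousOn
    hw.continuousOn
  have hK0 : 0 ≤ K := (norm_nonneg _).trans (hK (1 / 2) ⟨by norm_num, le_rfl⟩)
  let gap : ℕ ⊕ ℕ → ℝ :=
    Sum.elim (fun n => zpt α 0 n - zpt α 0 (n + 1)) (fun n => zpt α 0 n - zpt α 0 (n + 1))
  have hgap0 : ∀ i, 0 ≤ gap i := by
    rintro (n | n) <;> exact zpt_gap_nonneg hα n
  have hgap : Summable gap := Summable.sum _ (summable_zpt_gap hα) (summable_zpt_gap hα)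
  let wt : ℕ ⊕ ℕ → ℝ := fun i =>
    if i = .inr 0 then 0 else w (leftEnd α 0 i) / |deriv (leftExt α 0 i) (leftEnd α 0 i)|
  have hset : ∀ ε ∈ Ico 0 ε₀, ∀ i, leftI α ε i ∩ hole (inducedMap α T4 ε) indDomL indDomR =
      leftI α ε i ∩ inducedMap α T4 ε ⁻¹' indDomR := fun ε hε i => by
    have hsub : leftI α ε i ⊆ indDomL := (leftI_subset hα hε.1 i).trans Ioo_subset_Icc_self
    rw [hole, ← inter_assoc, inter_eq_left.2 hsub]
  have hslope : ∀ i, ∀ ε ∈ Ico 0 ε₀, ∀ x ∈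
      Icc (branchL 0 α (fun _ => id) ε (.inl i)) (branchR 0 α (fun _ => id) ε (.inl i)),
      1 ≤ |deriv (leftExt α ε i) x| := by
    intro i ε hε
    have hcl : IsClosed {x | 1 ≤ |deriv (leftExt α ε i) x|} :=
      isClosed_le continuous_const (((contDiff_slice (G := fun ε => leftExt α ε i)
        (contDiff_leftExt hα i) ε).continuous_deriv
        (show (1 : WithTop ℕ∞) ≤ 2 by norm_num)).abs)
    -- The slope bound is known inside the branch and extends to the end points by continuity of the
    -- derivative of the extension.
    rw [← closure_Ioo (branch_left_lt hα hε.1 i).ne]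
    refine closure_minimal (fun x hx => ?_) hcl
    have heq := leftExt_eqOn (T4 := T4) hα hε.1 (he1 ε hε) i
    have hb := isBranch_left (T4 := T4) hα hα1 hε.1 (he1 ε hε) i
    rw [leftI_eq] at heq hb
    change 1 ≤ |deriv (leftExt α ε i) x|
    rw [eqOn_deriv_of_isOpen isOpen_Ioo heq hx]
    linarith [hb.expand x hx]
  have hterm : ∀ i, Tendsto (fun ε =>
      (∫ x in leftI α ε i ∩ hole (inducedMap α T4 ε) indDomL indDomR, w x) / ε)
      (𝓝[>] 0) (𝓝 (wt i)) := by
    intro i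
    by_cases hi : i = .inr 0
    · have : wt i = 0 := if_pos hi
      rw [this]
      refine tendsto_const_nhds.congr' ?_
      filter_upwards [nhdsGT_le_Ioo h0] with ε hε
      have hε' : ε ∈ Ico 0 ε₀ := ⟨hε.1.le, hε.2⟩
      rw [hset ε hε', hi, left_inter_eq_empty hα hε.1.le (he1 ε hε'), setIntegral_empty, zero_div]
    · have : wt i = w (leftEnd α 0 i) / |deriv (leftExt α 0 i) (leftEnd α 0 i)| := if_neg hi
      rw [this]
      have key := tendsto_component (F := inducedMap α T4) (G := fun ε => leftExt α ε i)
        (a := fun ε => branchL 0 α (fun _ => id) ε (.inl i))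
        (b := fun ε => branchR 0 α (fun _ => id) ε (.inl i))
        (e := fun ε => leftEnd α ε i) (B := indDomR) h0 (contDiff_leftExt hα i)
        (fun ε hε => h.measurable_inducedMap hε α)
        (fun ε hε => by rw [← leftI_eq]; exact leftExt_eqOn hα hε.1 (he1 ε hε) i)
        (hslope i) (fun ε hε => leftEnd_mem hα hε.1 i) (continuousOn_leftEnd hα hε₀ i)
        measurableSet_Icc
        (fun ε hε => by
          rw [← leftI_eq, image_left_inter hα hε.1.le (he1 ε ⟨hε.1.le, hε.2⟩) hi, Real.volume_Ico]
          congr 1; ring)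
        (fun ε hε y hy => by
          rw [← leftI_eq, image_left_inter hα hε.1.le (he1 ε ⟨hε.1.le, hε.2⟩) hi] at hy
          rw [leftExt_leftEnd hα hε.1.le (he1 ε ⟨hε.1.le, hε.2⟩) hi, abs_le]
          constructor <;> linarith [hy.1, hy.2]) hw
      refine key.congr' ?_
      filter_upwards [nhdsGT_le_Ioo h0] with ε hε
      rw [hset ε ⟨hε.1.le, hε.2⟩, leftI_eq]
  have hbound : ∀ᶠ ε in 𝓝[>] (0 : ℝ), ∀ i,
      ‖(∫ x in leftI α ε i ∩ hole (inducedMap α T4 ε) indDomL indDomR, w x) / ε‖ ≤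
        K * (8 * Real.exp 8 * gap i) := by
    filter_upwards [nhdsGT_le_Ioo h0] with ε hε i
    have hε' : ε ∈ Ico 0 ε₀ := ⟨hε.1.le, hε.2⟩
    have hexp := Real.exp_pos 8
    have hg := hgap0 i
    rw [hset ε hε' i]
    by_cases hi : i = .inr 0
    · rw [hi, left_inter_eq_empty hα hε.1.le (he1 ε hε'), setIntegral_empty, zero_div, norm_zero]
      exact mul_nonneg hK0 (mul_nonneg (by positivity) (hgap0 _))
    · have hvol := volume_left_inter_le (T4 := T4) hα hα1 hε.1.le (he1 ε hε') hi
      have h1 := norm_setIntegral_le_of_norm_le_const (f := w) (C := K)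
        (hvol.trans_lt ENNReal.ofReal_lt_top) fun x hx =>
          hK x (Ioo_subset_Icc_self (leftI_subset hα hε.1.le i hx.1))
      have h2 : volume.real (leftI α ε i ∩ inducedMap α T4 ε ⁻¹' indDomR) ≤
          8 * Real.exp 8 * gap i * ε :=
        ENNReal.toReal_le_of_le_ofReal (mul_nonneg (by positivity) hε.1.le) hvol
      rw [norm_div, Real.norm_of_nonneg hε.1.le, div_le_iff₀ hε.1, mul_assoc]
      exact h1.trans (mul_le_mul_of_nonneg_left h2 hK0)
  have hbs : Summable fun i => K * (8 * Real.exp 8 * gap i) := (hgap.mul_left _).mul_left _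
  have hlim := tendsto_tsum_of_dominated_convergence hbs hterm hbound
  have hwt0 : ∀ i, i ≠ .inr 0 → 0 < wt i := fun i hi => by
    have e : wt i = w (leftEnd α 0 i) / |deriv (leftExt α 0 i) (leftEnd α 0 i)| := if_neg hi
    rw [e]
    exact div_pos (hpos _) (zero_lt_one.trans_le (hslope i 0 hz _ (leftEnd_mem hα le_rfl i)))
  have hwt : ∀ i, 0 ≤ wt i := fun i => by
    by_cases hi : i = .inr 0
    · exact (if_pos hi : wt i = 0).ge
    · exact (hwt0 i hi).le
  have hws : Summable wt := by
    refine Summable.of_nonneg_of_le hwt (fun i => ?_) hbs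
    exact le_of_tendsto (hterm i) (hbound.mono fun ε hε => (Real.le_norm_self _).trans (hε i))
  refine ⟨_, hws.tsum_pos hwt (.inl 0) (hwt0 _ (by simp)), hlim.congr' ?_⟩
  filter_upwards [nhdsGT_le_Ioo h0] with ε hε
  have hε' : ε ∈ Ico 0 ε₀ := ⟨hε.1.le, hε.2⟩
  have hA : MeasurableSet (hole (inducedMap α T4 ε) indDomL indDomR) :=
    measurableSet_Icc.inter (h.measurable_inducedMap hε' α measurableSet_Icc)
  rw [hμ.toReal_eq_tsum hw hA inter_subset_left (fun i => (isOpen_leftI i).measurableSet)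
    (disjoint_leftI hα hε.1.le) (countable_left hα hε.1.le), tsum_div_const]

end left

/-! ### Invariant sides, orbits of the partition points, behaviour at 1/2, and conclusion. -/

namespace IsRightData

variable {ε₀ : ℝ} {T4 : ℝ → ℝ → ℝ} {M p : ℕ} {s : ℝ} {c : ℕ → ℝ → ℝ} {g : ℕ → ℝ → ℝ → ℝ} {α : ℝ}

theorem inducedMap_one (h : IsRightData ε₀ T4 M p s c g) (hε₀ : ε₀ ≤ 1 / 4) {ε : ℝ}
    (hε : ε ∈ Ico 0 ε₀) : inducedMap α T4 ε 1 = 1 := by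
  rw [h.inducedMap_eq hε₀ hε ⟨by norm_num, le_rfl⟩]
  have := h.odd ε hε (2 * M + 1) le_rfl ⟨M, rfl⟩
  rwa [h.c_last ε hε] at this

theorem condA4 (h : IsRightData ε₀ T4 M p s c g) (hα : 0 < α) (h0 : 0 < ε₀) (hε₀ : ε₀ ≤ 1 / 4) :
    CondA4 (inducedMap α T4 0) indDom indDomL indDomR (1 / 2) := by
  refine ⟨?_, ordConnected_Icc, ordConnected_Icc, Icc_union_Icc_eq_Icc (by norm_num) (by norm_num),
    ?_, h.mapsTo_indDomL_zero hα h0 hε₀, h.mapsTo_indDomR_zero h0 hε₀⟩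
  · rw [indDom, interior_Icc]
    constructor <;> norm_num
  · rw [indDomL, indDomR, Icc_inter_Icc_eq_singleton (by norm_num) (by norm_num)]

/-- After one step a partition point sits at a fixed point y. If y is mapped to 1/2, then y = 1/2,
which is excluded from the infinitesimal holes. -/
theorem condA5 (h : IsRightData ε₀ T4 M p s c g) (hα : 0 < α) (h0 : 0 < ε₀) (hε₀ : ε₀ ≤ 1 / 4)
    {l r : ℕ → ℝ} (hP : ∀ x ∈ partitionPoints indDom l r,
      inducedMap α T4 0 x ∈ ({1 / 2, 3 / 8, 1} : Set ℝ)) :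
    CondA5 (inducedMap α T4 0) indDom (1 / 2) l r := by
  have hz : (0 : ℝ) ∈ Ico 0 ε₀ := ⟨le_rfl, h0⟩
  have hfix : ∀ y ∈ ({1 / 2, 3 / 8, 1} : Set ℝ), inducedMap α T4 0 y = y := by
    rintro y (rfl | rfl | rfl)
    · exact h.inducedMap_half hε₀ hz α
    · exact inducedMap_three_eighths hα
    · exact h.inducedMap_one hε₀ hz
  intro n hn
  obtain ⟨n, rfl⟩ : ∃ m, n = m + 1 := ⟨n - 1, by omega⟩
  refine eq_empty_of_forall_notMem ?_
  rintro _ ⟨⟨x, hx, rfl⟩, ⟨-, hb⟩, hne⟩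
  have hmem := hP x hx
  rw [Function.iterate_succ_apply, Function.iterate_fixed (hfix _ hmem)] at hb hne
  rw [hfix _ hmem] at hb
  exact hne hb

theorem condB4 (h : IsRightData ε₀ T4 M p s c g) (h0 : 0 < ε₀) (hε₀ : ε₀ ≤ 1 / 4)
    {l r : ℝ → ℕ → ℝ} (hb : 1 / 2 ∉ partitionPoints indDom (l 0) (r 0)) :
    CondB4 (inducedMap α T4) indDom (1 / 2) ε₀ l r :=
  ⟨fun _ => ⟨h.inducedMap_half hε₀ ⟨le_rfl, h0⟩ α,
    fun _ hε => h.inducedMap_half hε₀ ⟨hε.1.le, hε.2⟩ α⟩, fun hb' => (hb hb').elim⟩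

end IsRightData

theorem lemma3p1 (α ε₀ : ℝ) (hα : α ∈ Ioo (0 : ℝ) 1) (hε₀ : 0 < ε₀) (hε₀' : ε₀ ≤ 1 / 4)
    (T4 : ℝ → ℝ → ℝ) (hT4 : IsRightFamily ε₀ T4) :
    (∀ ε ∈ Ico 0 ε₀, MapsTo (inducedMap α T4 ε) indDom indDom) ∧
    ∃ (μl μr : Measure ℝ) (hl hr : ℝ → ℝ) (l r : ℝ → ℕ → ℝ) (δ : ℝ) (Tbar : ℝ → ℕ → ℝ → ℝ),
      -- (1) the densities of the unperturbed induced map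
      ((∃ K, LipschitzOnWith K hl indDomL) ∧ (∃ a > 0, ∀ x ∈ indDomL, a ≤ hl x) ∧
        (∃ K, LipschitzOnWith K hr indDomR) ∧ (∃ a > 0, ∀ x ∈ indDomR, a ≤ hr x)) ∧
      -- (2) (A1) - (A6) for the unperturbed induced map
      (CondA1 (inducedMap α T4 0) indDom (l 0) (r 0) δ (Tbar 0) ∧
        CondA2 (inducedMap α T4 0) indDom (l 0) (r 0) ∧
        CondA3 (inducedMap α T4 0) (l 0) (r 0) ∧
        CondA4 (inducedMap α T4 0) indDom indDomL indDomR (1 / 2) ∧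
        CondA5 (inducedMap α T4 0) indDom (1 / 2) (l 0) (r 0) ∧
        CondA6 (inducedMap α T4 0) indDom indDomL indDomR (1 / 2) (l 0) (r 0) μl μr hl hr) ∧
      -- (3) (B1) - (B4) for the perturbed induced maps
      (CondB1 (inducedMap α T4) indDom ε₀ l r δ Tbar ∧
        CondB2 (inducedMap α T4) ε₀ l r ∧
        CondB3 (inducedMap α T4) indDom ε₀ ∧
        (∀ ε ∈ Ico 0 ε₀, inducedMap α T4 ε (1 / 2) = 1 / 2) ∧
        ((∀ ε ∈ Ico 0 ε₀, ContDiffAt ℝ 2 (intermittentMap α T4 ε) (1 / 2)) →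
          CondB4 (inducedMap α T4) indDom (1 / 2) ε₀ l r)) ∧
      -- (4) the limiting hole ratio
      ∃ L : ℝ, 0 < L ∧
        Tendsto (fun ε =>
          (μr (hole (inducedMap α T4 ε) indDomR indDomL)).toReal /
            (μl (hole (inducedMap α T4 ε) indDomL indDomR)).toReal) (𝓝[>] 0) (𝓝 L) := by
  obtain ⟨M, p, s, c, g, h⟩ := hT4.exists_data
  have hz : (0 : ℝ) ∈ Ico 0 ε₀ := ⟨le_rfl, hε₀⟩
  refine ⟨fun ε hε => h.mapsTo_indDom hα.1 hε₀' hε, ?_⟩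
  obtain ⟨μl, hl, Kl, al, l1, l2, l3, l4, l5, l6, l7, l8⟩ := exists_full_component (by norm_num)
    (h.isPiecewiseExpanding_left hα.1 hα.2 hε₀)
  obtain ⟨D, lam, hright⟩ := h.exists_isPiecewiseExpanding_right (α := α) hε₀ hε₀'
  obtain ⟨μr, hr, Kr, ar, r1, r2, r3, r4, r5, r6, r7, r8⟩ := exists_full_component (by norm_num)
    hright
  obtain ⟨l, r, B, hP, hpts, hhalf⟩ := h.exists_partition hα.1 hα.2 hε₀ hε₀'
  have hA4 := h.condA4 hα.1 hε₀ hε₀'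
  obtain ⟨D', lam', hD', -, hexp⟩ := hP.exists_expand hε₀
  obtain ⟨L₁, hL₁, hlim₁⟩ := h.tendsto_hole_right (α := α) hε₀ hε₀' r4 r1.continuous
    fun x => r2.trans_le (r3 x)
  obtain ⟨L₂, hL₂, hlim₂⟩ := h.tendsto_hole_left hα.1 hα.2 hε₀ hε₀' l4 l1.continuous
    fun x => l2.trans_le (l3 x)
  refine ⟨μl, μr, hl, hr, l, r, 1, B,
    ⟨⟨Kl, l1.lipschitzOnWith⟩, ⟨al, l2, fun x _ => l3 x⟩, ⟨Kr, r1.lipschitzOnWith⟩,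
      ⟨ar, r2, fun x _ => r3 x⟩⟩,
    ⟨hP.condA1 hε₀ one_pos, hP.condA2 hε₀, hP.condA3 hz, hA4, h.condA5 hα.1 hε₀ hε₀' hpts,
      ⟨D', hD', fun i x hx => (hexp i x hx).2⟩, ?_,
      acim_ergodic_iff hA4.2.2.2.1 measurableSet_Icc hA4.2.2.2.2.2.1 l5 l6 l7 r5 r6 r7,
      l8, r8, l4, r4, fun x _ => l2.trans_le (l3 x), fun x _ => r2.trans_le (r3 x)⟩,
    ⟨hP.condB1 hε₀ (by norm_num), fun ε hε => hP.condA3 ⟨hε.1.le, hε.2⟩, h.condB3 hα.1 hα.2 hε₀',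
      fun ε hε => h.inducedMap_half hε₀' hε α, fun H => h.condB4 hε₀ hε₀' (hhalf H)⟩,
    L₁ / L₂, div_pos hL₁ hL₂, ?_⟩
  -- The two measures differ because the point 1 lies in the support of only one of them.
  · rintro rfl
    have h1 : (1 : ℝ) ∈ Icc (1 / 4 : ℝ) (1 / 2) := by
      rw [← l8, r8]
      constructor <;> norm_num
    norm_num at h1
  -- Both masses are of exact order ε, and ε cancels in the quotient.
  · refine (hlim₁.div hlim₂ hL₂.ne').congr' ?_
    filter_upwards [self_mem_nhdsWithin] with ε hε
    exact div_div_div_cancel_right₀ (ne_of_gt hε) _ _
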